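/- Young's graph is the Hasse diagram of the lattice of integer partitions ordered by containment of Young diagrams. For a partition $\lambda$ let $f_\lambda$ be the number of saturated chains in this lattice from $\emptyset$ to $\lambda$, and call $\lambda$ odd if $f_\lambda$ is odd. A partition of $n\ge 1$ is a hook if it is $(j,1^{n-j})$ for some $1\le j\le n$, and it is one-dimensional if it is $(n)$ or $(1^n)$. Let $M$ be the subgraph of Young's graph induced by the odd partitions, and let $M_k$ be its first $2^k$ rows, i.e. the subgraph induced by the odd partitions of $0,1,\dots,2^k-1$. The top row of $M_k$ consists of the odd partitions of $2^k-1$. **Theorem (Recursive description of $M$).** The graph $M$ is a binary tree rooted at $\emptyset$ (a tree in which every node has at most two children), and every nonempty odd partition covers exactly one odd partition. The tree $M_2$ has exactly the six vertices $\emptyset,(1),(2),(1,1),(3),(1,1,1)$ and the five edges $\emptyset-(1)$, $(1)-(2)$, $(1)-(1,1)$, $(2)-(3)$, $(1,1)-(1,1,1)$. For each $k\ge 2$: 1. $M_{k+1}$ is obtained from $M_k$ by attaching two disjoint copies of $M_k$ to each hook in the top row of $M_k$, each copy being attached by one edge from the hook to the root of the copy. (This means: there is a graph isomorphism from the graph so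 constructed onto $M_{k+1}$ that is the identity on the original $M_k$.) Moreover, this identification can be made so that, for each one-dimensional node $s$ in the top row of $M_k$, one of the two copies attached to $s$ is distinguished and the following hold: 2. The hooks in the top row of $M_{k+1}$ are exactly the nodes that correspond to the hooks in the top row of $M_k$ in the distinguished copies. 3. Every one-dimensional node in the top row of $M_{k+1}$ corresponds to a one-dimensional node of the top row of $M_k$ in one of the distinguished copies; and in each distinguished copy, exactly one of the one-dimensional nodes of the top row of $M_k$ becomes a one-dimensional node in the top row of $M_{k+1}$. Consequently, for $n\ge 1$, the restriction to $S_{n-1}$ of an odd-dimensional irreducible complex representation of $S_n$ contains exactly one odd-dimensional irreducible representation of $S_{n-1}$; that is, it has exactly one $S_{n-1}$-invariant subspace that is irreducible and odd-dimensional. -/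

import Mathlib

namespace Macdonald

/-- The number `f_μ` of saturated chains `∅ = μ₀ ⋖ μ₁ ⋖ ⋯ ⋖ μₙ = μ` in Young's lattice. -/
noncomputable def numChains (μ : YoungDiagram) : ℕ :=
  Nat.card {c : RelSeries {p : YoungDiagram × YoungDiagram | p.1 ⋖ p.2} //
    c.head = ⊥ ∧ c.last = μ}

/-- A partition `μ` is odd if `f_μ` is odd. -/
def IsOddPartition (μ : YoungDiagram) : Prop := Odd (numChains μ)

/-- `μ = (k, 1^{n-k})` for some `1 ≤ k ≤ n`, where `n` is the size of `μ`. -/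
def IsHook (μ : YoungDiagram) : Prop :=
  ∃ k, 1 ≤ k ∧ k ≤ μ.card ∧ μ.rowLens = k :: List.replicate (μ.card - k) 1

/-- `μ = (n)` or `μ = (1^n)`, where `n ≥ 1` is the size of `μ`. -/
def IsOneDim (μ : YoungDiagram) : Prop :=
  1 ≤ μ.card ∧ (μ.rowLens = [μ.card] ∨ μ.rowLens = List.replicate μ.card 1)

theorem isOddPartition_bot : IsOddPartition ⊥ := by
  have h : numChains ⊥ = 1 := by
    rw [numChains, Nat.card_eq_one_iff_unique]
    refine ⟨⟨?_⟩, ⟨⟨RelSeries.singleton _ ⊥, by simp, by simp⟩⟩⟩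
    have key : ∀ c : RelSeries {p : YoungDiagram × YoungDiagram | p.1 ⋖ p.2},
        c.last = ⊥ → c.length = 0 := by
      intro c hl
      by_contra hne
      have hs := c.step ⟨c.length - 1, by omega⟩
      have hlast : (Fin.succ (⟨c.length - 1, by omega⟩ : Fin c.length)) = Fin.last c.length := by
        ext; simp; omega
      rw [hlast] at hs
      have h2 : c.toFun (Fin.last c.length) = ⊥ := hl
      rw [h2] at hs
      exact not_lt_bot hs.lt
    rintro ⟨c, hc, hc'⟩ ⟨d, hd, hd'⟩
    have h1 := key c hc'
    have h2 := key d hd'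
    refine Subtype.ext (RelSeries.ext (h1.trans h2.symm) ?_)
    funext i
    have hi : i = 0 := by
      ext
      have h3 := i.2
      have h4 : c.length = 0 := h1
      simp only [Fin.val_zero]
      change (i : ℕ) < c.length + 1 at h3
      omega
    subst hi
    exact hc.trans hd.symm
  rw [IsOddPartition, h]
  exact odd_one

/-- The Macdonald tree `M`: the subgraph of Young's graph (the Hasse diagram of Young's lattice)
induced by the odd partitions. -/
abbrev tree : SimpleGraph {μ : YoungDiagram | IsOddPartition μ} :=
  (SimpleGraph.hasse YoungDiagram).induce {μ | IsOddPartition μ}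

/-- The vertices of `M_k`: the odd partitions of `0, 1, …, 2^k - 1`. -/
abbrev Vert (k : ℕ) : Set YoungDiagram := {μ | IsOddPartition μ ∧ μ.card < 2 ^ k}

/-- `M_k`: the first `2^k` rows of `M`. -/
abbrev truncTree (k : ℕ) : SimpleGraph (Vert k) :=
  (SimpleGraph.hasse YoungDiagram).induce (Vert k)

/-- The empty partition, as the root of `M`. -/
def root : {μ : YoungDiagram | IsOddPartition μ} := ⟨⊥, isOddPartition_bot⟩

/-- The empty partition, as the root of `M_k`. -/
def truncRoot (k : ℕ) : Vert k :=
  ⟨⊥, isOddPartition_bot, by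
    have : (⊥ : YoungDiagram).card = 0 := by simp [YoungDiagram.card]
    rw [this]; positivity⟩

/-- The top row of `M_k`: the odd partitions of `2^k - 1`. -/
def topRow (k : ℕ) : Set (Vert k) := {μ | μ.1.card = 2 ^ k - 1}

/-- The hooks in the top row of `M_k`. -/
def topHooks (k : ℕ) : Set (Vert k) := {μ | μ ∈ topRow k ∧ IsHook μ.1}

/-- The one-dimensional nodes in the top row of `M_k`. -/
def topOneDims (k : ℕ) : Set (Vert k) := {μ | μ ∈ topRow k ∧ IsOneDim μ.1}

/-- A graph is a binary tree with root `r` if it is a tree and each vertex has at most two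
children, i.e. neighbours that are one step further away from `r`. -/
def IsRootedBinaryTree {V : Type*} (G : SimpleGraph V) (r : V) : Prop :=
  G.IsTree ∧ ∀ v, {w | G.Adj v w ∧ G.dist r w = G.dist r v + 1}.encard ≤ 2

/-- Given a graph `G` with root `r` and a set `S` of vertices, attach to each `s ∈ S` two disjoint
copies of `G`, each through one new edge from `s` to the root of the copy. The original graph is
`Sum.inl`, and `Sum.inr (s, i, v)` is the vertex `v` of the `i`-th copy attached to `s`. -/
def attachTwoCopies {V : Type*} (G : SimpleGraph V) (r : V) (S : Set V) :
    SimpleGraph (V ⊕ (S × Fin 2 × V)) where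
  Adj
    | .inl u, .inl v => G.Adj u v
    | .inl u, .inr (s, _, v) => u = s ∧ v = r
    | .inr (s, _, v), .inl u => u = s ∧ v = r
    | .inr (s, i, u), .inr (t, j, v) => s = t ∧ i = j ∧ G.Adj u v
  symm := ⟨by
    rintro (u | ⟨s, i, u⟩) (v | ⟨t, j, v⟩) h
    · exact G.adj_symm h
    · exact h
    · exact h
    · exact ⟨h.1.symm, h.2.1.symm, G.adj_symm h.2.2⟩⟩
  loopless := ⟨by
    rintro (u | ⟨s, i, u⟩) h
    · exact G.irrefl h
    · exact G.irrefl h.2.2⟩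

/-- The tree on `0, …, 5` with edges `01`, `12`, `13`, `24`, `35`. -/
def sixTree : SimpleGraph (Fin 6) :=
  SimpleGraph.fromEdgeSet {s(0, 1), s(1, 2), s(1, 3), s(2, 4), s(3, 5)}

/-- The embedding of `S_n` in `S_{n+1}` as the permutations that fix the last point. -/
noncomputable def permIncl (n : ℕ) : Equiv.Perm (Fin n) →* Equiv.Perm (Fin (n + 1)) :=
  Equiv.Perm.viaEmbeddingHom Fin.castSuccEmb

end Macdonald

open Macdonald

namespace Macdonald

/-! A partition is encoded by an abacus with `m` beads at the positions `μ_i + m - 1 - i`. Removing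
a rim hook of length `q` means moving one bead down by `q` to a free position. The number `f_μ`
counts the ways (`cnt`) to reach the ground state by unit moves.

Modulo 2 this count can be extended by zero to all bead vectors in `ℤ^m`: the sign of the usual
alternating extension disappears. The extension still obeys the recursion given by the operator `D =
∑ S_i`, where `S_i` lowers coordinate `i` by one. The `S_i` commute, so in characteristic 2 the
power `D^(2^k)` equals `∑ S_i^(2^k)`; this is `cnt_two_pow_add`. If the size is `2^k + r` with `r <
2^k`, what remains after removing a hook of length `2^k` is a `2^k`-core whenever its count is
nonzero, so at most one summand survives. Hence a partition of `2^k + r` is odd iff a rim hook of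
length `2^k` can be removed from it so that an odd partition, its core, remains
(`odd_cnt_two_pow_add`). In particular the odd partitions of `2^k` are exactly its hooks.

Removing a box commutes with passing to the core (`Rem.exists_lower`, `Rem.lower_unique`,
`Rem.exists_upper`, `Rem.upper_unique`). So for sizes strictly between `2^k` and `2^(k+1)` the odd
lower neighbours of a partition correspond to those of its core, and induction gives a unique one.
At size `2^k` a hook has at most two lower neighbours, and an odd sum of at most two terms has
exactly one odd term (`existsUnique_odd_rem`).

Upwards, the same correspondence makes the part of `M_{k+1}` above each odd partition of `2^k` a
copy of `M_k`: an odd partition is determined by its ancestor of size `2^k` and its core, and all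
pairs occur. Every odd hook of size `2^k - 1` is covered by two hooks of size `2^k`, both odd, and
every odd partition of `2^k` lies above such a hook. This gives the two attached copies. The core of
a hook of size `2^(k+1) - 1` is a hook with shorter arm or shorter leg; its ancestor of size `2^k`
is then the row or the column. The distinguished copies are therefore the ones above the row and the
column.

For the representations, Young's orthogonal form is built on functions on paths, with the Coxeter
presentation supplying the action. Jucys-Murphy elements separate the paths and yield matrix units.
Since `∑ f_μ^2 = n!`, these span the group algebra, so every irreducible representation has this
form. Its restriction to `S_n` splits according to the last move into pieces of dimension `f_ν`, one
for each `ν ⋖ μ`, and every nonzero invariant subspace contains one of them. The unique odd `ν`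
gives the unique odd-dimensional constituent. -/

open Finset

/-! ### Abaci, moves of beads and levels -/

/-- Move the bead at `c + q` of the abacus `X` to the free position `c`. -/
def slide (q c : ℕ) (X : Finset ℕ) : Finset ℕ := insert c (X.erase (c + q))

/-- The free positions to which a bead of the abacus `X` can be moved down by `q`. -/
def dn (q : ℕ) (X : Finset ℕ) : Finset ℕ :=
  (X.image (· - q)).filter fun c => c ∉ X ∧ c + q ∈ X

/-- `A` arises from `X` by moving one bead down by `q`, i.e. by removing a rim hook of length `q`. -/
def Rem (q : ℕ) (X A : Finset ℕ) : Prop := ∃ c, c ∉ X ∧ c + q ∈ X ∧ A = slide q c X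

/-- The number of ways to reach the ground state from the abacus `X` in `n` unit moves. -/
def cnt : ℕ → Finset ℕ → ℕ
  | 0, X => if X = range X.card then 1 else 0
  | n + 1, X => ∑ c ∈ dn 1 X, cnt n (slide 1 c X)

theorem mem_dn {q c : ℕ} {X : Finset ℕ} : c ∈ dn q X ↔ c ∉ X ∧ c + q ∈ X := by
  simp only [dn, mem_filter, mem_image, and_iff_right_iff_imp]
  rintro ⟨-, h⟩
  exact ⟨c + q, h, by simp⟩

theorem mem_slide {q c z : ℕ} {X : Finset ℕ} :
    z ∈ slide q c X ↔ z = c ∨ (z ≠ c + q ∧ z ∈ X) := by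
  simp [slide]

theorem card_slide {q c : ℕ} {X : Finset ℕ} (hc : c ∉ X) (hcq : c + q ∈ X) :
    (slide q c X).card = X.card := by
  have hpos : 0 < X.card := card_pos.2 ⟨_, hcq⟩
  rw [slide, card_insert_of_notMem (fun h => hc (mem_of_mem_erase h)), card_erase_of_mem hcq]
  omega

theorem sum_slide {q c : ℕ} {X : Finset ℕ} (hc : c ∉ X) (hcq : c + q ∈ X) :
    ∑ x ∈ slide q c X, x + q = ∑ x ∈ X, x := by
  rw [slide, sum_insert (fun h => hc (mem_of_mem_erase h)), ← add_sum_erase _ _ hcq]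
  ring

theorem Rem.card_eq {q : ℕ} {X A : Finset ℕ} (h : Rem q X A) : A.card = X.card := by
  obtain ⟨c, h1, h2, rfl⟩ := h
  exact card_slide h1 h2

theorem Rem.sum_eq {q : ℕ} {X A : Finset ℕ} (h : Rem q X A) : ∑ x ∈ A, x + q = ∑ x ∈ X, x := by
  obtain ⟨c, h1, h2, rfl⟩ := h
  exact sum_slide h1 h2

/-- The abacus `X` represents a partition of `n`. -/
def Lev (n : ℕ) (X : Finset ℕ) : Prop := ∑ x ∈ X, x = ∑ i ∈ range X.card, i + n

theorem eq_range_of_dn_eq_empty {X : Finset ℕ} (h : dn 1 X = ∅) : X = range X.card := by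
  have hd : ∀ c, c + 1 ∈ X → c ∈ X := by
    intro c hc
    by_contra hn
    have : c ∈ dn 1 X := mem_dn.2 ⟨hn, hc⟩
    simp [h] at this
  have hd2 : ∀ k c, c + k ∈ X → c ∈ X := by
    intro k
    induction k with
    | zero => simp
    | succ k ih => exact fun c hc => ih c (hd _ (by rwa [add_assoc]))
  rcases X.eq_empty_or_nonempty with rfl | hne
  · simp
  · have hX : X = range (X.max' hne + 1) := by
      ext z
      simp only [mem_range, Nat.lt_succ_iff]
      refine ⟨fun hz => X.le_max' z hz, fun hz => hd2 (X.max' hne - z) z ?_⟩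
      rw [Nat.add_sub_cancel' hz]
      exact X.max'_mem hne
    rw [hX, card_range]

/-- Unit moves lower the sum of the positions and can be continued until the ground state is
reached. -/
theorem sum_range_card_le (X : Finset ℕ) : ∑ i ∈ range X.card, i ≤ ∑ x ∈ X, x := by
  induction hs : ∑ x ∈ X, x using Nat.strong_induction_on generalizing X with
  | _ s ih =>
    rcases (dn 1 X).eq_empty_or_nonempty with h | ⟨c, hc⟩
    · rw [← hs, ← eq_range_of_dn_eq_empty h]
    · obtain ⟨h1, h2⟩ := mem_dn.1 hc
      have h3 := sum_slide h1 h2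
      have := ih _ (by omega) (slide 1 c X) rfl
      rw [card_slide h1 h2] at this
      omega

theorem Lev.rem {n q : ℕ} {X A : Finset ℕ} (hX : Lev n X) (h : Rem q X A) :
    q ≤ n ∧ Lev (n - q) A := by
  have h1 := h.sum_eq
  have h2 := sum_range_card_le A
  have h3 := h.card_eq
  unfold Lev at *
  rw [h3] at h2 ⊢
  omega

theorem Rem.lev {n q : ℕ} {X A : Finset ℕ} (h : Rem q X A) (hA : Lev n A) : Lev (n + q) X := by
  have h1 := h.sum_eq
  have h3 := h.card_eq
  unfold Lev at *
  rw [h3] at hA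
  omega

theorem Lev.eq {n k : ℕ} {X : Finset ℕ} (h : Lev n X) (h' : Lev k X) : n = k := by
  unfold Lev at *
  omega

theorem lev_zero_range (m : ℕ) : Lev 0 (range m) := by simp [Lev]

theorem Lev.eq_range {X : Finset ℕ} (h : Lev 0 X) : X = range X.card := by
  apply eq_range_of_dn_eq_empty
  by_contra hne
  obtain ⟨c, hc⟩ := nonempty_iff_ne_empty.2 hne
  obtain ⟨h1, h2⟩ := mem_dn.1 hc
  have := (h.rem ⟨c, h1, h2, rfl⟩).1
  omega

theorem Lev.exists_dn {n : ℕ} {X : Finset ℕ} (h : Lev (n + 1) X) : ∃ c, c ∈ dn 1 X := by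
  by_contra hne
  push Not at hne
  have := eq_range_of_dn_eq_empty (eq_empty_of_forall_notMem hne)
  rw [this] at h
  have := h.eq (lev_zero_range _)
  omega

theorem lev_of_cnt_ne_zero {n : ℕ} {X : Finset ℕ} (h : cnt n X ≠ 0) : Lev n X := by
  induction n generalizing X with
  | zero =>
    have hX : X = range X.card := by
      by_contra hne
      simp [cnt, hne] at h
    rw [hX]
    exact lev_zero_range _
  | succ n ih =>
    obtain ⟨c, hc, hne⟩ := exists_ne_zero_of_sum_ne_zero (show ∑ c ∈ dn 1 X, cnt n (slide 1 c X) ≠ 0 from h)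
    obtain ⟨h1, h2⟩ := mem_dn.1 hc
    exact Rem.lev ⟨c, h1, h2, rfl⟩ (ih hne)

/-- With more beads than boxes the last row is empty. If `0` were free, all beads could be shifted
down by one, and the sum would drop below that of the ground state. -/
theorem zero_mem_of_lev {n : ℕ} {X : Finset ℕ} (h : Lev n X) (hn : n < X.card) : 0 ∈ X := by
  by_contra h0
  have h1 : ∑ x ∈ X.image (· - 1), x + X.card = ∑ x ∈ X, x := by
    rw [sum_image]
    · rw [card_eq_sum_ones, ← sum_add_distrib]
      refine sum_congr rfl fun x hx => Nat.sub_add_cancel (Nat.pos_of_ne_zero ?_)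
      rintro rfl
      exact h0 hx
    · intro x hx y hy hxy
      have hx0 : x ≠ 0 := by rintro rfl; exact h0 hx
      have hy0 : y ≠ 0 := by rintro rfl; exact h0 hy
      simp only at hxy
      omega
  have h2 : (X.image (· - 1)).card = X.card := by
    refine card_image_of_injOn ?_
    intro x hx y hy hxy
    have hx0 : x ≠ 0 := by rintro rfl; exact h0 hx
    have hy0 : y ≠ 0 := by rintro rfl; exact h0 hy
    simp only at hxy
    omega
  have h3 := sum_range_card_le (X.image (· - 1))
  rw [h2] at h3
  unfold Lev at h
  omega

/-! ### Removal of rim hooks of length `2^k`, modulo two -/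

section Vectors

variable {m : ℕ}

/-- Extension of a function of abaci to bead vectors, zero on vectors that are no abaci. -/
noncomputable def vecExt (F : Finset ℕ → ZMod 2) (v : Fin m → ℤ) : ZMod 2 :=
  open Classical in
  if Function.Injective v ∧ ∀ i, 0 ≤ v i then F (univ.image fun i => (v i).toNat) else 0

/-- Over `ZMod 2` symmetric and alternating are the same, so the extension may simply forget the
order of the beads. -/
theorem vecExt_comp_equiv (F : Finset ℕ → ZMod 2) (v : Fin m → ℤ) (e : Equiv.Perm (Fin m)) :
    vecExt F (v ∘ e) = vecExt F v := by
  have h1 : (Function.Injective (v ∘ e) ∧ ∀ i, 0 ≤ (v ∘ e) i) ↔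
      (Function.Injective v ∧ ∀ i, 0 ≤ v i) := by
    rw [Function.Injective.of_comp_iff' v e.bijective]
    refine and_congr_right fun _ => ⟨fun h i => ?_, fun h i => h _⟩
    simpa using h (e.symm i)
  have h2 : (univ.image fun i => ((v ∘ e) i).toNat) = univ.image fun i => (v i).toNat := by
    ext z
    simp only [mem_image, mem_univ, true_and, Function.comp]
    exact ⟨fun ⟨i, hi⟩ => ⟨e i, hi⟩, fun ⟨i, hi⟩ => ⟨e.symm i, by simpa using hi⟩⟩
  simp only [vecExt, h1, h2]

/-- Lowering coordinate `i` by `q` either is a legal move of that bead or leads to a collision or a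
negative position, where the extension vanishes. -/
theorem vecExt_sub_single (F : Finset ℕ → ZMod 2) {v : Fin m → ℤ} (hv : Function.Injective v)
    (h0 : ∀ i, 0 ≤ v i) {q : ℕ} (hq : 0 < q) (i : Fin m) :
    vecExt F (v - Pi.single i (q : ℤ)) =
      if q ≤ (v i).toNat ∧ (v i).toNat - q ∉ univ.image (fun i => (v i).toNat) then
        F (slide q ((v i).toNat - q) (univ.image fun i => (v i).toNat)) else 0 := by
  have hval : ∀ j, (v - Pi.single i (q : ℤ) : Fin m → ℤ) j = if j = i then v i - q else v j := by
    intro j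
    rcases eq_or_ne j i with rfl | h <;> simp [*]
  have hiff : (Function.Injective (v - Pi.single i (q : ℤ) : Fin m → ℤ) ∧
      ∀ j, 0 ≤ (v - Pi.single i (q : ℤ) : Fin m → ℤ) j) ↔
      (q ≤ (v i).toNat ∧ (v i).toNat - q ∉ univ.image (fun i => (v i).toNat)) := by
    constructor
    · rintro ⟨hinj, hpos⟩
      have h1 := hpos i
      rw [hval, if_pos rfl] at h1
      refine ⟨by omega, ?_⟩
      simp only [mem_image, mem_univ, true_and, not_exists]
      intro j hj
      have h2 := h0 j
      have hji : j ≠ i := by rintro rfl; omega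
      refine hji (hinj ?_)
      rw [hval, hval, if_pos rfl, if_neg hji]
      omega
    · rintro ⟨h1, h2⟩
      simp only [mem_image, mem_univ, true_and, not_exists] at h2
      have h3 : ∀ j, v j ≠ v i - q := by
        intro j hj
        apply h2 j
        omega
      constructor
      · intro a b hab
        rw [hval, hval] at hab
        split_ifs at hab with ha hb hb
        · rw [ha, hb]
        · exact absurd hab.symm (h3 b)
        · exact absurd hab (h3 a)
        · exact hv hab
      · intro j
        rw [hval]
        split_ifs
        · omega
        · exact h0 j
  unfold vecExt
  rw [if_congr hiff rfl rfl]
  split_ifs with h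
  · congr 1
    ext z
    simp only [mem_image, mem_univ, true_and, mem_slide, hval]
    constructor
    · rintro ⟨j, rfl⟩
      split_ifs with hj
      · left; omega
      · right
        refine ⟨fun hz => hj (hv ?_), j, rfl⟩
        have := h0 j
        have := h0 i
        omega
    · rintro (rfl | ⟨hz, j, rfl⟩)
      · exact ⟨i, by rw [if_pos rfl]; omega⟩
      · refine ⟨j, ?_⟩
        rw [if_neg]
        rintro rfl
        apply hz
        omega
  · rfl

theorem sum_vecExt_sub_single (F : Finset ℕ → ZMod 2) {v : Fin m → ℤ} (hv : Function.Injective v)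
    (h0 : ∀ i, 0 ≤ v i) {q : ℕ} (hq : 0 < q) :
    ∑ i, vecExt F (v - Pi.single i (q : ℤ)) =
      ∑ c ∈ dn q (univ.image fun i => (v i).toNat),
        F (slide q c (univ.image fun i => (v i).toNat)) := by
  simp only [vecExt_sub_single F hv h0 hq]
  rw [← sum_filter]
  refine sum_bij (fun i _ => (v i).toNat - q) ?_ ?_ ?_ ?_
  · intro i hi
    simp only [mem_filter, mem_univ, true_and] at hi
    rw [mem_dn, Nat.sub_add_cancel hi.1]
    exact ⟨hi.2, mem_image_of_mem (fun i => (v i).toNat) (mem_univ i)⟩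
  · intro i hi j hj hij
    simp only [mem_filter, mem_univ, true_and] at hi hj
    apply hv
    have := h0 j
    have := h0 i
    omega
  · intro c hc
    rw [mem_dn] at hc
    obtain ⟨h1, h2⟩ := hc
    obtain ⟨i, -, hi⟩ := mem_image.1 h2
    have hci : (v i).toNat - q = c := by omega
    refine ⟨i, ?_, hci⟩
    simp only [mem_filter, mem_univ, true_and, hci]
    exact ⟨by omega, h1⟩
  · intro i _
    rfl

/-- If coordinates `a` and `b` agree, only lowering one of these two can make the vector injective.
The two results differ by a transposition and cancel modulo 2. Thus the recursion also holds off the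
abaci, which is what allows it to be iterated. -/
theorem sum_vecExt_sub_single_of_not_injective (F : Finset ℕ → ZMod 2) {v : Fin m → ℤ}
    (hv : ¬ Function.Injective v) (q : ℤ) : ∑ i, vecExt F (v - Pi.single i q) = 0 := by
  simp only [Function.Injective, not_forall] at hv
  obtain ⟨a, b, hab, hne⟩ := hv
  have hz : ∀ i, i ≠ a → i ≠ b → vecExt F (v - Pi.single i q) = 0 := by
    intro i hia hib
    rw [vecExt, if_neg]
    rintro ⟨hinj, -⟩
    refine hne (hinj ?_)
    simp [hia.symm, hib.symm, hab]
  have hs : vecExt F (v - Pi.single a q) = vecExt F (v - Pi.single b q) := by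
    rw [← vecExt_comp_equiv F _ (Equiv.swap a b)]
    congr 1
    ext j
    simp only [Function.comp, Pi.sub_apply]
    rcases eq_or_ne j a with rfl | hja
    · simp [hab, hne, Ne.symm hne]
    · rcases eq_or_ne j b with rfl | hjb
      · simp [hab]
      · simp [Equiv.swap_apply_of_ne_of_ne hja hjb, hja, hjb]
  rw [← sum_subset (subset_univ {a, b})]
  · rw [sum_pair hne, hs]
    exact CharTwo.add_self_eq_zero _
  · intro i _ hi
    simp only [mem_insert, mem_singleton, not_or] at hi
    exact hz i hi.1 hi.2

theorem sum_vecExt_sub_single_of_neg (F : Finset ℕ → ZMod 2) {v : Fin m → ℤ}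
    (hv : ¬ ∀ i, 0 ≤ v i) (q : ℕ) : ∑ i, vecExt F (v - Pi.single i (q : ℤ)) = 0 := by
  push Not at hv
  obtain ⟨a, ha⟩ := hv
  refine sum_eq_zero fun i _ => ?_
  rw [vecExt, if_neg]
  rintro ⟨-, hpos⟩
  have h1 := hpos a
  rcases eq_or_ne a i with rfl | hai
  · simp at h1; omega
  · simp [hai] at h1; omega

/-- This is the Frobenius identity `(∑ x_i)^2 = ∑ x_i^2`: off-diagonal terms occur in equal pairs.
-/
theorem sum_sum_eq_sum_diag_of_symm {ι R : Type*} [Semiring R] [CharP R 2] (s : Finset ι)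
    (g : ι → ι → R) (hg : ∀ i j, g i j = g j i) : ∑ i ∈ s, ∑ j ∈ s, g i j = ∑ i ∈ s, g i i := by
  classical
  induction s using Finset.induction_on with
  | empty => simp
  | insert a s ha ih =>
    simp only [sum_insert ha, sum_add_distrib, ih]
    rw [sum_congr rfl fun i _ => hg i a]
    have := CharTwo.add_self_eq_zero (∑ j ∈ s, g a j)
    calc _ = g a a + (∑ j ∈ s, g a j + ∑ j ∈ s, g a j) + ∑ i ∈ s, g i i := by abel
      _ = _ := by rw [this, add_zero]

theorem vecExt_cnt_succ (n : ℕ) (v : Fin m → ℤ) :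
    vecExt (fun X => (cnt (n + 1) X : ZMod 2)) v =
      ∑ i, vecExt (fun X => (cnt n X : ZMod 2)) (v - Pi.single i ((1 : ℕ) : ℤ)) := by
  by_cases hv : Function.Injective v
  · by_cases h0 : ∀ i, 0 ≤ v i
    · rw [sum_vecExt_sub_single _ hv h0 one_pos, vecExt, if_pos ⟨hv, h0⟩]
      simp [cnt]
    · rw [sum_vecExt_sub_single_of_neg _ h0, vecExt, if_neg (fun h => h0 h.2)]
  · rw [sum_vecExt_sub_single_of_not_injective _ hv, vecExt, if_neg (fun h => hv h.1)]

/-- By induction on `k`: apply `D^(2^k) = ∑ S_i^(2^k)` twice. The double sum is symmetric because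
shifts commute, so only its diagonal, with shifts by `2^(k+1)`, remains. -/
theorem vecExt_cnt_two_pow_add (k n : ℕ) (v : Fin m → ℤ) :
    vecExt (fun X => (cnt (2 ^ k + n) X : ZMod 2)) v =
      ∑ i, vecExt (fun X => (cnt n X : ZMod 2)) (v - Pi.single i ((2 ^ k : ℕ) : ℤ)) := by
  induction k generalizing n v with
  | zero => simp [add_comm 1 n, vecExt_cnt_succ]
  | succ k ih =>
    have h2 : 2 ^ (k + 1) + n = 2 ^ k + (2 ^ k + n) := by ring
    rw [h2, ih]
    simp only [ih]
    rw [sum_sum_eq_sum_diag_of_symm]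
    · refine sum_congr rfl fun i _ => ?_
      rw [sub_sub, ← Pi.single_add]
      congr 3
      push_cast
      ring
    · intro i j
      rw [sub_right_comm]

end Vectors

/-- Modulo two, chains can be counted by first removing a rim hook whose length is a power of
two. -/
theorem cnt_two_pow_add (k n : ℕ) (X : Finset ℕ) :
    (cnt (2 ^ k + n) X : ZMod 2) = ∑ c ∈ dn (2 ^ k) X, (cnt n (slide (2 ^ k) c X) : ZMod 2) := by
  set v : Fin X.card → ℤ := fun i => (X.orderEmbOfFin rfl i : ℤ) with hv
  have hinj : Function.Injective v := fun i j h => by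
    simpa [hv] using h
  have h0 : ∀ i, 0 ≤ v i := fun i => by simp [hv]
  have himg : (univ.image fun i => (v i).toNat) = X := by
    simp [hv]
  have h1 := vecExt_cnt_two_pow_add k n v
  rw [sum_vecExt_sub_single _ hinj h0 (by positivity), vecExt, if_pos ⟨hinj, h0⟩, himg] at h1
  exact h1

/-! ### Cores, and squares made of a box and a long rim hook -/

/-- No rim hook of length `q` can be removed from `A`. -/
def IsCore (q : ℕ) (A : Finset ℕ) : Prop := ∀ c, c + q ∈ A → c ∈ A

theorem Lev.isCore {n q : ℕ} {A : Finset ℕ} (h : Lev n A) (hn : n < q) : IsCore q A := by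
  intro c hc
  by_contra hne
  have := (h.rem ⟨c, hne, hc, rfl⟩).1
  omega

/-- If a second move `d + q → d` were possible, the bead at `d + q` would survive the first move,
and the core property would force a bead at `d`. -/
theorem Rem.unique {q : ℕ} {X A A' : Finset ℕ} (h : Rem q X A) (h' : Rem q X A')
    (hA : IsCore q A) : A = A' := by
  obtain ⟨c, h1, h2, rfl⟩ := h
  obtain ⟨d, h3, h4, rfl⟩ := h'
  have : c = d := by
    by_contra hne
    have h5 : d ∈ slide q c X := hA d (mem_slide.2 (Or.inr ⟨by omega, h4⟩))
    rcases mem_slide.1 h5 with h | h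
    · exact hne h.symm
    · exact h3 h.2
  rw [this]

/-- A summand that is nonzero modulo 2 belongs to an abacus of level `r < 2^k`, hence to a core, and
then no other hook of length `2^k` is removable. So the sum modulo 2 has at most one nonzero term.
-/
theorem odd_cnt_two_pow_add {k r : ℕ} {X : Finset ℕ} (hr : r < 2 ^ k) :
    Odd (cnt (2 ^ k + r) X) ↔ ∃ A, Rem (2 ^ k) X A ∧ Odd (cnt r A) := by
  rw [← ZMod.natCast_eq_one_iff_odd, cnt_two_pow_add]
  have hall : ∀ c d, c ∈ dn (2 ^ k) X → d ∈ dn (2 ^ k) X →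
      (cnt r (slide (2 ^ k) c X) : ZMod 2) ≠ 0 → c = d := by
    intro c d hc hd hne
    have hl : Lev r (slide (2 ^ k) c X) := lev_of_cnt_ne_zero fun h => hne (by simp [h])
    obtain ⟨h1, h2⟩ := mem_dn.1 hc
    obtain ⟨h3, h4⟩ := mem_dn.1 hd
    by_contra hcd
    have h5 := hl.isCore hr d (mem_slide.2 (Or.inr ⟨by omega, h4⟩))
    rcases mem_slide.1 h5 with h | h
    · exact hcd h.symm
    · exact h3 h.2
  constructor
  · intro h
    obtain ⟨c, hc, hne⟩ := exists_ne_zero_of_sum_ne_zero (by rw [h]; exact one_ne_zero)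
    have h1 := mem_dn.1 hc
    refine ⟨_, ⟨c, h1.1, h1.2, rfl⟩, ?_⟩
    rw [← ZMod.natCast_eq_one_iff_odd, ← h]
    exact (sum_eq_single_of_mem c hc fun d hd hdc => by
      by_contra h0
      exact hdc (hall d c hd hc h0)).symm
  · rintro ⟨A, ⟨c, h1, h2, rfl⟩, hodd⟩
    rw [← ZMod.natCast_eq_one_iff_odd] at hodd
    rw [← hodd]
    have hc := mem_dn.2 ⟨h1, h2⟩
    exact sum_eq_single_of_mem c hc fun d hd hdc =>
      by_contra fun h0 => hdc (hall d c hd hc h0)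

theorem rem_iff {q : ℕ} {X A : Finset ℕ} :
    Rem q X A ↔ ∃ c, c ∉ X ∧ c + q ∈ X ∧ ∀ z, z ∈ A ↔ z = c ∨ (z ≠ c + q ∧ z ∈ X) := by
  simp only [Rem, Finset.ext_iff, mem_slide]

theorem rem_iff' {q : ℕ} {X A : Finset ℕ} (hq : q ≠ 0) :
    Rem q X A ↔ ∃ c, c ∈ A ∧ c + q ∉ A ∧ ∀ z, z ∈ X ↔ z = c + q ∨ (z ≠ c ∧ z ∈ A) := by
  rw [rem_iff]
  refine exists_congr fun c => ?_
  constructor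
  · rintro ⟨h1, h2, h3⟩
    exact ⟨by grind, by grind, by grind⟩
  · rintro ⟨h1, h2, h3⟩
    exact ⟨by grind, by grind, by grind⟩

theorem exists_rem {q c : ℕ} {X : Finset ℕ} (h1 : c ∉ X) (h2 : c + q ∈ X) :
    ∃ A, Rem q X A ∧ ∀ z, z ∈ A ↔ z = c ∨ (z ≠ c + q ∧ z ∈ X) :=
  ⟨slide q c X, ⟨c, h1, h2, rfl⟩, fun _ => mem_slide⟩

theorem exists_rem' {q c : ℕ} {A : Finset ℕ} (hq : q ≠ 0) (h1 : c ∈ A) (h2 : c + q ∉ A) :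
    ∃ X, Rem q X A ∧ ∀ z, z ∈ X ↔ z = c + q ∨ (z ≠ c ∧ z ∈ A) := by
  refine ⟨insert (c + q) (A.erase c), ?_, by simp⟩
  exact (rem_iff' hq).2 ⟨c, h1, h2, by simp⟩

/-- Let `c → c + q` be the move from `A` up to `X`, and `y + 1 → y` the move from `A` down to `B`.
Usually the two are independent. If `y + 1 = c`, the bead in question sits at `c + q` in `X` and is
moved there. If `y = c + q`, the target is occupied in `X`; the core property puts a bead at `c +
1`, and this one moves to `c` instead. -/
theorem Rem.exists_lower {q : ℕ} {X A B : Finset ℕ} (hq : 2 ≤ q) (hXA : Rem q X A)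
    (hA : IsCore q A) (hAB : Rem 1 A B) : ∃ Y, Rem 1 X Y ∧ Rem q Y B := by
  obtain ⟨c, h1, h2, hX⟩ := (rem_iff' (by omega)).1 hXA
  obtain ⟨y, h3, h4, hB⟩ := rem_iff.1 hAB
  by_cases hy1 : y + 1 = c
  · subst hy1
    have h5 : y + q ∉ A := fun h => h3 (hA y h)
    obtain ⟨Y, hXY, hY⟩ := exists_rem (q := 1) (c := y + q) (X := X) (by grind) (by grind)
    exact ⟨Y, hXY, rem_iff.2 ⟨y, by grind, by grind, by grind⟩⟩
  by_cases hy2 : y = c + q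
  · subst hy2
    have h5 : c + 1 ∈ A := hA _ (by grind)
    obtain ⟨Y, hXY, hY⟩ := exists_rem (q := 1) (c := c) (X := X) (by grind) (by grind)
    exact ⟨Y, hXY, rem_iff.2 ⟨c + 1, by grind, by grind, by grind⟩⟩
  · obtain ⟨Y, hXY, hY⟩ := exists_rem (q := 1) (c := y) (X := X) (by grind) (by grind)
    exact ⟨Y, hXY, rem_iff.2 ⟨c, by grind, by grind, by grind⟩⟩

/-- The three cases of `Rem.exists_lower` are the only ones: the move from `X` to `Y` is a function
of the move from `A` to `B`. Existence of the fourth side and uniqueness of `Y` both follow from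
this. -/
theorem Rem.lower_aux {q c : ℕ} {X Y A B : Finset ℕ} (hq : 2 ≤ q) (h1 : c ∈ A) (h2 : c + q ∉ A)
    (hX : ∀ z, z ∈ X ↔ z = c + q ∨ (z ≠ c ∧ z ∈ A))
    (hA : IsCore q A) (hXY : Rem 1 X Y) (hYB : Rem q Y B) (hB : IsCore q B) :
    ∃ b, (b ∉ A ∧ b + 1 ∈ A ∧ ∀ z, z ∈ B ↔ z = b ∨ (z ≠ b + 1 ∧ z ∈ A)) ∧
      ∃ y, (y = if b + 1 = c then b + q else if b = c + q then c else b) ∧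
        ∀ z, z ∈ Y ↔ z = y ∨ (z ≠ y + 1 ∧ z ∈ X) := by
  obtain ⟨y, h3, h4, hY⟩ := rem_iff.1 hXY
  obtain ⟨d, h5, h6, hB'⟩ := rem_iff.1 hYB
  have hAd := hA d
  have hAc := hA c
  have hBd := hB c
  have hAd1 := hA (d + 1)
  have hAy := hA y
  have hAy1 := hA (y + 1)
  by_cases hdc : d = c
  · exact ⟨y, ⟨by grind, by grind, by grind⟩, y, by grind, hY⟩
  by_cases hdc : d + 1 = c
  · exact ⟨d, ⟨by grind, by grind, by grind⟩, y, by grind, hY⟩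
  · exact ⟨c + q, ⟨by grind, by grind, by grind⟩, y, by grind, hY⟩

theorem Rem.lower {q : ℕ} {X Y A B : Finset ℕ} (hq : 2 ≤ q) (hXA : Rem q X A)
    (hA : IsCore q A) (hXY : Rem 1 X Y) (hYB : Rem q Y B) (hB : IsCore q B) : Rem 1 A B := by
  obtain ⟨c, h1, h2, hX⟩ := (rem_iff' (by omega)).1 hXA
  obtain ⟨b, hb, -⟩ := Rem.lower_aux hq h1 h2 hX hA hXY hYB hB
  exact rem_iff.2 ⟨b, hb⟩

theorem Rem.lower_unique {q : ℕ} {X Y Y' A B : Finset ℕ} (hq : 2 ≤ q) (hXA : Rem q X A)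
    (hA : IsCore q A) (hXY : Rem 1 X Y) (hYB : Rem q Y B) (hXY' : Rem 1 X Y')
    (hYB' : Rem q Y' B) (hB : IsCore q B) : Y = Y' := by
  obtain ⟨c, h1, h2, hX⟩ := (rem_iff' (by omega)).1 hXA
  obtain ⟨b, hb, y, hy, hY⟩ := Rem.lower_aux hq h1 h2 hX hA hXY hYB hB
  obtain ⟨b', hb', y', hy', hY'⟩ := Rem.lower_aux hq h1 h2 hX hA hXY' hYB' hB
  have hbb : b = b' := by
    have := (hb.2.2 b).2 (Or.inl rfl)
    have := (hb'.2.2 b).1 this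
    tauto
  subst hbb
  have : y = y' := hy.trans hy'.symm
  subst this
  ext z
  rw [hY, hY']

theorem Rem.exists_upper {q : ℕ} {Y A B : Finset ℕ} (hq : 2 ≤ q) (hYB : Rem q Y B)
    (hB : IsCore q B) (hAB : Rem 1 A B) (h0 : 0 ∈ Y) :
    ∃ X, Rem 1 X Y ∧ Rem q X A := by
  obtain ⟨c, h1, h2, hY⟩ := (rem_iff' (by omega)).1 hYB
  obtain ⟨y, h3, h4, hA'⟩ := (rem_iff' (by omega)).1 hAB
  have h6 := hB (y + 1)
  by_cases hy1 : y = c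
  · subst hy1
    obtain ⟨X, hXY, hX⟩ := exists_rem' (q := 1) (c := y + q) (A := Y) (by grind) (by grind)
      (by grind)
    exact ⟨X, hXY, rem_iff.2 ⟨y + 1, by grind, by grind, by grind⟩⟩
  by_cases hy2 : y + 1 = c + q
  · have hc : c ≠ 0 := by grind
    obtain ⟨d, rfl⟩ := Nat.exists_eq_add_one_of_ne_zero hc
    have h5 : d ∈ B := hB _ (by grind)
    obtain ⟨X, hXY, hX⟩ := exists_rem' (q := 1) (c := d) (A := Y) (by grind) (by grind) (by grind)
    exact ⟨X, hXY, rem_iff.2 ⟨d, by grind, by grind, by grind⟩⟩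
  · obtain ⟨X, hXY, hX⟩ := exists_rem' (q := 1) (c := y) (A := Y) (by grind) (by grind) (by grind)
    exact ⟨X, hXY, rem_iff.2 ⟨c, by grind, by grind, by grind⟩⟩

/-- As in `Rem.lower_aux`, the move between `X` and `Y` is determined by the one between `A` and
`B`. -/
theorem Rem.upper_aux {q c : ℕ} {X Y A B : Finset ℕ} (hq : 2 ≤ q) (h1 : c ∈ B) (h2 : c + q ∉ B)
    (hY : ∀ z, z ∈ Y ↔ z = c + q ∨ (z ≠ c ∧ z ∈ B))
    (hB : IsCore q B) (hXY : Rem 1 X Y) (hXA : Rem q X A) (hA : IsCore q A) :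
    ∃ b, (b ∈ B ∧ b + 1 ∉ B ∧ ∀ z, z ∈ A ↔ z = b + 1 ∨ (z ≠ b ∧ z ∈ B)) ∧
      ∃ y, (y + 1 = if b = c then b + q + 1 else if b + 1 = c + q then c else b + 1) ∧
        ∀ z, z ∈ X ↔ z = y + 1 ∨ (z ≠ y ∧ z ∈ Y) := by
  obtain ⟨y, h3, h4, hX⟩ := (rem_iff' (by omega)).1 hXY
  obtain ⟨d, h5, h6, hA'⟩ := rem_iff.1 hXA
  have hBd := hB d
  have hBc := hB c
  have hAc := hA c
  have hBd1 := hB (d + 1)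
  have hBy := hB y
  have hBy1 := hB (y + 1)
  have hAy := hA y
  have hAy1 := hA (y + 1)
  by_cases hdc : d = c
  · exact ⟨y, ⟨by grind, by grind, by grind⟩, y, by grind, hX⟩
  by_cases hdc : d = c + 1
  · exact ⟨c, ⟨by grind, by grind, by grind⟩, y, by grind, hX⟩
  · exact ⟨d + q, ⟨by grind, by grind, by grind⟩, y, by grind, hX⟩

theorem Rem.upper_unique {q : ℕ} {X X' Y A B : Finset ℕ} (hq : 2 ≤ q) (hYB : Rem q Y B)
    (hB : IsCore q B) (hXY : Rem 1 X Y) (hXA : Rem q X A) (hXY' : Rem 1 X' Y)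
    (hXA' : Rem q X' A) (hA : IsCore q A) : X = X' := by
  obtain ⟨c, h1, h2, hY⟩ := (rem_iff' (by omega)).1 hYB
  obtain ⟨b, hb, y, hy, hX⟩ := Rem.upper_aux hq h1 h2 hY hB hXY hXA hA
  obtain ⟨b', hb', y', hy', hX'⟩ := Rem.upper_aux hq h1 h2 hY hB hXY' hXA' hA
  have hbb : b = b' := by
    have := (hb.2.2 (b + 1)).2 (Or.inl rfl)
    have := (hb'.2.2 (b + 1)).1 this
    grind
  subst hbb
  have : y = y' := by omega
  subst this
  ext z
  rw [hX, hX']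

/-! ### Young diagrams, their covering relation and their bead sets -/

theorem rowLen_ext {μ ν : YoungDiagram} (h : ∀ i, μ.rowLen i = ν.rowLen i) : μ = ν := by
  ext ⟨i, j⟩
  rw [YoungDiagram.mem_cells, YoungDiagram.mem_cells, YoungDiagram.mem_iff_lt_rowLen,
    YoungDiagram.mem_iff_lt_rowLen, h]

theorem le_iff_rowLen {μ ν : YoungDiagram} : μ ≤ ν ↔ ∀ i, μ.rowLen i ≤ ν.rowLen i := by
  constructor
  · intro h i
    by_contra! hlt
    have : (i, ν.rowLen i) ∈ μ := YoungDiagram.mem_iff_lt_rowLen.2 hlt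
    exact lt_irrefl _ (YoungDiagram.mem_iff_lt_rowLen.1 (h this))
  · rintro h ⟨i, j⟩ hij
    exact YoungDiagram.mem_iff_lt_rowLen.2 ((YoungDiagram.mem_iff_lt_rowLen.1 hij).trans_le (h i))

theorem exists_rowLen_eq (m : ℕ) {f : ℕ → ℕ} (hf : Antitone f) :
    ∃ μ : YoungDiagram, ∀ i, μ.rowLen i = if i < m then f i else 0 := by
  refine ⟨⟨(range m ×ˢ range (f 0)).filter fun c => c.2 < f c.1, ?_⟩, fun i => ?_⟩
  · rintro ⟨a, b⟩ ⟨c, d⟩ ⟨h1 : c ≤ a, h2 : d ≤ b⟩ h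
    simp only [coe_filter, mem_product, mem_range, Set.mem_ofPred_eq] at h ⊢
    have := hf h1
    have := hf (Nat.zero_le c)
    omega
  · refine eq_of_forall_lt_iff fun j => ?_
    rw [← YoungDiagram.mem_iff_lt_rowLen, ← YoungDiagram.mem_cells]
    simp only [mem_filter, mem_product, mem_range]
    have := hf (Nat.zero_le i)
    split_ifs <;> omega

theorem rowLen_eq_zero_of_card_le {μ : YoungDiagram} {m : ℕ} (h : μ.card ≤ m) :
    μ.rowLen m = 0 := by
  by_contra hne
  have h1 : (m, 0) ∈ μ := YoungDiagram.mem_iff_lt_rowLen.2 (Nat.pos_of_ne_zero hne)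
  have h2 := YoungDiagram.mem_iff_lt_colLen.1 h1
  rw [YoungDiagram.colLen_eq_card] at h2
  have h3 : (μ.col 0).card ≤ μ.card := card_le_card (filter_subset _ _)
  omega

theorem rowLen_eq_zero_of_le {μ : YoungDiagram} {m i : ℕ} (h : μ.rowLen m = 0) (hi : m ≤ i) :
    μ.rowLen i = 0 := Nat.le_zero.1 (h ▸ μ.rowLen_anti _ _ hi)

/-- The row lengths of `κ` are those of `μ`, except that row `i` is shorter by one. -/
theorem exists_decrement {μ : YoungDiagram} {i : ℕ} (h : μ.rowLen (i + 1) < μ.rowLen i) :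
    ∃ κ : YoungDiagram, μ.rowLen i = κ.rowLen i + 1 ∧ ∀ j, j ≠ i → μ.rowLen j = κ.rowLen j := by
  have hanti : Antitone fun j => if j = i then μ.rowLen i - 1 else μ.rowLen j := by
    intro a b hab
    have h1 := μ.rowLen_anti a b hab
    simp only
    split_ifs with hb ha ha
    · exact le_rfl
    · subst hb
      omega
    · subst ha
      have := μ.rowLen_anti (a + 1) b (by omega)
      omega
    · exact h1
  obtain ⟨κ, hκ⟩ := exists_rowLen_eq μ.card hanti
  have hzero : ∀ j, ¬ j < μ.card → μ.rowLen j = 0 := fun j hj =>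
    rowLen_eq_zero_of_card_le (not_lt.1 hj)
  refine ⟨κ, ?_, fun j hj => ?_⟩
  · rw [hκ]
    have := hzero i
    split_ifs <;> omega
  · rw [hκ, if_neg hj]
    split_ifs with h1
    · rfl
    · exact hzero j h1

theorem covBy_iff_rowLen {μ ν : YoungDiagram} :
    ν ⋖ μ ↔ ∃ i, μ.rowLen i = ν.rowLen i + 1 ∧ ∀ j, j ≠ i → μ.rowLen j = ν.rowLen j := by
  have back : ∀ {μ ν : YoungDiagram} {i : ℕ}, μ.rowLen i = ν.rowLen i + 1 →
      (∀ j, j ≠ i → μ.rowLen j = ν.rowLen j) → ν ⋖ μ := by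
    intro μ ν i h1 h2
    have hle : ν ≤ μ := le_iff_rowLen.2 fun j => by
      rcases eq_or_ne j i with rfl | hj
      · omega
      · exact (h2 j hj).ge
    refine ⟨lt_of_le_of_ne hle fun h => ?_, fun κ hνκ hκμ => ?_⟩
    · rw [h] at h1
      omega
    · have h3 := le_iff_rowLen.1 hνκ.le
      have h4 := le_iff_rowLen.1 hκμ.le
      have h5 := h3 i
      have h6 := h4 i
      by_cases h7 : κ.rowLen i = ν.rowLen i
      · refine hνκ.ne (rowLen_ext fun j => ?_)
        rcases eq_or_ne j i with rfl | hj
        · exact h7.symm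
        · exact le_antisymm (h3 j) ((h4 j).trans_eq (h2 j hj))
      · refine hκμ.ne (rowLen_ext fun j => ?_)
        rcases eq_or_ne j i with rfl | hj
        · omega
        · exact le_antisymm (h4 j) ((h2 j hj).le.trans (h3 j))
  refine ⟨fun h => ?_, fun ⟨i, h1, h2⟩ => back h1 h2⟩
  have hle := le_iff_rowLen.1 h.le
  have hex : ∃ i, i ≤ μ.card ∧ ν.rowLen i < μ.rowLen i := by
    by_contra! hcon
    refine h.ne (rowLen_ext fun j => le_antisymm (hle j) ?_)
    by_cases hj : j ≤ μ.card
    · exact hcon j hj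
    · rw [rowLen_eq_zero_of_card_le (by omega)]
      exact Nat.zero_le _
  obtain ⟨i0, hi0, hi0'⟩ := hex
  -- In the last row where the diagrams differ, the final box of `μ` is a corner, since the next row
  -- is no longer than that of `ν`. Removing it leaves a diagram that still contains `ν`, hence
  -- equals `ν`.
  set i := Nat.findGreatest (fun i => ν.rowLen i < μ.rowLen i) μ.card with hi
  have h1 : ν.rowLen i < μ.rowLen i :=
    Nat.findGreatest_spec (P := fun i => ν.rowLen i < μ.rowLen i) hi0 hi0'
  have h2 : μ.rowLen (i + 1) ≤ ν.rowLen (i + 1) := by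
    by_cases hj : i + 1 ≤ μ.card
    · have := Nat.findGreatest_is_greatest (P := fun i => ν.rowLen i < μ.rowLen i)
        (Nat.lt_succ_self i) hj
      exact not_lt.1 this
    · rw [rowLen_eq_zero_of_card_le (by omega)]
      exact Nat.zero_le _
  have h3 := ν.rowLen_anti i (i + 1) (by omega)
  obtain ⟨κ, hκ, hκ'⟩ := exists_decrement (μ := μ) (i := i) (by omega)
  have hκμ := back hκ hκ'
  have hνκ : ν ≤ κ := le_iff_rowLen.2 fun j => by
    rcases eq_or_ne j i with rfl | hj
    · omega
    · exact (hle j).trans_eq (hκ' j hj)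
  have : ν = κ := by
    by_contra hne
    exact h.2 (lt_of_le_of_ne hνκ hne) hκμ.lt
  exact ⟨i, this ▸ hκ, this ▸ hκ'⟩

theorem card_of_covBy {μ ν : YoungDiagram} (h : ν ⋖ μ) : μ.card = ν.card + 1 := by
  obtain ⟨i, h1, h2⟩ := covBy_iff_rowLen.1 h
  have : μ.cells = insert (i, ν.rowLen i) ν.cells := by
    ext ⟨a, b⟩
    simp only [mem_insert, YoungDiagram.mem_cells, YoungDiagram.mem_iff_lt_rowLen, Prod.mk.injEq]
    rcases eq_or_ne a i with rfl | ha
    · omega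
    · rw [h2 a ha]
      simp [ha]
  rw [YoungDiagram.card, this, card_insert_of_notMem]
  simp [YoungDiagram.mem_iff_lt_rowLen]

/-- The abacus with `m` beads of a partition. -/
def beads (m : ℕ) (μ : YoungDiagram) : Finset ℕ :=
  (range m).image fun i => μ.rowLen i + (m - 1 - i)

theorem mem_beads {m x : ℕ} {μ : YoungDiagram} :
    x ∈ beads m μ ↔ ∃ i, i < m ∧ x + i + 1 = μ.rowLen i + m := by
  simp only [beads, mem_image, mem_range]
  refine exists_congr fun i => and_congr_right fun hi => ?_
  omega

theorem rowLen_add_injOn (m : ℕ) (μ : YoungDiagram) :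
    Set.InjOn (fun i => μ.rowLen i + (m - 1 - i)) (range m) := by
  intro i hi j hj hij
  simp only [coe_range, Set.mem_Iio] at hi hj
  replace hij : μ.rowLen i + (m - 1 - i) = μ.rowLen j + (m - 1 - j) := hij
  rcases le_total i j with h | h
  · have := μ.rowLen_anti _ _ h
    omega
  · have := μ.rowLen_anti _ _ h
    omega

theorem card_beads (m : ℕ) (μ : YoungDiagram) : (beads m μ).card = m := by
  rw [beads, card_image_of_injOn (rowLen_add_injOn m μ), card_range]

/-- The rows read from the bottom give the increasing enumeration of the bead set, which is unique.
Rows from `m` on are invisible to the abacus and must be assumed empty. -/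
theorem beads_injective {m : ℕ} {μ ν : YoungDiagram} (hμ : μ.rowLen m = 0) (hν : ν.rowLen m = 0)
    (h : beads m μ = beads m ν) : μ = ν := by
  have key : ∀ κ : YoungDiagram, beads m κ = beads m μ →
      (fun i : Fin m => κ.rowLen (m - 1 - i) + i) =
        (beads m μ).orderEmbOfFin (card_beads m μ) := by
    intro κ hκ
    refine orderEmbOfFin_unique _ (fun i => ?_) (fun i j hij => ?_)
    · rw [← hκ, mem_beads]
      exact ⟨m - 1 - i, by omega, by omega⟩
    · have := κ.rowLen_anti (m - 1 - j) (m - 1 - i) (by omega)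
      change κ.rowLen (m - 1 - i) + i < κ.rowLen (m - 1 - j) + j
      omega
  have h1 := (key μ rfl).trans (key ν h.symm).symm
  refine rowLen_ext fun i => ?_
  by_cases hi : i < m
  · have := congrFun h1 ⟨m - 1 - i, by omega⟩
    simp only [add_left_inj] at this
    rwa [show m - 1 - (m - 1 - i) = i by omega] at this
  · rw [rowLen_eq_zero_of_le hμ (not_lt.1 hi), rowLen_eq_zero_of_le hν (not_lt.1 hi)]

/-- Row `i` gets the length `e (m - 1 - i) - (m - 1 - i)`, where `e` enumerates `X` increasingly.
These lengths decrease because successive values of `e` differ by at least one. -/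
theorem exists_beads_eq {m : ℕ} {X : Finset ℕ} (h : X.card = m) :
    ∃ μ : YoungDiagram, μ.rowLen m = 0 ∧ beads m μ = X := by
  set e := X.orderEmbOfFin h with he
  have hstep : ∀ a b : Fin m, a ≤ b → e a + (b - a : ℕ) ≤ e b := by
    rintro ⟨a, ha⟩ ⟨b, hb⟩ (hab : a ≤ b)
    induction b, hab using Nat.le_induction with
    | base => simp
    | succ b hab ih =>
      have h1 := ih (by omega)
      have h2 : e ⟨b, by omega⟩ < e ⟨b + 1, hb⟩ := e.strictMono (by simp [Fin.lt_def])
      simp only at h1 ⊢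
      omega
  set f : ℕ → ℕ := fun i => if hi : i < m then e ⟨m - 1 - i, by omega⟩ - (m - 1 - i) else 0 with hf
  have hanti : Antitone f := by
    intro a b hab
    simp only [hf]
    split_ifs with h1 h2
    · have := hstep ⟨m - 1 - b, by omega⟩ ⟨m - 1 - a, by omega⟩ (by simp; omega)
      simp only at this
      omega
    · omega
    · exact Nat.zero_le _
    · exact le_rfl
  obtain ⟨μ, hμ⟩ := exists_rowLen_eq m hanti
  refine ⟨μ, by simp [hμ], ?_⟩
  have hge : ∀ a : Fin m, (a : ℕ) ≤ e a := by
    intro a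
    have := hstep ⟨0, a.pos⟩ a (by simp [Fin.le_def])
    simp only at this
    omega
  have hval : ∀ i (hi : i < m), μ.rowLen i + (m - 1 - i) = e ⟨m - 1 - i, by omega⟩ := by
    intro i hi
    have := hge ⟨m - 1 - i, by omega⟩
    simp only at this
    rw [hμ, if_pos hi]
    simp only [hf, dif_pos hi]
    omega
  rw [← X.image_orderEmbOfFin_univ h, beads]
  ext z
  simp only [mem_image, mem_range, mem_univ, true_and]
  constructor
  · rintro ⟨i, hi, rfl⟩
    exact ⟨_, (hval i hi).symm⟩
  · rintro ⟨i, rfl⟩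
    refine ⟨m - 1 - i, by omega, ?_⟩
    rw [hval _ (by omega)]
    congr 1
    apply Fin.ext
    simp only
    omega

theorem rem_one_beads_of_rowLen {m i : ℕ} {μ ν : YoungDiagram} (hi : i < m)
    (h1 : μ.rowLen i = ν.rowLen i + 1) (h2 : ∀ j, j ≠ i → μ.rowLen j = ν.rowLen j) :
    ν.rowLen i + (m - 1 - i) ∉ beads m μ ∧ ν.rowLen i + (m - 1 - i) + 1 ∈ beads m μ ∧
      beads m ν = slide 1 (ν.rowLen i + (m - 1 - i)) (beads m μ) := by
  refine ⟨?_, mem_beads.2 ⟨i, hi, by omega⟩, ?_⟩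
  · rw [mem_beads]
    rintro ⟨j, hj, hj'⟩
    rcases lt_trichotomy j i with h | rfl | h
    · have := μ.rowLen_anti j i h.le
      omega
    · omega
    · have := ν.rowLen_anti i j h.le
      have := h2 j (by omega)
      omega
  · ext z
    rw [mem_slide, mem_beads, mem_beads]
    constructor
    · rintro ⟨j, hj, hz⟩
      rcases lt_trichotomy j i with h | rfl | h
      · have := μ.rowLen_anti j i h.le
        have := h2 j (by omega)
        exact Or.inr ⟨by omega, j, hj, by omega⟩
      · left
        omega
      · have := ν.rowLen_anti i j h.le
        have := h2 j (by omega)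
        exact Or.inr ⟨by omega, j, hj, by omega⟩
    · rintro (rfl | ⟨hz, j, hj, hj'⟩)
      · exact ⟨i, hi, by omega⟩
      · rcases eq_or_ne j i with rfl | h
        · omega
        · exact ⟨j, hj, by rw [← h2 j h]; exact hj'⟩

/-- A removable box at the end of row `i` is a free position just below the bead of row `i`. -/
theorem covBy_iff_rem {m : ℕ} {μ ν : YoungDiagram} (hμ : μ.rowLen m = 0) (hν : ν.rowLen m = 0) :
    ν ⋖ μ ↔ Rem 1 (beads m μ) (beads m ν) := by
  constructor
  · intro h
    obtain ⟨i, h1, h2⟩ := covBy_iff_rowLen.1 h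
    have hi : i < m := by
      by_contra hi
      have := rowLen_eq_zero_of_le hμ (not_lt.1 hi)
      omega
    exact ⟨_, rem_one_beads_of_rowLen hi h1 h2⟩
  · rintro ⟨c, h1, h2, h3⟩
    obtain ⟨i, hi, hi'⟩ := mem_beads.1 h2
    have h4 : μ.rowLen (i + 1) < μ.rowLen i := by
      by_contra! hcon
      have h5 := μ.rowLen_anti i (i + 1) (by omega)
      rcases Nat.lt_or_ge (i + 1) m with him | him
      · exact h1 (mem_beads.2 ⟨i + 1, him, by omega⟩)
      · have := rowLen_eq_zero_of_le hμ him
        omega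
    obtain ⟨κ, hκ, hκ'⟩ := exists_decrement h4
    obtain ⟨-, -, h5⟩ := rem_one_beads_of_rowLen hi hκ hκ'
    rw [show κ.rowLen i + (m - 1 - i) = c by omega, ← h3] at h5
    have hκm : κ.rowLen m = 0 := by
      rw [← hκ' m (by omega)]
      exact hμ
    rw [← beads_injective hκm hν h5]
    exact covBy_iff_rowLen.2 ⟨i, hκ, hκ'⟩

theorem rowLen_bot (i : ℕ) : (⊥ : YoungDiagram).rowLen i = 0 := by
  by_contra hne
  have h1 : (i, 0) ∈ (⊥ : YoungDiagram) :=
    YoungDiagram.mem_iff_lt_rowLen.2 (Nat.pos_of_ne_zero hne)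
  exact YoungDiagram.notMem_bot _ h1

theorem beads_bot (m : ℕ) : beads m ⊥ = range m := by
  ext z
  rw [mem_beads, mem_range]
  simp only [rowLen_bot]
  constructor
  · rintro ⟨i, hi, h⟩
    omega
  · intro h
    exact ⟨m - 1 - z, by omega, by omega⟩

theorem card_bot : (⊥ : YoungDiagram).card = 0 := by simp [YoungDiagram.card]

/-! ### Saturated chains counted on the abacus -/

/-- The saturated chains from the empty partition to `μ`. -/
abbrev ChainTo (μ : YoungDiagram) : Type :=
  {c : RelSeries {p : YoungDiagram × YoungDiagram | p.1 ⋖ p.2} // c.head = ⊥ ∧ c.last = μ}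

/-- Extend a chain by one step. -/
def snocChain (μ : YoungDiagram) (x : Σ ν : {ν // ν ⋖ μ}, ChainTo ν.1) : ChainTo μ :=
  ⟨x.2.1.snoc μ (by rw [x.2.2.2]; exact x.1.2), by rw [RelSeries.head_snoc]; exact x.2.2.1,
    RelSeries.last_snoc _ _ _⟩

theorem snocChain_bijective {μ : YoungDiagram} (hμ : μ ≠ ⊥) :
    Function.Bijective (snocChain μ) := by
  constructor
  · rintro ⟨⟨ν, hν⟩, c, hc, hl⟩ ⟨⟨ν', hν'⟩, c', hc', hl'⟩ h
    obtain rfl : c.last = ν := hl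
    obtain rfl : c'.last = ν' := hl'
    have h1 := congrArg (fun c => RelSeries.toList c.1) h
    simp only [snocChain, RelSeries.toList_snoc, List.append_cancel_right_eq] at h1
    have h2 := RelSeries.toList_injective h1
    subst h2
    rfl
  · rintro ⟨c, hc, hc'⟩
    have hlen : c.length ≠ 0 := by
      intro h0
      apply hμ
      rw [← hc, ← hc', RelSeries.head, RelSeries.last]
      congr 1
      ext
      simp [h0]
    refine ⟨⟨⟨c.eraseLast.last, ?_⟩, c.eraseLast, ?_, rfl⟩, ?_⟩
    · have := c.eraseLast_last_rel_last hlen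
      rwa [hc'] at this
    · rw [RelSeries.head_eraseLast, hc]
    · apply Subtype.ext
      subst hc'
      exact c.snoc_self_eraseLast hlen

/-- The induction splits a chain at its last step. Finiteness is carried along because `Nat.card` of
a sigma type is the sum of the cardinalities only for finite fibres. -/
theorem finite_chainTo_and_numChains {m n : ℕ} {μ : YoungDiagram} (hμ : μ.rowLen m = 0)
    (hn : Lev n (beads m μ)) :
    μ.card = n ∧ Finite (ChainTo μ) ∧ numChains μ = cnt n (beads m μ) := by
  induction n generalizing μ with
  | zero =>
    have h1 := hn.eq_range
    rw [card_beads, ← beads_bot] at h1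
    obtain rfl := beads_injective hμ (rowLen_bot m) h1
    have hfin : Finite (ChainTo ⊥) := by
      have := isOddPartition_bot.pos
      exact Nat.finite_of_card_ne_zero this.ne'
    have h2 : numChains ⊥ = 1 := by
      rw [numChains, Nat.card_eq_one_iff_unique]
      refine ⟨⟨?_⟩, ⟨⟨RelSeries.singleton _ ⊥, by simp, by simp⟩⟩⟩
      have key : ∀ c : RelSeries {p : YoungDiagram × YoungDiagram | p.1 ⋖ p.2},
          c.last = ⊥ → c.length = 0 := by
        intro c hl
        by_contra hne
        have := c.eraseLast_last_rel_last hne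
        rw [hl] at this
        exact not_lt_bot (CovBy.lt this)
      rintro ⟨c, hc, hc'⟩ ⟨d, hd, hd'⟩
      refine Subtype.ext (RelSeries.toList_injective ?_)
      have h1 := c.length_toList
      have h2 := d.length_toList
      rw [key c hc'] at h1
      rw [key d hd'] at h2
      obtain ⟨x, hx⟩ := List.length_eq_one_iff.1 h1
      obtain ⟨y, hy⟩ := List.length_eq_one_iff.1 h2
      have h3 := c.head_toList
      have h4 := d.head_toList
      simp only [hx, hy, hc, hd, List.head_cons] at h3 h4
      simp only [hx, hy, h3, h4]
    refine ⟨card_bot, hfin, ?_⟩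
    simp [h2, beads_bot, cnt]
  | succ n ih =>
    have hne : μ ≠ ⊥ := by
      rintro rfl
      rw [beads_bot] at hn
      exact absurd (hn.eq (lev_zero_range m)) (by omega)
    have hg : ∀ c : dn 1 (beads m μ), ∃ ν : YoungDiagram, ν.rowLen m = 0 ∧
        beads m ν = slide 1 c (beads m μ) := by
      rintro ⟨c, hc⟩
      obtain ⟨h1, h2⟩ := mem_dn.1 hc
      exact exists_beads_eq ((card_slide h1 h2).trans (card_beads m μ))
    choose g hg0 hg1 using hg
    have hcov : ∀ c, g c ⋖ μ := fun c => (covBy_iff_rem hμ (hg0 c)).2 (by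
      rw [hg1]
      obtain ⟨h1, h2⟩ := mem_dn.1 c.2
      exact ⟨c, h1, h2, rfl⟩)
    have hlev : ∀ c, Lev n (beads m (g c)) := fun c =>
      (hn.rem ((covBy_iff_rem hμ (hg0 c)).1 (hcov c))).2
    have hbij : Function.Bijective fun c => (⟨g c, hcov c⟩ : {ν // ν ⋖ μ}) := by
      constructor
      · intro c d hcd
        have h1 : slide 1 c (beads m μ) = slide 1 d (beads m μ) := by
          rw [← hg1, ← hg1, Subtype.mk.inj hcd]
        have h2 : (c : ℕ) ∈ slide 1 d (beads m μ) := h1 ▸ mem_slide.2 (Or.inl rfl)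
        rcases mem_slide.1 h2 with h | h
        · exact Subtype.ext h
        · exact absurd h.2 (mem_dn.1 c.2).1
      · rintro ⟨ν, hν⟩
        have hνm : ν.rowLen m = 0 := by
          have := le_iff_rowLen.1 hν.le m
          omega
        obtain ⟨c, h1, h2, h3⟩ := (covBy_iff_rem hμ hνm).1 hν
        refine ⟨⟨c, mem_dn.2 ⟨h1, h2⟩⟩, Subtype.ext ?_⟩
        exact beads_injective (hg0 _) hνm ((hg1 _).trans h3.symm)
    have hfin : ∀ c, Finite (ChainTo (g c)) := fun c => (ih (hg0 c) (hlev c)).2.1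
    let E : (Σ c, ChainTo (g c)) ≃ ChainTo μ :=
      (Equiv.sigmaCongrLeft (β := fun ν : {ν // ν ⋖ μ} => ChainTo ν.1)
        (Equiv.ofBijective _ hbij)).trans (Equiv.ofBijective _ (snocChain_bijective hne))
    refine ⟨?_, Finite.of_equiv _ E, ?_⟩
    · obtain ⟨c, hc⟩ := hn.exists_dn
      rw [card_of_covBy (hcov ⟨c, hc⟩), (ih (hg0 _) (hlev _)).1]
    · have h1 : numChains μ = ∑ c, numChains (g c) := by
        rw [numChains, ← Nat.card_congr E, Nat.card_sigma]
        rfl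
      rw [h1, cnt, ← sum_coe_sort (dn 1 (beads m μ)) fun c => cnt n (slide 1 c (beads m μ))]
      exact sum_congr rfl fun c _ => by rw [(ih (hg0 c) (hlev c)).2.2, hg1]

theorem lev_beads {m : ℕ} {μ : YoungDiagram} (hμ : μ.rowLen m = 0) :
    Lev μ.card (beads m μ) := by
  obtain ⟨n, hn⟩ := Nat.exists_eq_add_of_le (sum_range_card_le (beads m μ))
  have : Lev n (beads m μ) := hn
  rwa [← (finite_chainTo_and_numChains hμ this).1] at this

theorem numChains_eq {m : ℕ} {μ : YoungDiagram} (hμ : μ.rowLen m = 0) :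
    numChains μ = cnt μ.card (beads m μ) :=
  (finite_chainTo_and_numChains hμ (lev_beads hμ)).2.2

/-! ### Hooks on the abacus and the unique odd lower neighbour -/

/-- The abacus `X` with `m` beads represents the hook of size `n` for which the bead of the ground
state at `p` has been moved. -/
def HookAt (m p n : ℕ) (X : Finset ℕ) : Prop :=
  p < m ∧ m ≤ p + n ∧ ∀ z, z ∈ X ↔ z = p + n ∨ (z ≠ p ∧ z < m)

theorem rem_range_iff {m n : ℕ} {X : Finset ℕ} (hn : n ≠ 0) :
    Rem n X (range m) ↔ ∃ p, HookAt m p n X := by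
  simp only [rem_iff' hn, HookAt, mem_range, not_lt]

theorem HookAt.eq {m p n : ℕ} {X Y : Finset ℕ} (hX : HookAt m p n X) (hY : HookAt m p n Y) :
    X = Y := by
  ext z
  rw [hX.2.2, hY.2.2]

theorem HookAt.pos_unique {m p p' n : ℕ} {X : Finset ℕ} (h : HookAt m p n X)
    (h' : HookAt m p' n X) : p = p' := by
  obtain ⟨h1, h2, h3⟩ := h
  obtain ⟨h1', h2', h3'⟩ := h'
  have := h3 p
  have := h3' p
  grind

theorem HookAt.lev {m p n : ℕ} {X : Finset ℕ} (h : HookAt m p n X) (hn : n ≠ 0) : Lev n X := by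
  have := Rem.lev ((rem_range_iff hn).2 ⟨p, h⟩) (lev_zero_range m)
  simpa using this

theorem HookAt.card {m p n : ℕ} {X : Finset ℕ} (h : HookAt m p n X) (hn : n ≠ 0) :
    X.card = m := by
  have := Rem.card_eq ((rem_range_iff hn).2 ⟨p, h⟩)
  simpa using this.symm

theorem exists_hookAt {m p n : ℕ} (h1 : p < m) (h2 : m ≤ p + n) : ∃ X, HookAt m p n X :=
  ⟨insert (p + n) ((range m).erase p), h1, h2, by simp⟩

/-- Moving the top bead shortens the arm and keeps the gap at `p`; moving the bead at `p + 1` into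
the gap shortens the leg and shifts the gap to `p + 1`. -/
theorem HookAt.rem_one {m p n : ℕ} {X Y : Finset ℕ} (hn : 1 ≤ n) (hX : HookAt m p (n + 1) X)
    (h : Rem 1 X Y) : HookAt m p n Y ∨ HookAt m (p + 1) n Y := by
  obtain ⟨h1, h2, h3⟩ := hX
  obtain ⟨c, h4, h5, h6⟩ := rem_iff.1 h
  have h7 := (h3 (c + 1)).1 h5
  by_cases hc : c = p + n
  · left
    exact ⟨by grind, by grind, by grind⟩
  · right
    exact ⟨by grind, by grind, by grind⟩

theorem HookAt.rem_one_iff {m p p' n : ℕ} {X Y : Finset ℕ} (hn : 1 ≤ n)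
    (hX : HookAt m p (n + 1) X) (hY : HookAt m p' n Y) :
    Rem 1 X Y ↔ p' = p ∨ p' = p + 1 := by
  constructor
  · intro h
    rcases hX.rem_one hn h with h' | h'
    · exact Or.inl (hY.pos_unique h')
    · exact Or.inr (hY.pos_unique h')
  · obtain ⟨h1, h2, h3⟩ := hX
    obtain ⟨h1', h2', h3'⟩ := hY
    rintro (rfl | rfl)
    · exact rem_iff.2 ⟨p' + n, by grind, by grind, by grind⟩
    · exact rem_iff.2 ⟨p, by grind, by grind, by grind⟩

/-- Removing a long rim hook from a hook shortens its arm or its leg. -/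
theorem HookAt.rem {m p n q : ℕ} {X A : Finset ℕ} (hq : 1 ≤ q) (hn : q < n) (hnq : n < 2 * q)
    (hX : HookAt m p n X) (h : Rem q X A) :
    (m ≤ p + (n - q) ∧ HookAt m p (n - q) A) ∨ (p + q < m ∧ HookAt m (p + q) (n - q) A) := by
  obtain ⟨h1, h2, h3⟩ := hX
  obtain ⟨c, h4, h5, h6⟩ := rem_iff.1 h
  have h7 := (h3 (c + q)).1 h5
  by_cases hc : c + q = p + n
  · left
    exact ⟨by grind, by grind, by grind, by grind⟩
  · right
    have : c = p := by grind
    exact ⟨by grind, by grind, by grind, by grind⟩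

theorem HookAt.rem_arm {m p n q : ℕ} {X A : Finset ℕ} (hq : 1 ≤ q)
    (hX : HookAt m p (n + q) X) (hA : HookAt m p n A) : Rem q X A := by
  obtain ⟨h1, h2, h3⟩ := hX
  obtain ⟨h1', h2', h3'⟩ := hA
  exact rem_iff.2 ⟨p + n, by grind, by grind, by grind⟩

theorem HookAt.rem_leg {m p n q : ℕ} {X A : Finset ℕ} (hq : 1 ≤ q) (hn : 1 ≤ n)
    (hX : HookAt m p (n + q) X) (hA : HookAt m (p + q) n A) : Rem q X A := by
  obtain ⟨h1, h2, h3⟩ := hX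
  obtain ⟨h1', h2', h3'⟩ := hA
  exact rem_iff.2 ⟨p, by grind, by grind, by grind⟩

theorem existsUnique_odd_of_odd_sum {ι : Type*} {s : Finset ι} {f : ι → ℕ} {a b : ι}
    (hs : ∀ c ∈ s, c = a ∨ c = b) (h : Odd (∑ c ∈ s, f c)) : ∃! c, c ∈ s ∧ Odd (f c) := by
  classical
  by_cases ha : a ∈ s <;> by_cases hb : b ∈ s
  · rcases eq_or_ne a b with rfl | hab
    · have : s = {a} := by ext c; grind
      subst this
      exact ⟨a, by simpa using h, by simp⟩
    · have : s = {a, b} := by ext c; grind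
      subst this
      rw [sum_pair hab, Nat.odd_add] at h
      by_cases hfa : Odd (f a)
      · have h2 := h.1 hfa
        refine ⟨a, ⟨ha, hfa⟩, ?_⟩
        rintro c ⟨hc, hc'⟩
        rcases hs c hc with rfl | rfl
        · rfl
        · exact absurd hc' (Nat.not_odd_iff_even.2 h2)
      · have h2 : Odd (f b) := by
          rw [← Nat.not_even_iff_odd]
          exact fun h3 => hfa (h.2 h3)
        refine ⟨b, ⟨hb, h2⟩, ?_⟩
        rintro c ⟨hc, hc'⟩
        rcases hs c hc with rfl | rfl
        · exact absurd hc' hfa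
        · rfl
  · have : s = {a} := by ext c; grind
    subst this
    exact ⟨a, by simpa using h, by simp⟩
  · have : s = {b} := by ext c; grind
    subst this
    exact ⟨b, by simpa using h, by simp⟩
  · have : s = ∅ := by ext c; grind
    simp [this] at h

theorem odd_cnt_zero {X : Finset ℕ} : Odd (cnt 0 X) ↔ X = range X.card := by
  rw [cnt]
  split_ifs with h
  · exact iff_of_true odd_one h
  · exact iff_of_false (by decide) h

theorem odd_cnt_two_pow {k m : ℕ} {X : Finset ℕ} (hX : X.card = m) :
    Odd (cnt (2 ^ k) X) ↔ ∃ p, HookAt m p (2 ^ k) X := by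
  rw [← rem_range_iff (by positivity), ← add_zero (2 ^ k), odd_cnt_two_pow_add (by positivity),
    add_zero]
  simp only [odd_cnt_zero]
  constructor
  · rintro ⟨A, h1, h2⟩
    rw [h1.card_eq, hX] at h2
    rwa [h2] at h1
  · exact fun h => ⟨_, h, by simp⟩

theorem exists_eq_two_pow_add (n : ℕ) : ∃ k r, r < 2 ^ k ∧ n + 1 = 2 ^ k + r := by
  have h1 : 2 ^ Nat.log 2 (n + 1) ≤ n + 1 := Nat.pow_log_le_self 2 (Nat.succ_ne_zero n)
  have h2 : n + 1 < 2 ^ (Nat.log 2 (n + 1) + 1) := Nat.lt_pow_succ_log_self one_lt_two (n + 1)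
  rw [pow_succ] at h2
  exact ⟨Nat.log 2 (n + 1), n + 1 - 2 ^ Nat.log 2 (n + 1), by omega, by omega⟩

/-- Every odd abacus that is not a ground state has exactly one odd lower neighbour. -/
theorem existsUnique_odd_rem (n : ℕ) (X : Finset ℕ) (h : Odd (cnt (n + 1) X)) :
    ∃! Y, Rem 1 X Y ∧ Odd (cnt n Y) := by
  induction n using Nat.strong_induction_on generalizing X with
  | _ n ih =>
    obtain ⟨k, r, hr, hn⟩ := exists_eq_two_pow_add n
    rcases r with _ | r
    · have hhook : ∃ p, HookAt X.card p (n + 1) X := by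
        rw [hn, add_zero]
        rw [hn, add_zero] at h
        exact (odd_cnt_two_pow rfl).1 h
      obtain ⟨p, h1, h2, h3⟩ := hhook
      -- The size is a power of two, so the abacus is a hook. Its only removable boxes are at the
      -- ends of leg and arm, i.e. at `p` and `p + n`.
      obtain ⟨c, ⟨hc, hodd⟩, huniq⟩ := existsUnique_odd_of_odd_sum (s := dn 1 X)
        (f := fun c => cnt n (slide 1 c X)) (a := p) (b := p + n) (by
          intro c hc
          have := mem_dn.1 hc
          grind) h
      have hc' := mem_dn.1 hc
      refine ⟨_, ⟨⟨c, hc'.1, hc'.2, rfl⟩, hodd⟩, ?_⟩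
      rintro Y ⟨⟨d, hd1, hd2, rfl⟩, hY⟩
      rw [huniq d ⟨mem_dn.2 ⟨hd1, hd2⟩, hY⟩]
    -- Beyond `2^k`, the odd lower neighbours of `X` and of its core `A` correspond by the square
    -- lemmas, and the induction hypothesis applies to `A`.
    · have hk : 2 ≤ 2 ^ k := by omega
      obtain rfl : n = 2 ^ k + r := by omega
      rw [hn] at h
      obtain ⟨A, hXA, hA⟩ := (odd_cnt_two_pow_add hr).1 h
      obtain ⟨B, ⟨hAB, hB⟩, huniq⟩ := ih r (by omega) A hA
      have hAc := (lev_of_cnt_ne_zero hA.pos.ne').isCore hr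
      have hcore : ∀ C, Odd (cnt r C) → IsCore (2 ^ k) C := fun C hC =>
        (lev_of_cnt_ne_zero hC.pos.ne').isCore (by omega)
      obtain ⟨Y, hXY, hYB⟩ := hXA.exists_lower hk hAc hAB
      refine ⟨Y, ⟨hXY, (odd_cnt_two_pow_add (by omega)).2 ⟨B, hYB, hB⟩⟩, ?_⟩
      rintro Y' ⟨hXY', hY'⟩
      obtain ⟨B', hYB', hB'⟩ := (odd_cnt_two_pow_add (by omega)).1 hY'
      obtain rfl := huniq B' ⟨hXA.lower hk hAc hXY' hYB' (hcore _ hB'), hB'⟩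
      exact Rem.lower_unique hk hXA hAc hXY' hYB' hXY hYB (hcore _ hB)

/-! ### From abaci back to partitions -/

section Transfer

theorem isOddPartition_iff {m : ℕ} {μ : YoungDiagram} (hμ : μ.card ≤ m) :
    IsOddPartition μ ↔ Odd (cnt μ.card (beads m μ)) := by
  rw [IsOddPartition, numChains_eq (rowLen_eq_zero_of_card_le hμ)]

theorem beads_inj {m : ℕ} {μ ν : YoungDiagram} (hμ : μ.card ≤ m) (hν : ν.card ≤ m) :
    beads m μ = beads m ν ↔ μ = ν :=
  ⟨beads_injective (rowLen_eq_zero_of_card_le hμ) (rowLen_eq_zero_of_card_le hν),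
    fun h => h ▸ rfl⟩

theorem exists_beads_eq_of_lev {m n : ℕ} {X : Finset ℕ} (h : X.card = m) (hn : Lev n X) :
    ∃ μ : YoungDiagram, μ.rowLen m = 0 ∧ μ.card = n ∧ beads m μ = X := by
  obtain ⟨μ, h1, rfl⟩ := exists_beads_eq h
  exact ⟨μ, h1, (lev_beads h1).eq hn, rfl⟩

theorem covBy_iff_rem_beads {m : ℕ} {μ ν : YoungDiagram} (hμ : μ.card ≤ m) (hν : ν.card ≤ m) :
    ν ⋖ μ ↔ Rem 1 (beads m μ) (beads m ν) :=
  covBy_iff_rem (rowLen_eq_zero_of_card_le hμ) (rowLen_eq_zero_of_card_le hν)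

theorem card_eq_zero_iff {μ : YoungDiagram} : μ.card = 0 ↔ μ = ⊥ := by
  constructor
  · intro h
    exact rowLen_ext fun i => by rw [rowLen_eq_zero_of_card_le (by omega), rowLen_bot]
  · rintro rfl
    exact card_bot

theorem existsUnique_odd_covBy {μ : YoungDiagram} (hμ : IsOddPartition μ) (hne : μ ≠ ⊥) :
    ∃! ν : YoungDiagram, IsOddPartition ν ∧ ν ⋖ μ := by
  have hodd := (isOddPartition_iff le_rfl).1 hμ
  obtain ⟨n, hn⟩ := Nat.exists_eq_add_one_of_ne_zero fun h => hne (card_eq_zero_iff.1 h)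
  set m := μ.card with hm
  rw [hn] at hodd
  obtain ⟨Y, ⟨hXY, hY⟩, huniq⟩ := existsUnique_odd_rem n _ hodd
  rw [← hn] at hXY huniq
  obtain ⟨ν, -, hν, rfl⟩ := exists_beads_eq_of_lev (hXY.card_eq.trans (card_beads m μ))
    (lev_of_cnt_ne_zero hY.pos.ne')
  have hνm : ν.card ≤ m := by omega
  refine ⟨ν, ⟨?_, (covBy_iff_rem_beads le_rfl hνm).2 hXY⟩, ?_⟩
  · rw [isOddPartition_iff hνm, hν]
    exact hY
  · rintro κ ⟨h1, h2⟩
    have hκ := card_of_covBy h2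
    have hκm : κ.card ≤ m := by omega
    rw [← beads_inj hκm hνm]
    refine huniq _ ⟨(covBy_iff_rem_beads le_rfl hκm).1 h2, ?_⟩
    rw [isOddPartition_iff hκm] at h1
    rwa [show κ.card = n by omega] at h1

theorem hookAt_of_rowLens {m k l : ℕ} {μ : YoungDiagram} (hk : 1 ≤ k) (hl : l < m)
    (h : μ.rowLens = k :: List.replicate l 1) :
    μ.rowLen m = 0 ∧ HookAt m (m - 1 - l) (k + l) (beads m μ) := by
  have hlen : μ.colLen 0 = l + 1 := by rw [← YoungDiagram.length_rowLens, h]; simp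
  have hz : ∀ i, l < i → μ.rowLen i = 0 := by
    intro i hi
    by_contra hne
    have h1 : (i, 0) ∈ μ := YoungDiagram.mem_iff_lt_rowLen.2 (Nat.pos_of_ne_zero hne)
    have := YoungDiagram.mem_iff_lt_colLen.1 h1
    omega
  have h0 : μ.rowLen 0 = k := by
    rw [← YoungDiagram.get_rowLens (h := by rw [h]; simp)]
    simp [h]
  have h1 : ∀ i, i ≠ 0 → i ≤ l → μ.rowLen i = 1 := by
    intro i hi hil
    obtain ⟨j, rfl⟩ := Nat.exists_eq_add_one_of_ne_zero hi
    rw [← YoungDiagram.get_rowLens (h := by rw [h]; simp; omega)]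
    simp [h]
  refine ⟨hz m hl, by omega, by omega, fun z => ?_⟩
  rw [mem_beads]
  constructor
  · rintro ⟨i, hi, hz'⟩
    rcases eq_or_ne i 0 with rfl | hi0
    · omega
    · rcases le_or_gt i l with hil | hil
      · have := h1 i hi0 hil
        omega
      · have := hz i hil
        omega
  · rintro (rfl | ⟨hzp, hzm⟩)
    · exact ⟨0, by omega, by omega⟩
    · by_cases hzl : z < m - 1 - l
      · refine ⟨m - 1 - z, by omega, ?_⟩
        rw [hz _ (by omega)]
        omega
      · refine ⟨m - z, by omega, ?_⟩
        rw [h1 _ (by omega) (by omega)]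
        omega

/-- For the converse, the diagram with the prescribed hook as row lengths has the same bead set, so
it is `μ`. The gap sits `l + 1` places below `m`, where `l` is the leg length. -/
theorem rowLens_eq_hook_iff {m k : ℕ} {μ : YoungDiagram} (hm : μ.card ≤ m) (hk : 1 ≤ k)
    (hkc : k ≤ μ.card) :
    μ.rowLens = k :: List.replicate (μ.card - k) 1 ↔
      HookAt m (m - 1 - (μ.card - k)) μ.card (beads m μ) := by
  constructor
  · intro h
    have := (hookAt_of_rowLens (m := m) hk (by omega) h).2
    rwa [show k + (μ.card - k) = μ.card by omega] at this
  · intro h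
    have hs : (k :: List.replicate (μ.card - k) 1).SortedGE := by
      refine List.Pairwise.sortedGE (List.pairwise_cons.2 ⟨?_, ?_⟩)
      · intro a ha
        rw [List.eq_of_mem_replicate ha]
        exact hk
      · rw [List.pairwise_replicate]
        simp
    have hp : ∀ x ∈ k :: List.replicate (μ.card - k) 1, 0 < x := by
      intro x hx
      rcases List.mem_cons.1 hx with rfl | hx
      · exact hk
      · rw [List.eq_of_mem_replicate hx]
        exact one_pos
    have hκ := YoungDiagram.rowLens_ofRowLens_eq_self (hw := hs) hp
    obtain ⟨h1, h2⟩ := hookAt_of_rowLens (m := m) hk (by omega) hκ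
    rw [show k + (μ.card - k) = μ.card by omega] at h2
    rwa [beads_injective h1 (rowLen_eq_zero_of_card_le hm) (h2.eq h)] at hκ

theorem isHook_iff {m : ℕ} {μ : YoungDiagram} (hm : μ.card ≤ m) :
    IsHook μ ↔ ∃ p, HookAt m p μ.card (beads m μ) := by
  constructor
  · rintro ⟨k, h1, h2, h3⟩
    exact ⟨_, (rowLens_eq_hook_iff hm h1 h2).1 h3⟩
  · rintro ⟨p, hp⟩
    have h1 := hp.1
    have h2 := hp.2.1
    refine ⟨p + μ.card + 1 - m, by omega, by omega, ?_⟩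
    rw [rowLens_eq_hook_iff hm (by omega) (by omega)]
    rwa [show m - 1 - (μ.card - (p + μ.card + 1 - m)) = p by omega]

theorem isOneDim_iff {m : ℕ} {μ : YoungDiagram} (hm : μ.card ≤ m) (h0 : μ.card ≠ 0) :
    IsOneDim μ ↔ HookAt m (m - 1) μ.card (beads m μ) ∨
      HookAt m (m - μ.card) μ.card (beads m μ) := by
  have h1 := rowLens_eq_hook_iff hm (k := μ.card) (by omega) le_rfl
  have h2 := rowLens_eq_hook_iff hm (k := 1) (by omega) (by omega)
  rw [show m - 1 - (μ.card - μ.card) = m - 1 by omega] at h1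
  rw [show m - 1 - (μ.card - 1) = m - μ.card by omega] at h2
  rw [← h1, ← h2, IsOneDim, Nat.sub_self, List.replicate_zero, ← List.replicate_succ,
    Nat.sub_add_cancel (by omega)]
  simp only [and_iff_right_iff_imp]
  omega

end Transfer

/-! ### Parents and cores of odd partitions -/

/-- The unique odd partition covered by a nonempty odd partition. -/
noncomputable def par (μ : YoungDiagram) : YoungDiagram :=
  Classical.epsilon fun ν => IsOddPartition ν ∧ ν ⋖ μ

/-- `A` arises from `μ` by removing a rim hook of length `2 ^ k`. -/
def RemY (k : ℕ) (μ A : YoungDiagram) : Prop :=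
  Rem (2 ^ k) (beads (2 ^ (k + 1)) μ) (beads (2 ^ (k + 1)) A)

/-- The `2 ^ k`-core of an odd partition of `n`, where `2 ^ k ≤ n < 2 ^ (k + 1)`. -/
noncomputable def core (k : ℕ) (μ : YoungDiagram) : YoungDiagram :=
  Classical.epsilon fun A => IsOddPartition A ∧ A.card + 2 ^ k = μ.card ∧ RemY k μ A

section Par

variable {μ ν : YoungDiagram}

theorem par_spec (h : IsOddPartition μ) (h0 : μ.card ≠ 0) : IsOddPartition (par μ) ∧ par μ ⋖ μ :=
  Classical.epsilon_spec
    (existsUnique_odd_covBy h fun hb => h0 (card_eq_zero_iff.2 hb)).exists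

theorem card_par (h : IsOddPartition μ) (h0 : μ.card ≠ 0) : (par μ).card + 1 = μ.card :=
  (card_of_covBy (par_spec h h0).2).symm

theorem eq_par (h : IsOddPartition μ) (hν : IsOddPartition ν) (hc : ν ⋖ μ) : ν = par μ := by
  have h0 : μ.card ≠ 0 := by
    rw [card_of_covBy hc]
    omega
  exact (existsUnique_odd_covBy h fun hb => h0 (card_eq_zero_iff.2 hb)).unique ⟨hν, hc⟩
    (par_spec h h0)

theorem covBy_iff_par (hμ : IsOddPartition μ) (hν : IsOddPartition ν) :
    ν ⋖ μ ↔ μ.card ≠ 0 ∧ ν = par μ := by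
  constructor
  · intro h
    exact ⟨by rw [card_of_covBy h]; omega, eq_par hμ hν h⟩
  · rintro ⟨h0, rfl⟩
    exact (par_spec hμ h0).2

end Par

section Core

variable {k : ℕ} {μ ν A B : YoungDiagram}

theorem RemY.card_eq (h : RemY k μ A) (hμ : μ.card < 2 ^ (k + 1)) (hA : A.card < 2 ^ (k + 1)) :
    A.card + 2 ^ k = μ.card := by
  have h1 := lev_beads (rowLen_eq_zero_of_card_le hμ.le)
  have h2 := lev_beads (rowLen_eq_zero_of_card_le hA.le)
  have h3 := h1.rem h
  have := h3.2.eq h2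
  omega

theorem isCore_beads (hA : A.card < 2 ^ k) : IsCore (2 ^ k) (beads (2 ^ (k + 1)) A) := by
  have : A.card ≤ 2 ^ (k + 1) := by rw [pow_succ]; omega
  exact (lev_beads (rowLen_eq_zero_of_card_le this)).isCore hA

theorem RemY.unique (h : RemY k μ A) (h' : RemY k μ B) (hA : A.card < 2 ^ k)
    (hB : B.card < 2 ^ k) : A = B := by
  have h1 : 2 ^ k ≤ 2 ^ (k + 1) := by rw [pow_succ]; omega
  exact (beads_inj (hA.le.trans h1) (hB.le.trans h1)).1 (Rem.unique h h' (isCore_beads hA))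

theorem RemY.isOdd_iff (h : RemY k μ A) (hμ : μ.card < 2 ^ (k + 1)) (hA : A.card < 2 ^ k) :
    IsOddPartition μ ↔ IsOddPartition A := by
  have h1 : 2 ^ k ≤ 2 ^ (k + 1) := by rw [pow_succ]; omega
  have h2 := h.card_eq hμ (by omega)
  rw [isOddPartition_iff hμ.le, isOddPartition_iff (hA.le.trans h1), ← h2, add_comm,
    odd_cnt_two_pow_add hA]
  constructor
  · rintro ⟨B, h3, h4⟩
    rwa [Rem.unique h h3 (isCore_beads hA)]
  · exact fun h3 => ⟨_, h, h3⟩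

theorem exists_remY (h : IsOddPartition μ) (h1 : 2 ^ k ≤ μ.card) (h2 : μ.card < 2 ^ (k + 1)) :
    ∃ A, IsOddPartition A ∧ A.card + 2 ^ k = μ.card ∧ RemY k μ A := by
  obtain ⟨r, hr⟩ := Nat.exists_eq_add_of_le h1
  have hrk : r < 2 ^ k := by rw [pow_succ] at h2; omega
  rw [isOddPartition_iff h2.le, hr, odd_cnt_two_pow_add hrk] at h
  obtain ⟨X, hX, hodd⟩ := h
  obtain ⟨A, hA, hAr, rfl⟩ := exists_beads_eq_of_lev (hX.card_eq.trans (card_beads _ μ))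
    (lev_of_cnt_ne_zero hodd.pos.ne')
  refine ⟨A, ?_, by omega, hX⟩
  rw [isOddPartition_iff (m := 2 ^ (k + 1)) (by omega), hAr]
  exact hodd

theorem core_spec (h : IsOddPartition μ) (h1 : 2 ^ k ≤ μ.card) (h2 : μ.card < 2 ^ (k + 1)) :
    IsOddPartition (core k μ) ∧ (core k μ).card + 2 ^ k = μ.card ∧ RemY k μ (core k μ) :=
  Classical.epsilon_spec (exists_remY h h1 h2)

theorem card_core_lt (h : IsOddPartition μ) (h1 : 2 ^ k ≤ μ.card) (h2 : μ.card < 2 ^ (k + 1)) :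
    (core k μ).card < 2 ^ k := by
  have := (core_spec h h1 h2).2.1
  rw [pow_succ] at h2
  omega

theorem RemY.eq_core (h : RemY k μ A) (hμ : μ.card < 2 ^ (k + 1)) (hA : A.card < 2 ^ k)
    (hodd : IsOddPartition μ) : A = core k μ := by
  have h2 := h.card_eq hμ (hA.trans (by rw [pow_succ]; omega))
  exact h.unique (core_spec hodd (by omega) hμ).2.2 hA (card_core_lt hodd (by omega) hμ)

/-- The core of the parent is odd and is covered by the core of `μ`, by `Rem.lower`; so it is the
parent of that core. -/
theorem par_core (hk : 1 ≤ k) (h : IsOddPartition μ) (h1 : 2 ^ k < μ.card)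
    (h2 : μ.card < 2 ^ (k + 1)) : par (core k μ) = core k (par μ) := by
  have hq : 2 ≤ 2 ^ k := Nat.le_self_pow (by omega) 2
  have hp := par_spec h (by omega)
  have hpc := card_par h (by omega)
  have hc := core_spec h h1.le h2
  have hc' := core_spec hp.1 (k := k) (by omega) (by omega)
  have h3 := pow_succ 2 k
  symm
  refine eq_par hc.1 hc'.1 ?_
  rw [covBy_iff_rem_beads (m := 2 ^ (k + 1)) (by omega) (by omega)]
  refine Rem.lower hq hc.2.2 (isCore_beads (card_core_lt h h1.le h2)) ?_ hc'.2.2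
    (isCore_beads (card_core_lt hp.1 (by omega) (by omega)))
  exact (covBy_iff_rem_beads (by omega) (by omega)).1 hp.2

theorem eq_of_par_eq_of_core_eq (hk : 1 ≤ k) (hμ : IsOddPartition μ) (hν : IsOddPartition ν)
    (h1 : 2 ^ k < μ.card) (h2 : μ.card < 2 ^ (k + 1)) (h1' : 2 ^ k < ν.card)
    (h2' : ν.card < 2 ^ (k + 1)) (hp : par μ = par ν) (hc : core k μ = core k ν) : μ = ν := by
  have hq : 2 ≤ 2 ^ k := Nat.le_self_pow (by omega) 2
  have hpμ := par_spec hμ (by omega)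
  have hpν := par_spec hν (by omega)
  have hpcμ := card_par hμ (by omega)
  have hcμ := core_spec hμ h1.le h2
  have hcν := core_spec hν h1'.le h2'
  have hcp := core_spec hpμ.1 (k := k) (by omega) (by omega)
  rw [← hp] at hpν
  rw [← hc] at hcν
  rw [← beads_inj h2.le h2'.le]
  exact Rem.upper_unique hq hcp.2.2 (isCore_beads (card_core_lt hpμ.1 (by omega) (by omega)))
    ((covBy_iff_rem_beads (by omega) (by omega)).1 hpμ.2) hcμ.2.2
    ((covBy_iff_rem_beads (by omega) (by omega)).1 hpν.2) hcν.2.2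
    (isCore_beads (card_core_lt hμ (by omega) (by omega)))

/-- The square is filled upwards. Together with `eq_of_par_eq_of_core_eq` this makes the children of
`μ` below level `2^(k+1)` correspond to the children of its core. The abacus has more beads than `μ`
has boxes, which supplies the bead at `0` required by `Rem.exists_upper`. -/
theorem exists_par_eq_core_eq (hk : 1 ≤ k) (hμ : IsOddPartition μ) (hA : IsOddPartition A)
    (h1 : 2 ^ k ≤ μ.card) (h2 : μ.card + 1 < 2 ^ (k + 1)) (h0 : A.card ≠ 0)
    (h : par A = core k μ) :
    ∃ ν, IsOddPartition ν ∧ ν.card = μ.card + 1 ∧ par ν = μ ∧ core k ν = A := by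
  have hq : 2 ≤ 2 ^ k := Nat.le_self_pow (by omega) 2
  have h3 := pow_succ 2 k
  have hc := core_spec hμ h1 (by omega)
  have hAc := card_par hA h0
  rw [h] at hAc
  have hlev := lev_beads (m := 2 ^ (k + 1)) (rowLen_eq_zero_of_card_le (μ := μ) (by omega))
  have hAp := par_spec hA h0
  rw [h] at hAp
  obtain ⟨X, hX, hXA⟩ := Rem.exists_upper hq hc.2.2
    (isCore_beads (card_core_lt hμ (by omega) (by omega)))
    ((covBy_iff_rem_beads (by omega) (by omega)).1 hAp.2)
    (zero_mem_of_lev hlev (by rw [card_beads]; omega))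
  obtain ⟨ν, -, hν, rfl⟩ := exists_beads_eq_of_lev (hX.card_eq.symm.trans (card_beads _ μ))
    (Rem.lev hX hlev)
  have hodd : IsOddPartition ν := (RemY.isOdd_iff hXA (by omega) (by omega)).2 hA
  refine ⟨ν, hodd, hν, ?_, ?_⟩
  · exact (eq_par hodd hμ ((covBy_iff_rem_beads (by omega) (by omega)).2 hX)).symm
  · exact (RemY.eq_core hXA (by omega) (by omega) hodd).symm

theorem isOddPartition_iff_hookAt {m : ℕ} (hμ : μ.card = 2 ^ k) (hm : 2 ^ k ≤ m) :
    IsOddPartition μ ↔ ∃ p, HookAt m p (2 ^ k) (beads m μ) := by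
  rw [isOddPartition_iff (hμ.le.trans hm), hμ, odd_cnt_two_pow (card_beads _ _)]

end Core

/-! ### The rooted tree and its branching -/

section RankedGraph

variable {V : Type*} {G : SimpleGraph V} {r : V} {rank : V → ℕ} {p : V → V}

/-- A graph whose edges join each vertex other than the root to a parent of rank one less is
connected, and rank is distance because an edge changes it by one. -/
theorem dist_eq_rank_and_isTree
    (hadj : ∀ u v, G.Adj u v ↔ (rank v ≠ 0 ∧ u = p v) ∨ (rank u ≠ 0 ∧ v = p u))
    (hp : ∀ v, rank v ≠ 0 → rank (p v) + 1 = rank v) (hr : ∀ v, rank v = 0 ↔ v = r) :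
    (∀ v, G.dist r v = rank v) ∧ G.IsTree := by
  classical
  have hwalk : ∀ n v, rank v = n → ∃ w : G.Walk r v, w.length = n := by
    intro n
    induction n with
    | zero =>
      intro v hv
      obtain rfl := (hr v).1 hv
      exact ⟨.nil, rfl⟩
    | succ n ih =>
      intro v hv
      have h0 : rank v ≠ 0 := by omega
      obtain ⟨w, hw⟩ := ih (p v) (by have := hp v h0; omega)
      exact ⟨w.concat ((hadj _ _).2 (Or.inl ⟨h0, rfl⟩)), by simp [hw]⟩
  have hstep : ∀ u v, G.Adj u v → rank v ≤ rank u + 1 := by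
    intro u v h
    rcases (hadj u v).1 h with ⟨h1, rfl⟩ | ⟨h1, rfl⟩
    · exact (hp v h1).ge
    · have := hp u h1
      omega
  have hlen : ∀ u v (w : G.Walk u v), rank v ≤ rank u + w.length := by
    intro u v w
    induction w with
    | nil => simp
    | cons h w ih =>
      have := hstep _ _ h
      simp only [SimpleGraph.Walk.length_cons]
      omega
  have hreach : ∀ v, G.Reachable r v := fun v => ⟨(hwalk _ v rfl).choose⟩
  have hr0 : rank r = 0 := (hr r).2 rfl
  refine ⟨fun v => le_antisymm ?_ ?_, ?_⟩
  · obtain ⟨w, hw⟩ := hwalk _ v rfl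
    exact hw ▸ SimpleGraph.dist_le w
  · obtain ⟨w, hw⟩ := (hreach v).exists_walk_length_eq_dist
    have := hlen _ _ w
    omega
  · have : Nonempty V := ⟨r⟩
    refine ⟨⟨fun u v => (hreach u).symm.trans (hreach v)⟩, ?_⟩
    intro v c hc
    -- At a vertex of maximal rank both neighbours along the cycle would have to be its parent, but
    -- they are distinct.
    obtain ⟨u, hu, hmax⟩ := c.support.toFinset.exists_max_image rank ⟨v, by simp⟩
    rw [List.mem_toFinset] at hu
    have hc' := hc.rotate hu
    have key : ∀ x, G.Adj u x → x ∈ (c.rotate u hu).support → x = p u := by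
      intro x hx hmem
      rcases (hadj u x).1 hx with ⟨h1, rfl⟩ | ⟨h1, rfl⟩
      · have h2 := hp x h1
        have h3 := hmax x (by
          rw [List.mem_toFinset]
          exact (SimpleGraph.Walk.mem_support_rotate_iff _ _ hu).1 hmem)
        omega
      · rfl
    refine hc'.snd_ne_penultimate ?_
    rw [key _ (SimpleGraph.Walk.adj_snd hc'.not_nil) (SimpleGraph.Walk.getVert_mem_support _ _),
      key _ (SimpleGraph.Walk.adj_penultimate hc'.not_nil).symm
        (SimpleGraph.Walk.getVert_mem_support _ _)]

end RankedGraph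

/-- Among three odd partitions with the same parent, two coincide. -/
theorem eq_or_eq_of_par_eq (n : ℕ) (μ : YoungDiagram) (hn : μ.card = n) (ν : Fin 3 → YoungDiagram)
    (hν : ∀ i, IsOddPartition (ν i)) (hc : ∀ i, (ν i).card = n + 1) (hp : ∀ i, par (ν i) = μ) :
    ∃ i j, i ≠ j ∧ ν i = ν j := by
  induction n using Nat.strong_induction_on generalizing μ ν with
  | _ n ih =>
    obtain ⟨k, r, hr, hkr⟩ := exists_eq_two_pow_add n
    have hpow := pow_succ 2 k
    have hspec := fun i => par_spec (hν i) (by rw [hc]; omega)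
    rcases r with _ | r
    -- The three partitions are hooks of size `2^k`. If the common parent has its gap at `a`, their
    -- gaps lie in `{a - 1, a}`, so two coincide. For `n = 0` there is only one partition of size
    -- one.
    · set m := n + 1 with hm
      have hook : ∀ i, ∃ p, HookAt m p m (beads m (ν i)) := by
        intro i
        obtain ⟨p, h⟩ := (isOddPartition_iff_hookAt (k := k) (by rw [hc]; omega) hkr.ge).1 (hν i)
        rw [add_zero] at hkr
        rw [← hkr] at h
        exact ⟨p, h⟩
      choose p hp' using hook
      have hinj : ∀ i j, p i = p j → ν i = ν j := by
        intro i j hij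
        have h1 := hp' j
        rw [← hij] at h1
        exact (beads_inj (hc i).le (hc j).le).1 ((hp' i).eq h1)
      have hμm : μ.card ≤ m := by omega
      have hrem : ∀ i, Rem 1 (beads m (ν i)) (beads m μ) := fun i => by
        rw [← hp i]
        exact (covBy_iff_rem_beads (hc i).le (by rw [hp i]; exact hμm)).1 (hspec i).2
      rcases Nat.eq_zero_or_pos n with h0 | hpos
      · have h1 := (hp' 0).1
        have h2 := (hp' 1).1
        exact ⟨0, 1, by decide, hinj _ _ (by omega)⟩
      · have hor := fun i => (hp' i).rem_one hpos (hrem i)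
        have hex : ∃ a, HookAt m a n (beads m μ) := by
          rcases hor 0 with h | h <;> exact ⟨_, h⟩
        obtain ⟨a, ha⟩ := hex
        have hpa : ∀ i, p i = a ∨ p i + 1 = a := fun i =>
          (hor i).imp (fun h => h.pos_unique ha) (fun h => h.pos_unique ha)
        have h0 := hpa 0
        have h1 := hpa 1
        have h2 := hpa 2
        by_cases h01 : p 0 = p 1
        · exact ⟨0, 1, by decide, hinj _ _ h01⟩
        by_cases h02 : p 0 = p 2
        · exact ⟨0, 2, by decide, hinj _ _ h02⟩
        · exact ⟨1, 2, by decide, hinj _ _ (by omega)⟩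
    -- The three cores share the parent `core k μ`, so two cores coincide by induction, and with
    -- them the partitions themselves.
    · have hk : 1 ≤ k := by
        by_contra hk
        have : k = 0 := by omega
        subst this
        simp at hr
      have hcs := fun i => core_spec (hν i) (k := k) (by rw [hc]; omega) (by rw [hc]; omega)
      obtain ⟨i, j, hij, h⟩ := ih r (by have := Nat.one_le_two_pow (n := k); omega) (core k μ) (by
          have := (core_spec (hspec 0).1 (k := k) (by rw [hp]; omega) (by rw [hp]; omega)).2.1
          rw [hp] at this
          omega) (fun i => core k (ν i)) (fun i => (hcs i).1)
        (fun i => by have := (hcs i).2.1; have := hc i; omega)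
        (fun i => by
          rw [par_core hk (hν i) (by rw [hc]; omega) (by rw [hc]; omega), hp])
      refine ⟨i, j, hij, ?_⟩
      exact eq_of_par_eq_of_core_eq hk (hν i) (hν j) (by rw [hc]; omega) (by rw [hc]; omega)
        (by rw [hc]; omega) (by rw [hc]; omega) ((hp i).trans (hp j).symm) h

theorem tree_adj_iff (u v : {μ : YoungDiagram | IsOddPartition μ}) :
    tree.Adj u v ↔ (v.1.card ≠ 0 ∧ u.1 = par v.1) ∨ (u.1.card ≠ 0 ∧ v.1 = par u.1) := by
  rw [SimpleGraph.comap_adj, SimpleGraph.hasse_adj]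
  exact or_congr (covBy_iff_par v.2 u.2) (covBy_iff_par u.2 v.2)

theorem isRootedBinaryTree_tree : IsRootedBinaryTree tree root := by
  classical
  let p : {μ : YoungDiagram | IsOddPartition μ} → {μ : YoungDiagram | IsOddPartition μ} :=
    fun v => if h : v.1.card ≠ 0 then ⟨par v.1, (par_spec v.2 h).1⟩ else v
  have hp : ∀ v (_ : v.1.card ≠ 0), (p v).1 = par v.1 := fun v h => by simp only [p, dif_pos h]
  obtain ⟨hdist, htree⟩ := dist_eq_rank_and_isTree (G := tree) (r := root)
    (rank := fun v => v.1.card) (p := p) (by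
      intro u v
      rw [tree_adj_iff]
      refine or_congr (and_congr_right fun h => ?_) (and_congr_right fun h => ?_) <;>
        rw [Subtype.ext_iff, hp _ h]) (by
      intro v h
      rw [hp v h]
      exact card_par v.2 h) (fun v => by rw [card_eq_zero_iff, Subtype.ext_iff]; rfl)
  refine ⟨htree, fun v => ?_⟩
  by_contra! hlt
  obtain ⟨t, hts, ht⟩ := Set.exists_subset_encard_eq (k := 3)
    ((show (3 : ℕ∞) = 2 + 1 by norm_num) ▸ Order.add_one_le_of_lt hlt)
  obtain ⟨x, y, z, hxy, hxz, hyz, rfl⟩ := Set.encard_eq_three.1 ht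
  have hprop : ∀ w ∈ ({x, y, z} : Set _), w.1.card = v.1.card + 1 ∧ par w.1 = v.1 := by
    intro w hw
    obtain ⟨h1, h2⟩ := hts hw
    rw [hdist, hdist] at h2
    rcases (tree_adj_iff v w).1 h1 with h3 | ⟨h3, h4⟩
    · exact ⟨h2, h3.2.symm⟩
    · have := card_par v.2 h3
      rw [h4] at h2
      omega
  have hmem : ∀ i : Fin 3, ![x, y, z] i ∈ ({x, y, z} : Set _) := by
    intro i
    fin_cases i <;> simp
  obtain ⟨i, j, hij, h⟩ := eq_or_eq_of_par_eq _ v.1 rfl (fun i => (![x, y, z] i).1)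
    (fun i => (![x, y, z] i).2) (fun i => (hprop _ (hmem i)).1) (fun i => (hprop _ (hmem i)).2)
  have h' : ![x, y, z] i = ![x, y, z] j := Subtype.ext h
  fin_cases i <;> fin_cases j <;> simp_all

/-! ### Ancestors of size `2^k` -/

/-- The ancestor of size `2 ^ k`. -/
noncomputable def anc (k : ℕ) (μ : YoungDiagram) : YoungDiagram := par^[μ.card - 2 ^ k] μ

/-- The position of the moved bead of a hook on the abacus with `2 ^ (k + 1)` beads. -/
noncomputable def hpos (k : ℕ) (μ : YoungDiagram) : ℕ :=
  Classical.epsilon fun p => HookAt (2 ^ (k + 1)) p μ.card (beads (2 ^ (k + 1)) μ)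

section Anc

variable {k : ℕ} {μ ν : YoungDiagram}

theorem anc_of_card_eq (h : μ.card = 2 ^ k) : anc k μ = μ := by simp [anc, h]

theorem anc_par (hμ : IsOddPartition μ) (h : 2 ^ k < μ.card) : anc k (par μ) = anc k μ := by
  have := Nat.one_le_two_pow (n := k)
  have := card_par hμ (by omega)
  rw [anc, anc, show μ.card - 2 ^ k = ((par μ).card - 2 ^ k) + 1 by omega, Function.iterate_succ,
    Function.comp]

theorem anc_spec (hμ : IsOddPartition μ) (h : 2 ^ k ≤ μ.card) :
    IsOddPartition (anc k μ) ∧ (anc k μ).card = 2 ^ k := by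
  have hpos := Nat.one_le_two_pow (n := k)
  obtain ⟨n, hn⟩ := Nat.exists_eq_add_of_le h
  induction n generalizing μ with
  | zero => rw [anc_of_card_eq (by omega)]; exact ⟨hμ, by omega⟩
  | succ n ih =>
    have := card_par hμ (by omega)
    rw [← anc_par (k := k) hμ (by omega)]
    exact ih (par_spec hμ (by omega)).1 (by omega) (by omega)

/-- Descend along parents until size `2^k`: equal cores have equal parents, and at each level the
parent and the core determine the partition. -/
theorem eq_of_anc_eq_of_core_eq (hk : 1 ≤ k) (hμ : IsOddPartition μ) (hν : IsOddPartition ν)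
    (h1 : 2 ^ k ≤ μ.card) (h2 : μ.card < 2 ^ (k + 1)) (h1' : 2 ^ k ≤ ν.card)
    (h2' : ν.card < 2 ^ (k + 1)) (ha : anc k μ = anc k ν) (hc : core k μ = core k ν) : μ = ν := by
  obtain ⟨n, hn⟩ := Nat.exists_eq_add_of_le h1
  have hcμ := (core_spec hμ h1 h2).2.1
  have hcν := (core_spec hν h1' h2').2.1
  rw [hc] at hcμ
  induction n generalizing μ ν with
  | zero => rwa [anc_of_card_eq (by omega), anc_of_card_eq (by omega)] at ha
  | succ n ih =>
    have hpμ := card_par hμ (by omega)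
    have hpν := card_par hν (by omega)
    have hoμ := (par_spec hμ (by omega)).1
    have hoν := (par_spec hν (by omega)).1
    have hcp : core k (par μ) = core k (par ν) := by
      rw [← par_core hk hμ (by omega) h2, ← par_core hk hν (by omega) h2', hc]
    have hcpμ := (core_spec hoμ (k := k) (by omega) (by omega)).2.1
    rw [hcp] at hcpμ
    refine eq_of_par_eq_of_core_eq hk hμ hν (by omega) h2 (by omega) h2' ?_ hc
    refine ih hoμ hoν (by omega) (by omega) (by omega) (by omega) ?_ hcp (by omega) hcpμ
      (core_spec hoν (k := k) (by omega) (by omega)).2.1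
    rw [anc_par hμ (by omega), anc_par hν (by omega), ha]

/-- Starting from `μ`, whose core is empty, the path from the empty partition to `A` is lifted one
box at a time. -/
theorem exists_anc_eq_core_eq {A : YoungDiagram} (hk : 1 ≤ k) (hμ : IsOddPartition μ)
    (h1 : μ.card = 2 ^ k) (hA : IsOddPartition A) (h2 : A.card < 2 ^ k) :
    ∃ ν, IsOddPartition ν ∧ ν.card = 2 ^ k + A.card ∧ anc k ν = μ ∧ core k ν = A := by
  have h3 := pow_succ 2 k
  induction hn : A.card generalizing A with
  | zero =>
    have hc := core_spec hμ (k := k) (by omega) (by omega)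
    refine ⟨μ, hμ, by omega, anc_of_card_eq h1, ?_⟩
    rw [card_eq_zero_iff.1 hn]
    exact card_eq_zero_iff.1 (by omega)
  | succ n ih =>
    have hp := card_par hA (by omega)
    obtain ⟨ν, hν, hνc, hνa, hνA⟩ := ih (par_spec hA (by omega)).1 (by omega) (by omega)
    obtain ⟨κ, hκ, hκc, hκp, hκA⟩ := exists_par_eq_core_eq hk hν hA (by omega) (by omega)
      (by omega) hνA.symm
    refine ⟨κ, hκ, by omega, ?_, hκA⟩
    rw [← anc_par hκ (by omega), hκp, hνa]

end Anc

/-! ### Odd hooks, their ancestors and parities -/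

section Hooks

variable {k p n : ℕ} {μ ν : YoungDiagram}

theorem hpos_eq (h : HookAt (2 ^ (k + 1)) p μ.card (beads (2 ^ (k + 1)) μ)) : hpos k μ = p :=
  (Classical.epsilon_spec (p := fun p => HookAt (2 ^ (k + 1)) p μ.card (beads (2 ^ (k + 1)) μ))
    ⟨p, h⟩).pos_unique h

theorem exists_hook (h1 : p < 2 ^ (k + 1)) (h2 : 2 ^ (k + 1) ≤ p + n) (hn : n ≠ 0) :
    ∃ μ : YoungDiagram, μ.card = n ∧ HookAt (2 ^ (k + 1)) p n (beads (2 ^ (k + 1)) μ) := by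
  obtain ⟨X, hX⟩ := exists_hookAt h1 h2
  obtain ⟨μ, -, hμ, rfl⟩ := exists_beads_eq_of_lev (hX.card hn) (hX.lev hn)
  exact ⟨μ, hμ, hX⟩

theorem HookAt.par {m : ℕ} (hn : 1 ≤ n) (hμ : IsOddPartition μ) (hc : μ.card = n + 1)
    (hm : n + 1 ≤ m) (h : HookAt m p (n + 1) (beads m μ)) :
    HookAt m p n (beads m (par μ)) ∨ HookAt m (p + 1) n (beads m (par μ)) := by
  have h1 := par_spec hμ (by omega)
  have h2 := card_par hμ (by omega)
  exact h.rem_one hn ((covBy_iff_rem_beads (by omega) (by omega)).1 h1.2)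

theorem eq_par_of_hookAt {m p' : ℕ} (hn : 1 ≤ n) (hμ : IsOddPartition μ) (hν : IsOddPartition ν)
    (hc : μ.card = n + 1) (hc' : ν.card = n) (hm : n + 1 ≤ m)
    (h : HookAt m p (n + 1) (beads m μ)) (h' : HookAt m p' n (beads m ν))
    (hp : p' = p ∨ p' = p + 1) : ν = Macdonald.par μ :=
  eq_par hμ hν ((covBy_iff_rem_beads (by omega) (by omega)).2 ((h.rem_one_iff hn h').2 hp))

/-- If the core of an odd hook is a hook with shorter arm, then its ancestor is a row. -/
theorem hookAt_anc_of_arm {j : ℕ} (hj : 1 ≤ j) (hμ : IsOddPartition μ)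
    (hc : μ.card = j + 2 ^ k) (hjk : j < 2 ^ k)
    (h : HookAt (2 ^ (k + 1)) p (j + 2 ^ k) (beads (2 ^ (k + 1)) μ))
    (h' : HookAt (2 ^ (k + 1)) p j (beads (2 ^ (k + 1)) (core k μ))) :
    HookAt (2 ^ (k + 1)) (2 ^ (k + 1) - 1) (2 ^ k) (beads (2 ^ (k + 1)) (anc k μ)) := by
  have hpow := pow_succ 2 k
  induction j, hj using Nat.le_induction generalizing μ p with
  | base =>
    have h1 := h'.1
    have h2 := h'.2.1
    rw [add_comm 1 (2 ^ k)] at h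
    rw [← anc_par (k := k) hμ (by omega),
      anc_of_card_eq (k := k) (by have := card_par hμ (by omega); omega)]
    rcases HookAt.par (m := 2 ^ (k + 1)) (n := 2 ^ k) Nat.one_le_two_pow hμ (by omega) (by omega) h with h3 | h3
    · rwa [show p = 2 ^ (k + 1) - 1 by omega] at h3
    · have := h3.1
      omega
  | succ j hj ih =>
    have hA := core_spec hμ (k := k) (by omega) (by omega)
    have hB := par_spec hA.1 (by omega)
    have hBc := card_par hA.1 (by omega)
    -- The parent of the core is again a hook. Lengthening its arm by `2^k` gives an odd hook
    -- covered by `μ`, hence the parent of `μ`, to which the induction hypothesis applies.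
    have key : ∀ p', (p' = p ∨ p' = p + 1) →
        HookAt (2 ^ (k + 1)) p' j (beads (2 ^ (k + 1)) (par (core k μ))) →
        HookAt (2 ^ (k + 1)) (2 ^ (k + 1) - 1) (2 ^ k) (beads (2 ^ (k + 1)) (anc k μ)) := by
      intro p' hp' hB'
      obtain ⟨ν, hνc, hν⟩ := exists_hook (k := k) (n := j + 2 ^ k) hB'.1
        (by have := hB'.2.1; omega) (by omega)
      have hrem : RemY k ν (par (core k μ)) := hν.rem_arm Nat.one_le_two_pow hB'
      have hodd := (hrem.isOdd_iff (by omega) (by omega)).2 hB.1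
      have hcore := hrem.eq_core (by omega) (by omega) hodd
      rw [add_right_comm] at h
      rw [← anc_par (k := k) hμ (by omega),
        ← eq_par_of_hookAt (by omega) hμ hodd (by omega) hνc (by omega) h hν hp']
      exact ih hodd hνc (by omega) hν (hcore ▸ hB')
    rcases h'.par hj hA.1 (by omega) (by omega) with h3 | h3
    · exact key _ (Or.inl rfl) h3
    · exact key _ (Or.inr rfl) h3

/-- If the core of an odd hook is a hook with shorter leg, then its ancestor is a column. -/
theorem hookAt_anc_of_leg {j : ℕ} (hj : 1 ≤ j) (hμ : IsOddPartition μ)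
    (hc : μ.card = j + 2 ^ k) (hjk : j < 2 ^ k)
    (h : HookAt (2 ^ (k + 1)) p (j + 2 ^ k) (beads (2 ^ (k + 1)) μ))
    (h' : HookAt (2 ^ (k + 1)) (p + 2 ^ k) j (beads (2 ^ (k + 1)) (core k μ))) :
    HookAt (2 ^ (k + 1)) (2 ^ k) (2 ^ k) (beads (2 ^ (k + 1)) (anc k μ)) := by
  have hpow := pow_succ 2 k
  induction j, hj using Nat.le_induction generalizing μ p with
  | base =>
    have h1 := h'.1
    have h2 := h'.2.1
    rw [add_comm 1 (2 ^ k)] at h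
    rw [← anc_par (k := k) hμ (by omega),
      anc_of_card_eq (k := k) (by have := card_par hμ (by omega); omega)]
    rcases HookAt.par (m := 2 ^ (k + 1)) (n := 2 ^ k) Nat.one_le_two_pow hμ (by omega) (by omega) h with h3 | h3
    · have := h3.2.1
      omega
    · rwa [show p + 1 = 2 ^ k by omega] at h3
  | succ j hj ih =>
    have hA := core_spec hμ (k := k) (by omega) (by omega)
    have hB := par_spec hA.1 (by omega)
    have hBc := card_par hA.1 (by omega)
    have key : ∀ p', (p' = p ∨ p' = p + 1) →
        HookAt (2 ^ (k + 1)) (p' + 2 ^ k) j (beads (2 ^ (k + 1)) (par (core k μ))) →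
        HookAt (2 ^ (k + 1)) (2 ^ k) (2 ^ k) (beads (2 ^ (k + 1)) (anc k μ)) := by
      intro p' hp' hB'
      obtain ⟨ν, hνc, hν⟩ := exists_hook (k := k) (p := p') (n := j + 2 ^ k)
        (by have := hB'.1; omega) (by have := hB'.2.1; omega) (by omega)
      have hrem : RemY k ν (par (core k μ)) := hν.rem_leg Nat.one_le_two_pow hj hB'
      have hodd := (hrem.isOdd_iff (by omega) (by omega)).2 hB.1
      have hcore := hrem.eq_core (by omega) (by omega) hodd
      rw [add_right_comm] at h
      rw [← anc_par (k := k) hμ (by omega),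
        ← eq_par_of_hookAt (by omega) hμ hodd (by omega) hνc (by omega) h hν hp']
      exact ih hodd hνc (by omega) hν (hcore ▸ hB')
    rcases h'.par hj hA.1 (by omega) (by omega) with h3 | h3
    · exact key _ (Or.inl rfl) h3
    · rw [add_right_comm] at h3
      exact key _ (Or.inr rfl) h3

/-- The hooks of size `2 ^ k - 1` are odd for every other leg length. -/
theorem isOddPartition_hook_iff (hk : 1 ≤ k) (hc : μ.card = 2 ^ k - 1)
    (h : HookAt (2 ^ (k + 1)) p (2 ^ k - 1) (beads (2 ^ (k + 1)) μ)) :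
    IsOddPartition μ ↔ Odd p := by
  have hpow := pow_succ 2 k
  have hq : 2 ≤ 2 ^ k := Nat.le_self_pow (by omega) 2
  obtain ⟨n, hn⟩ : ∃ n, 2 ^ k = n + 1 := ⟨2 ^ k - 1, by omega⟩
  rw [show 2 ^ k - 1 = n by omega] at hc h
  have h1 := h.1
  have h2 := h.2.1
  obtain ⟨j, hj⟩ : ∃ j, p + j + 1 = 2 ^ (k + 1) := ⟨2 ^ (k + 1) - 1 - p, by omega⟩
  have key : ∀ {p μ}, μ.card = n → HookAt (2 ^ (k + 1)) p n (beads (2 ^ (k + 1)) μ) →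
      ∃ κ, IsOddPartition κ ∧ κ.card = n + 1 ∧
        HookAt (2 ^ (k + 1)) p (n + 1) (beads (2 ^ (k + 1)) κ) ∧
        (IsOddPartition μ → μ = par κ) := by
    intro p μ hc h
    obtain ⟨κ, hκc, hκ⟩ := exists_hook (k := k) (n := n + 1) h.1
      (by have := h.2.1; omega) (by omega)
    have hodd : IsOddPartition κ :=
      (isOddPartition_iff_hookAt (k := k) (m := 2 ^ (k + 1)) (by omega) (by omega)).2
        ⟨p, by rwa [hn]⟩
    exact ⟨κ, hodd, hκc, hκ, fun ho =>
      eq_par_of_hookAt (m := 2 ^ (k + 1)) (by omega) hodd ho hκc hc (by omega) hκ h (Or.inl rfl)⟩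
  have heven : Even (2 ^ (k + 1)) := (even_two).pow_of_ne_zero (by omega)
  -- The variable `j` is the leg length. Every hook of size `2^k` is odd and has exactly one odd
  -- lower neighbour, so of the gaps `p` and `p + 1` exactly one belongs to an odd hook. Oddness
  -- thus alternates, starting from the row, whose gap `2^(k+1) - 1` is odd.
  induction j generalizing p μ with
  | zero =>
    obtain ⟨κ, hodd, hκc, hκ, -⟩ := key hc h
    have hpar : HookAt (2 ^ (k + 1)) p n (beads (2 ^ (k + 1)) (par κ)) := by
      rcases hκ.par (by omega) hodd hκc (by omega) with h3 | h3
      · exact h3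
      · have := h3.1
        omega
    have hpc := card_par hodd (by omega)
    have hμκ : μ = par κ := (beads_inj (by omega) (by omega)).1 (h.eq hpar)
    refine iff_of_true (hμκ ▸ (par_spec hodd (by omega)).1) ?_
    rw [add_zero] at hj
    rw [← hj, Nat.even_add_one, Nat.not_even_iff_odd] at heven
    exact heven
  | succ j ih =>
    obtain ⟨κ, hodd, hκc, hκ, hκμ⟩ := key hc h
    obtain ⟨ν, hνc, hν⟩ := exists_hook (k := k) (p := p + 1) (n := n) (by omega) (by omega)
      (by omega)
    have hpc := card_par hodd (by omega)
    have hiff : IsOddPartition ν ↔ Odd (p + 1) := ih hν hνc hν.1 hν.2.1 (by omega)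
    rw [← not_iff_not, ← Nat.odd_add_one, ← hiff]
    constructor
    · intro hμ
      have hps := (par_spec hodd (by omega)).1
      rcases hκ.par (by omega) hodd hκc (by omega) with h3 | h3
      · rw [← (beads_inj (by omega) (by omega)).1 (h.eq h3)] at hps
        exact absurd hps hμ
      · rwa [← (beads_inj (by omega) (by omega)).1 (hν.eq h3)] at hps
    · intro hνo hμ
      have h4 := eq_par_of_hookAt (by omega) hodd hνo hκc hνc (by omega) hκ hν (Or.inr rfl)
      rw [← h4] at hκμ
      have h5 := hκμ hμ
      subst h5
      have := h.pos_unique hν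
      omega

end Hooks

/-! ### The two hooks above an odd hook -/

/-- Of the two hooks of size `2 ^ k` above a given odd hook, the rule that selects the one
carrying the distinguished copy. -/
def side (k p : ℕ) : Fin 2 :=
  if p = 2 ^ k then 0 else if p = 2 ^ k + 1 then 1 else if Odd p then 0 else 1

section Hooks

variable {k : ℕ} {μ ν : YoungDiagram}

theorem exists_hookAt_of_card_eq (hμ : IsOddPartition μ) (hc : μ.card = 2 ^ k) :
    ∃ p, HookAt (2 ^ (k + 1)) p (2 ^ k) (beads (2 ^ (k + 1)) μ) :=
  (isOddPartition_iff_hookAt hc (by rw [pow_succ]; omega)).1 hμ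

theorem hpos_eq' {p : ℕ} (hc : μ.card = 2 ^ k)
    (h : HookAt (2 ^ (k + 1)) p (2 ^ k) (beads (2 ^ (k + 1)) μ)) : hpos k μ = p :=
  hpos_eq (by rwa [hc])

theorem not_odd_of_eq_two_pow (hk : 1 ≤ k) {p : ℕ} (hp : p = 2 ^ k) : ¬ Odd p := by
  rw [hp, Nat.not_odd_iff_even]
  exact even_two.pow_of_ne_zero (by omega)

/-- The parent of an odd hook of size `2 ^ k` is an odd hook. -/
theorem exists_hookAt_par (hk : 1 ≤ k) (hμ : IsOddPartition μ) (hc : μ.card = 2 ^ k) {p : ℕ}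
    (h : HookAt (2 ^ (k + 1)) p (2 ^ k) (beads (2 ^ (k + 1)) μ)) :
    ∃ p', HookAt (2 ^ (k + 1)) p' (2 ^ k - 1) (beads (2 ^ (k + 1)) (par μ)) ∧ Odd p' ∧
      (p' = p ∨ p' = p + 1) := by
  have hpow := pow_succ 2 k
  have hq : 2 ≤ 2 ^ k := Nat.le_self_pow (by omega) 2
  obtain ⟨n, hn⟩ : ∃ n, 2 ^ k = n + 1 := ⟨2 ^ k - 1, by omega⟩
  have hps := par_spec hμ (by omega)
  have hpc := card_par hμ (by omega)
  have hodd : ∀ p', HookAt (2 ^ (k + 1)) p' (2 ^ k - 1) (beads (2 ^ (k + 1)) (par μ)) → Odd p' :=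
    fun p' h' => (isOddPartition_hook_iff hk (by omega) h').1 hps.1
  have h' := h
  rw [hn] at h'
  rcases HookAt.par (m := 2 ^ (k + 1)) (n := n) (by omega) hμ (by omega) (by omega) h' with h3 | h3
  all_goals rw [show n = 2 ^ k - 1 by omega] at h3
  · exact ⟨_, h3, hodd _ h3, Or.inl rfl⟩
  · exact ⟨_, h3, hodd _ h3, Or.inr rfl⟩

/-- The two children of a hook with odd gap `p'` have gaps `p'` and `p' - 1`, so parity tells them
apart. The row has an odd gap and gets label `0`. The column of size `2^k` has the even gap `2^k`;
the labels of the pair `2^k`, `2^k + 1` are therefore interchanged, which gives the column label `0`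
as well. -/
theorem side_eq_side {p p' : ℕ} (hk : 2 ≤ k) (h : side k p = side k p')
    (hp : p' = p + 1) (hodd : Odd p') : False := by
  have hq : 4 ≤ 2 ^ k := by
    calc 4 = 2 ^ 2 := rfl
      _ ≤ 2 ^ k := Nat.pow_le_pow_right (by norm_num) hk
  have heven : ¬ Odd (2 ^ k) := not_odd_of_eq_two_pow (by omega) rfl
  have hpe : ¬ Odd p := by
    rw [hp, Nat.odd_add_one] at hodd
    exact hodd
  unfold side at h
  by_cases h1 : p = 2 ^ k
  · have h2 : p' = 2 ^ k + 1 := by omega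
    have h3 : ¬ p' = 2 ^ k := by omega
    rw [if_pos h1, if_neg h3, if_pos h2] at h
    exact absurd h (by decide)
  · have h2 : ¬ p' = 2 ^ k + 1 := by omega
    have h3 : ¬ p' = 2 ^ k := by
      rintro rfl
      exact heven hodd
    have h4 : ¬ p = 2 ^ k + 1 := by
      rintro rfl
      exact hpe (by rw [Nat.odd_add_one]; exact heven)
    rw [if_neg h1, if_neg h4, if_neg hpe, if_neg h3, if_neg h2, if_pos hodd] at h
    exact absurd h (by decide)

theorem eq_of_par_eq_of_side_eq (hk : 2 ≤ k) (hμ : IsOddPartition μ) (hν : IsOddPartition ν)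
    (hcμ : μ.card = 2 ^ k) (hcν : ν.card = 2 ^ k) (hp : par μ = par ν)
    (hs : side k (hpos k μ) = side k (hpos k ν)) : μ = ν := by
  have hpow := pow_succ 2 k
  obtain ⟨a, ha⟩ := exists_hookAt_of_card_eq hμ hcμ
  obtain ⟨b, hb⟩ := exists_hookAt_of_card_eq hν hcν
  rw [hpos_eq' hcμ ha, hpos_eq' hcν hb] at hs
  obtain ⟨s, hs1, hs2, hs3⟩ := exists_hookAt_par (by omega) hμ hcμ ha
  obtain ⟨t, ht1, ht2, ht3⟩ := exists_hookAt_par (by omega) hν hcν hb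
  rw [← hp] at ht1
  obtain rfl := hs1.pos_unique ht1
  have hab : a = b := by
    rcases hs3 with rfl | rfl <;> rcases ht3 with h | h
    · exact h
    · exact (side_eq_side hk hs.symm h hs2).elim
    · exact (side_eq_side hk hs h.symm (h ▸ hs2)).elim
    · omega
  subst hab
  exact (beads_inj (by omega) (by omega)).1 (ha.eq hb)

theorem exists_par_eq_side_eq (hk : 2 ≤ k) {s : YoungDiagram} (hs : IsOddPartition s)
    (hsc : s.card = 2 ^ k - 1) {p : ℕ}
    (hp : HookAt (2 ^ (k + 1)) p (2 ^ k - 1) (beads (2 ^ (k + 1)) s)) (i : Fin 2) :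
    ∃ μ, IsOddPartition μ ∧ μ.card = 2 ^ k ∧ par μ = s ∧ side k (hpos k μ) = i := by
  have hpow := pow_succ 2 k
  have hq : 4 ≤ 2 ^ k := by
    calc 4 = 2 ^ 2 := rfl
      _ ≤ 2 ^ k := Nat.pow_le_pow_right (by norm_num) hk
  have hodd : Odd p := (isOddPartition_hook_iff (by omega) hsc hp).1 hs
  have h1 := hp.1
  have h2 := hp.2.1
  have key : ∀ a, (p = a ∨ p = a + 1) →
      ∃ μ, IsOddPartition μ ∧ μ.card = 2 ^ k ∧ par μ = s ∧ hpos k μ = a := by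
    intro a ha
    obtain ⟨μ, hμc, hμ⟩ := exists_hook (k := k) (p := a) (n := 2 ^ k) (by omega) (by omega)
      (by omega)
    have ho : IsOddPartition μ :=
      (isOddPartition_iff_hookAt (k := k) (m := 2 ^ (k + 1)) hμc (by omega)).2 ⟨a, hμ⟩
    refine ⟨μ, ho, hμc, ?_, hpos_eq' hμc hμ⟩
    refine (eq_par_of_hookAt (m := 2 ^ (k + 1)) (n := 2 ^ k - 1) (by omega) ho hs (by omega) hsc
      (by omega) ?_ hp ha).symm
    rwa [show 2 ^ k - 1 + 1 = 2 ^ k by omega]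
  obtain ⟨μ, h3, h4, h5, h6⟩ := key p (Or.inl rfl)
  obtain ⟨ν, h3', h4', h5', h6'⟩ := key (p - 1) (Or.inr (by omega))
  by_cases h7 : side k (hpos k μ) = i
  · exact ⟨μ, h3, h4, h5, h7⟩
  · refine ⟨ν, h3', h4', h5', ?_⟩
    by_contra h8
    refine side_eq_side (p := p - 1) (p' := p) hk ?_ (by omega) hodd
    rw [h6] at h7
    rw [h6'] at h8
    omega

theorem side_row (hk : 2 ≤ k) : side k (2 ^ (k + 1) - 1) = 0 := by
  have hpow := pow_succ 2 k
  have hq : 4 ≤ 2 ^ k := by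
    calc 4 = 2 ^ 2 := rfl
      _ ≤ 2 ^ k := Nat.pow_le_pow_right (by norm_num) hk
  unfold side
  rw [if_neg (by omega), if_neg (by omega), if_pos]
  refine Nat.Even.sub_odd (by omega) (even_two.pow_of_ne_zero (by omega)) odd_one

theorem side_column : side k (2 ^ k) = 0 := by simp [side]

end Hooks

/-! ### The isomorphism from the graph with attached copies -/

section Iso

variable {k : ℕ}

theorem vert_lt (v : Vert k) : v.1.card < 2 ^ (k + 1) := by
  have := v.2.2
  rw [pow_succ]
  omega

theorem mem_topHooks_iff {μ : Vert k} : μ ∈ topHooks k ↔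
    μ.1.card = 2 ^ k - 1 ∧
      ∃ p, HookAt (2 ^ (k + 1)) p (2 ^ k - 1) (beads (2 ^ (k + 1)) μ.1) := by
  refine and_congr_right fun h => ?_
  have h' : μ.1.card = 2 ^ k - 1 := h
  rw [isHook_iff (vert_lt μ).le, h']

theorem mem_topOneDims_iff {μ : Vert k} (hk : 1 ≤ k) : μ ∈ topOneDims k ↔
    μ.1.card = 2 ^ k - 1 ∧
      (HookAt (2 ^ (k + 1)) (2 ^ (k + 1) - 1) (2 ^ k - 1) (beads (2 ^ (k + 1)) μ.1) ∨
        HookAt (2 ^ (k + 1)) (2 ^ k + 1) (2 ^ k - 1) (beads (2 ^ (k + 1)) μ.1)) := by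
  have hq : 2 ≤ 2 ^ k := Nat.le_self_pow (by omega) 2
  refine and_congr_right fun h => ?_
  have h' : μ.1.card = 2 ^ k - 1 := h
  rw [isOneDim_iff (vert_lt μ).le (by omega), h',
    show 2 ^ (k + 1) - (2 ^ k - 1) = 2 ^ k + 1 by rw [pow_succ]; omega]

theorem mem_topHooks_succ_iff {μ : Vert (k + 1)} : μ ∈ topHooks (k + 1) ↔
    μ.1.card = 2 ^ (k + 1) - 1 ∧
      ∃ p, HookAt (2 ^ (k + 1)) p (2 ^ (k + 1) - 1) (beads (2 ^ (k + 1)) μ.1) := by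
  refine and_congr_right fun h => ?_
  have h' : μ.1.card = 2 ^ (k + 1) - 1 := h
  have hq := Nat.one_le_two_pow (n := k + 1)
  rw [isHook_iff (m := 2 ^ (k + 1)) (by omega), h']

theorem mem_topOneDims_succ_iff {μ : Vert (k + 1)} : μ ∈ topOneDims (k + 1) ↔
    μ.1.card = 2 ^ (k + 1) - 1 ∧
      (HookAt (2 ^ (k + 1)) (2 ^ (k + 1) - 1) (2 ^ (k + 1) - 1) (beads (2 ^ (k + 1)) μ.1) ∨
        HookAt (2 ^ (k + 1)) 1 (2 ^ (k + 1) - 1) (beads (2 ^ (k + 1)) μ.1)) := by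
  have hpow := pow_succ 2 k
  have hq := Nat.one_le_two_pow (n := k)
  refine and_congr_right fun h => ?_
  have h' : μ.1.card = 2 ^ (k + 1) - 1 := h
  rw [isOneDim_iff (m := 2 ^ (k + 1)) (by omega) (by omega), h',
    show 2 ^ (k + 1) - (2 ^ (k + 1) - 1) = 1 by omega]

theorem mem_topHooks_of_mem_topOneDims (hk : 1 ≤ k) {μ : Vert k} (h : μ ∈ topOneDims k) : μ ∈ topHooks k := by
  rw [mem_topOneDims_iff hk] at h
  rw [mem_topHooks_iff]
  exact ⟨h.1, h.2.elim (fun h => ⟨_, h⟩) fun h => ⟨_, h⟩⟩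

theorem par_anc_mem (hk : 1 ≤ k) (μ : Vert (k + 1)) (h : ¬ μ.1.card < 2 ^ k) :
    ∃ h' : par (anc k μ.1) ∈ Vert k, (⟨_, h'⟩ : Vert k) ∈ topHooks k := by
  have hq := Nat.one_le_two_pow (n := k)
  have ha := anc_spec μ.2.1 (not_lt.1 h)
  have hp := par_spec ha.1 (by omega)
  have hc := card_par ha.1 (by omega)
  refine ⟨⟨hp.1, by omega⟩, mem_topHooks_iff.2 ⟨?_, ?_⟩⟩
  · simp only
    omega
  · obtain ⟨p, hp'⟩ := exists_hookAt_of_card_eq ha.1 ha.2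
    obtain ⟨p', h1, -⟩ := exists_hookAt_par hk ha.1 ha.2 hp'
    exact ⟨p', h1⟩

/-- The vertex of the graph with attached copies that corresponds to an odd partition. -/
noncomputable def locate (hk : 1 ≤ k) (μ : Vert (k + 1)) :
    Vert k ⊕ (topHooks k × Fin 2 × Vert k) :=
  if h : μ.1.card < 2 ^ k then Sum.inl ⟨μ.1, μ.2.1, h⟩
  else Sum.inr (⟨⟨par (anc k μ.1), (par_anc_mem hk μ h).1⟩, (par_anc_mem hk μ h).2⟩,
    side k (hpos k (anc k μ.1)),
    ⟨core k μ.1, (core_spec μ.2.1 (not_lt.1 h) μ.2.2).1, card_core_lt μ.2.1 (not_lt.1 h) μ.2.2⟩)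

theorem locate_eq_inl {hk : 1 ≤ k} {μ : Vert (k + 1)} {v : Vert k} :
    locate hk μ = Sum.inl v ↔ μ.1 = v.1 := by
  unfold locate
  split_ifs with h
  · rw [Sum.inl.injEq, Subtype.ext_iff]
  · simp only [false_iff]
    intro h'
    exact h (h' ▸ v.2.2)

theorem locate_eq_inr {hk : 1 ≤ k} {μ : Vert (k + 1)} {s : topHooks k} {i : Fin 2} {v : Vert k} :
    locate hk μ = Sum.inr (s, i, v) ↔ 2 ^ k ≤ μ.1.card ∧ par (anc k μ.1) = s.1.1 ∧
      side k (hpos k (anc k μ.1)) = i ∧ core k μ.1 = v.1 := by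
  unfold locate
  split_ifs with h
  · simp only [false_iff]
    omega
  · rw [Sum.inr.injEq, Prod.mk.injEq, Prod.mk.injEq, Subtype.ext_iff, Subtype.ext_iff,
      Subtype.ext_iff]
    exact ⟨fun h' => ⟨not_lt.1 h, h'⟩, fun h' => h'.2⟩

/-- The hook `s` and the label `i` amount to an odd partition of `2^k`; such an ancestor and a core
in `M_k` together amount to an odd partition of size between `2^k` and `2^(k+1) - 1`. -/
theorem locate_bijective (hk : 2 ≤ k) : Function.Bijective (locate (k := k) (by omega)) := by
  have hpow := pow_succ 2 k
  constructor
  · intro μ ν h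
    apply Subtype.ext
    rcases hν : locate (k := k) (by omega) ν with v | ⟨s, i, v⟩
    · rw [hν] at h
      rw [locate_eq_inl] at h hν
      exact h.trans hν.symm
    · rw [hν] at h
      rw [locate_eq_inr] at h hν
      have haμ := anc_spec μ.2.1 h.1
      have haν := anc_spec ν.2.1 hν.1
      refine eq_of_anc_eq_of_core_eq (by omega) μ.2.1 ν.2.1 h.1 μ.2.2 hν.1 ν.2.2 ?_
        (h.2.2.2.trans hν.2.2.2.symm)
      exact eq_of_par_eq_of_side_eq hk haμ.1 haν.1 haμ.2 haν.2 (h.2.1.trans hν.2.1.symm)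
        (h.2.2.1.trans hν.2.2.1.symm)
  · rintro (v | ⟨s, i, v⟩)
    · exact ⟨⟨v.1, v.2.1, vert_lt v⟩, locate_eq_inl.2 rfl⟩
    · obtain ⟨hs, p, hp⟩ := mem_topHooks_iff.1 s.2
      obtain ⟨μ, h1, h2, h3, h4⟩ := exists_par_eq_side_eq hk s.1.2.1 hs hp i
      obtain ⟨ν, h5, h6, h7, h8⟩ := exists_anc_eq_core_eq (by omega) h1 h2 v.2.1 v.2.2
      have hv : v.1.card < 2 ^ k := v.2.2
      refine ⟨⟨ν, h5, by omega⟩, locate_eq_inr.2 ⟨?_, ?_, ?_, h8⟩⟩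
      · simp only
        omega
      · rw [h7, h3]
      · rw [h7, h4]

theorem truncTree_adj_iff (u v : Vert k) :
    (truncTree k).Adj u v ↔ (v.1.card ≠ 0 ∧ u.1 = par v.1) ∨ (u.1.card ≠ 0 ∧ v.1 = par u.1) := by
  rw [SimpleGraph.comap_adj, SimpleGraph.hasse_adj]
  exact or_congr (covBy_iff_par v.2.1 u.2.1) (covBy_iff_par u.2.1 v.2.1)

theorem attach_adj_locate_iff_aux (hk : 2 ≤ k) (μ ν : Vert (k + 1)) :
    (ν.1.card ≠ 0 ∧ μ.1 = par ν.1) ↔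
      (∃ u v : Vert k, locate (k := k) (by omega) μ = Sum.inl u ∧
        locate (k := k) (by omega) ν = Sum.inl v ∧ v.1.card ≠ 0 ∧ u.1 = par v.1) ∨
      (∃ (s : topHooks k) (i : Fin 2), locate (k := k) (by omega) μ = Sum.inl s.1 ∧
        locate (k := k) (by omega) ν = Sum.inr (s, i, truncRoot k)) ∨
      (∃ (s : topHooks k) (i : Fin 2) (u v : Vert k),
        locate (k := k) (by omega) μ = Sum.inr (s, i, u) ∧
        locate (k := k) (by omega) ν = Sum.inr (s, i, v) ∧ v.1.card ≠ 0 ∧ u.1 = par v.1) := by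
  have hpow := pow_succ 2 k
  have hq := Nat.one_le_two_pow (n := k)
  have hν2 : ν.1.card < 2 ^ (k + 1) := ν.2.2
  constructor
  · rintro ⟨h0, h⟩
    have hc := card_par ν.2.1 h0
    rw [← h] at hc
    -- Below `2^k` the edge lies in the original `M_k`. At size exactly `2^k` the child has empty
    -- core and is the root of a copy, with its parent a hook in the top row. Above, parent and
    -- child share the ancestor and the edge is seen on the cores.
    rcases lt_trichotomy ν.1.card (2 ^ k) with h1 | h1 | h1
    · left
      exact ⟨⟨μ.1, μ.2.1, by omega⟩, ⟨ν.1, ν.2.1, h1⟩, locate_eq_inl.2 rfl, locate_eq_inl.2 rfl,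
        h0, h⟩
    · right
      left
      obtain ⟨h2, h3⟩ := par_anc_mem (by omega) ν (by omega)
      refine ⟨⟨⟨_, h2⟩, h3⟩, side k (hpos k (anc k ν.1)), locate_eq_inl.2 ?_, locate_eq_inr.2
        ⟨h1.ge, rfl, rfl, ?_⟩⟩
      · simp only
        rw [anc_of_card_eq h1, h]
      · exact card_eq_zero_iff.1 (by
          have := (core_spec ν.2.1 (k := k) (by omega) (by omega)).2.1
          omega)
    · right
      right
      obtain ⟨h2, h3⟩ := par_anc_mem (by omega) ν (by omega)
      refine ⟨⟨⟨_, h2⟩, h3⟩, side k (hpos k (anc k ν.1)),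
        ⟨core k μ.1, (core_spec μ.2.1 (by omega) (by omega)).1,
          card_core_lt μ.2.1 (by omega) (by omega)⟩,
        ⟨core k ν.1, (core_spec ν.2.1 (by omega) (by omega)).1,
          card_core_lt ν.2.1 (by omega) (by omega)⟩,
        locate_eq_inr.2 ⟨by omega, ?_, ?_, rfl⟩, locate_eq_inr.2 ⟨by omega, rfl, rfl, rfl⟩, ?_, ?_⟩
      · rw [h, anc_par ν.2.1 h1]
      · rw [h, anc_par ν.2.1 h1]
      · have := (core_spec ν.2.1 (k := k) (by omega) (by omega)).2.1
        simp only
        omega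
      · simp only
        rw [par_core (by omega) ν.2.1 h1 (by omega), h]
  · rintro (⟨u, v, hu, hv, h0, h⟩ | ⟨s, i, hμ, hν⟩ | ⟨s, i, u, v, hμ, hν, h0, h⟩)
    · rw [locate_eq_inl] at hu hv
      rw [hu, hv]
      exact ⟨h0, h⟩
    · rw [locate_eq_inl] at hμ
      rw [locate_eq_inr] at hν
      have h1 := (core_spec ν.2.1 hν.1 ν.2.2).2.1
      rw [hν.2.2.2] at h1
      have h2 : (truncRoot k).1.card = 0 := card_bot
      rw [anc_of_card_eq (by omega)] at hν
      exact ⟨by omega, by rw [hμ, hν.2.1]⟩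
    · have hμ' := hμ
      rw [locate_eq_inr] at hμ' hν
      have h1 := (core_spec ν.2.1 hν.1 ν.2.2).2.1
      have h2 : 2 ^ k < ν.1.card := by
        rw [hν.2.2.2] at h1
        omega
      have h3 := par_spec ν.2.1 (by omega)
      have h4 := card_par ν.2.1 (by omega)
      refine ⟨by omega, ?_⟩
      have h5 : locate (k := k) (by omega) (⟨par ν.1, h3.1, by omega⟩ : Vert (k + 1)) =
          Sum.inr (s, i, u) := by
        rw [locate_eq_inr]
        simp only
        rw [anc_par ν.2.1 h2, ← par_core (by omega) ν.2.1 h2 ν.2.2, hν.2.2.2, h]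
        exact ⟨by omega, hν.2.1, hν.2.2.1, rfl⟩
      exact congrArg Subtype.val ((locate_bijective hk).1 (hμ.trans h5.symm))

theorem attach_adj_locate_iff (hk : 2 ≤ k) (μ ν : Vert (k + 1)) :
    (attachTwoCopies (truncTree k) (truncRoot k) (topHooks k)).Adj
      (locate (k := k) (by omega) μ) (locate (k := k) (by omega) ν) ↔
      (truncTree (k + 1)).Adj μ ν := by
  rw [truncTree_adj_iff, attach_adj_locate_iff_aux hk μ ν, attach_adj_locate_iff_aux hk ν μ]
  generalize locate (k := k) _ μ = x
  generalize locate (k := k) _ ν = y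
  rcases x with u | ⟨s, i, u⟩ <;> rcases y with v | ⟨t, j, v⟩
  · simp only [attachTwoCopies, truncTree_adj_iff, Sum.inl.injEq, reduceCtorEq]
    grind
  · simp only [attachTwoCopies, Sum.inl.injEq, Sum.inr.injEq, reduceCtorEq, Prod.mk.injEq]
    grind
  · simp only [attachTwoCopies, Sum.inl.injEq, Sum.inr.injEq, reduceCtorEq, Prod.mk.injEq]
    grind
  · simp only [attachTwoCopies, truncTree_adj_iff, Sum.inr.injEq, reduceCtorEq, Prod.mk.injEq]
    grind

end Iso

/-! ### Hooks and one-dimensional nodes in the new top row -/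

section Iso

variable {k : ℕ}

theorem four_le_two_pow (hk : 2 ≤ k) : 4 ≤ 2 ^ k := by
  calc 4 = 2 ^ 2 := rfl
    _ ≤ 2 ^ k := Nat.pow_le_pow_right (by norm_num) hk

/-- An odd hook in the top row has a hook as core, and a row or a column as ancestor. -/
theorem hook_cases (hk : 2 ≤ k) {μ : YoungDiagram} (hμ : IsOddPartition μ) {p : ℕ}
    (hc : μ.card = 2 ^ (k + 1) - 1)
    (h : HookAt (2 ^ (k + 1)) p (2 ^ (k + 1) - 1) (beads (2 ^ (k + 1)) μ)) :
    (HookAt (2 ^ (k + 1)) p (2 ^ k - 1) (beads (2 ^ (k + 1)) (core k μ)) ∧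
      HookAt (2 ^ (k + 1)) (2 ^ (k + 1) - 1) (2 ^ k) (beads (2 ^ (k + 1)) (anc k μ))) ∨
    (HookAt (2 ^ (k + 1)) (p + 2 ^ k) (2 ^ k - 1) (beads (2 ^ (k + 1)) (core k μ)) ∧
      HookAt (2 ^ (k + 1)) (2 ^ k) (2 ^ k) (beads (2 ^ (k + 1)) (anc k μ))) := by
  have hpow := pow_succ 2 k
  have hq := four_le_two_pow hk
  have hA := core_spec hμ (k := k) (by omega) (by omega)
  have h1 := h.rem (q := 2 ^ k) (by omega) (by omega) (by omega) hA.2.2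
  rw [show 2 ^ (k + 1) - 1 - 2 ^ k = 2 ^ k - 1 by omega] at h1
  have h' := h
  rw [show HookAt (2 ^ (k + 1)) p (2 ^ (k + 1) - 1) =
    HookAt (2 ^ (k + 1)) p (2 ^ k - 1 + 2 ^ k) by congr 1; omega] at h'
  rcases h1 with ⟨-, h1⟩ | ⟨-, h1⟩
  · exact Or.inl ⟨h1, hookAt_anc_of_arm (by omega) hμ (by omega) (by omega) h' h1⟩
  · exact Or.inr ⟨h1, hookAt_anc_of_leg (by omega) hμ (by omega) (by omega) h' h1⟩

/-- Lengthening the arm of the core by `2^k` produces an odd hook with the same core. Its ancestor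
is the row by `hookAt_anc_of_arm`, so it coincides with `μ`. The column case is the same with legs.
-/
theorem hookAt_of_anc_row (hk : 2 ≤ k) {μ : YoungDiagram} (hμ : IsOddPartition μ) {p : ℕ}
    (hc : 2 ^ k ≤ μ.card) (hc' : μ.card < 2 ^ (k + 1))
    (h : HookAt (2 ^ (k + 1)) p (2 ^ k - 1) (beads (2 ^ (k + 1)) (core k μ)))
    (ha : HookAt (2 ^ (k + 1)) (2 ^ (k + 1) - 1) (2 ^ k) (beads (2 ^ (k + 1)) (anc k μ))) :
    HookAt (2 ^ (k + 1)) p (2 ^ (k + 1) - 1) (beads (2 ^ (k + 1)) μ) := by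
  have hpow := pow_succ 2 k
  have hq := four_le_two_pow hk
  obtain ⟨ν, hνc, hν⟩ := exists_hook (k := k) (n := 2 ^ k - 1 + 2 ^ k) h.1
    (by have := h.2.1; omega) (by omega)
  have hrem : RemY k ν (core k μ) := hν.rem_arm Nat.one_le_two_pow h
  have hA := core_spec hμ hc hc'
  have hodd := (hrem.isOdd_iff (by omega) (card_core_lt hμ hc hc')).2 hA.1
  have hcore := hrem.eq_core (by omega) (card_core_lt hμ hc hc') hodd
  have hanc := hookAt_anc_of_arm (by omega) hodd hνc (by omega) hν (hcore ▸ h)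
  have haμ := anc_spec hμ hc
  have haν := anc_spec hodd (k := k) (by omega)
  have hμν : μ = ν := eq_of_anc_eq_of_core_eq (by omega) hμ hodd hc hc' (by omega) (by omega)
    ((beads_inj (m := 2 ^ (k + 1)) (by omega) (by omega)).1 (ha.eq hanc)) hcore
  rwa [hμν, show 2 ^ (k + 1) - 1 = 2 ^ k - 1 + 2 ^ k by omega]

theorem hookAt_of_anc_column (hk : 2 ≤ k) {μ : YoungDiagram} (hμ : IsOddPartition μ) {p : ℕ}
    (hc : 2 ^ k ≤ μ.card) (hc' : μ.card < 2 ^ (k + 1))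
    (h : HookAt (2 ^ (k + 1)) (p + 2 ^ k) (2 ^ k - 1) (beads (2 ^ (k + 1)) (core k μ)))
    (ha : HookAt (2 ^ (k + 1)) (2 ^ k) (2 ^ k) (beads (2 ^ (k + 1)) (anc k μ))) :
    HookAt (2 ^ (k + 1)) p (2 ^ (k + 1) - 1) (beads (2 ^ (k + 1)) μ) := by
  have hpow := pow_succ 2 k
  have hq := four_le_two_pow hk
  obtain ⟨ν, hνc, hν⟩ := exists_hook (k := k) (p := p) (n := 2 ^ k - 1 + 2 ^ k)
    (by have := h.1; omega) (by have := h.2.1; omega) (by omega)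
  have hrem : RemY k ν (core k μ) := hν.rem_leg Nat.one_le_two_pow (by omega) h
  have hA := core_spec hμ hc hc'
  have hodd := (hrem.isOdd_iff (by omega) (card_core_lt hμ hc hc')).2 hA.1
  have hcore := hrem.eq_core (by omega) (card_core_lt hμ hc hc') hodd
  have hanc := hookAt_anc_of_leg (by omega) hodd hνc (by omega) hν (hcore ▸ h)
  have haμ := anc_spec hμ hc
  have haν := anc_spec hodd (k := k) (by omega)
  have hμν : μ = ν := eq_of_anc_eq_of_core_eq (by omega) hμ hodd hc hc' (by omega) (by omega)
    ((beads_inj (m := 2 ^ (k + 1)) (by omega) (by omega)).1 (ha.eq hanc)) hcore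
  rwa [hμν, show 2 ^ (k + 1) - 1 = 2 ^ k - 1 + 2 ^ k by omega]

/-- The parent of the row of size `2 ^ k` is the row, on the distinguished side. -/
theorem par_anc_row (hk : 2 ≤ k) {μ : YoungDiagram} (hμ : IsOddPartition μ) (hc : μ.card = 2 ^ k)
    (h : HookAt (2 ^ (k + 1)) (2 ^ (k + 1) - 1) (2 ^ k) (beads (2 ^ (k + 1)) μ)) :
    HookAt (2 ^ (k + 1)) (2 ^ (k + 1) - 1) (2 ^ k - 1) (beads (2 ^ (k + 1)) (par μ)) ∧
      side k (hpos k μ) = 0 := by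
  obtain ⟨p', h1, -, h2⟩ := exists_hookAt_par (by omega) hμ hc h
  rw [hpos_eq' hc h]
  have := h1.1
  obtain rfl : p' = 2 ^ (k + 1) - 1 := by omega
  exact ⟨h1, side_row hk⟩

theorem par_anc_column (hk : 2 ≤ k) {μ : YoungDiagram} (hμ : IsOddPartition μ)
    (hc : μ.card = 2 ^ k) (h : HookAt (2 ^ (k + 1)) (2 ^ k) (2 ^ k) (beads (2 ^ (k + 1)) μ)) :
    HookAt (2 ^ (k + 1)) (2 ^ k + 1) (2 ^ k - 1) (beads (2 ^ (k + 1)) (par μ)) ∧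
      side k (hpos k μ) = 0 := by
  have hpow := pow_succ 2 k
  have hq := four_le_two_pow hk
  obtain ⟨p', h1, -, h2⟩ := exists_hookAt_par (by omega) hμ hc h
  rw [hpos_eq' hc h]
  have := h1.2.1
  obtain rfl : p' = 2 ^ k + 1 := by omega
  exact ⟨h1, side_column⟩

theorem hookAt_row_of_par (hk : 2 ≤ k) {μ : YoungDiagram} (hμ : IsOddPartition μ)
    (hc : μ.card = 2 ^ k) (hs : side k (hpos k μ) = 0)
    (h : HookAt (2 ^ (k + 1)) (2 ^ (k + 1) - 1) (2 ^ k - 1) (beads (2 ^ (k + 1)) (par μ))) :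
    HookAt (2 ^ (k + 1)) (2 ^ (k + 1) - 1) (2 ^ k) (beads (2 ^ (k + 1)) μ) := by
  have hpow := pow_succ 2 k
  have hq := four_le_two_pow hk
  obtain ⟨p, hp⟩ := exists_hookAt_of_card_eq hμ hc
  obtain ⟨p', h1, h2, h3⟩ := exists_hookAt_par (by omega) hμ hc hp
  rw [hpos_eq' hc hp] at hs
  obtain rfl := h1.pos_unique h
  rcases h3 with h3 | h3
  · rwa [h3]
  · exact (side_eq_side hk (hs.trans (side_row hk).symm) h3 h2).elim

/-- The alternative gap `2^k + 1` has label `1`. -/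
theorem hookAt_column_of_par (hk : 2 ≤ k) {μ : YoungDiagram} (hμ : IsOddPartition μ)
    (hc : μ.card = 2 ^ k) (hs : side k (hpos k μ) = 0)
    (h : HookAt (2 ^ (k + 1)) (2 ^ k + 1) (2 ^ k - 1) (beads (2 ^ (k + 1)) (par μ))) :
    HookAt (2 ^ (k + 1)) (2 ^ k) (2 ^ k) (beads (2 ^ (k + 1)) μ) := by
  have hpow := pow_succ 2 k
  have hq := four_le_two_pow hk
  obtain ⟨p, hp⟩ := exists_hookAt_of_card_eq hμ hc
  obtain ⟨p', h1, h2, h3⟩ := exists_hookAt_par (by omega) hμ hc hp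
  rw [hpos_eq' hc hp] at hs
  obtain rfl := h1.pos_unique h
  rcases h3 with h3 | h3
  · simp [side, ← h3] at hs
  · rwa [show 2 ^ k = p by omega] at hp ⊢

theorem mem_topHooks_succ_iff_locate (hk : 2 ≤ k) (μ : Vert (k + 1)) :
    μ ∈ topHooks (k + 1) ↔ ∃ s : topHooks k, s.1 ∈ topOneDims k ∧ ∃ u ∈ topHooks k,
      locate (k := k) (by omega) μ = Sum.inr (s, 0, u) := by
  have hpow := pow_succ 2 k
  have hq := four_le_two_pow hk
  rw [mem_topHooks_succ_iff]
  constructor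
  · rintro ⟨hc, p, hp⟩
    have hcore := core_spec μ.2.1 (k := k) (by omega) (by omega)
    have hcl := card_core_lt μ.2.1 (k := k) (by omega) (by omega)
    have ha := anc_spec μ.2.1 (k := k) (by omega)
    obtain ⟨hm, hm'⟩ := par_anc_mem (k := k) (by omega) μ (by omega)
    have hpc := card_par ha.1 (by omega)
    rcases hook_cases hk μ.2.1 hc hp with ⟨h1, h2⟩ | ⟨h1, h2⟩
    · obtain ⟨h3, h4⟩ := par_anc_row hk ha.1 ha.2 h2
      exact ⟨⟨_, hm'⟩, (mem_topOneDims_iff (by omega)).2 ⟨by simp only; omega, Or.inl h3⟩,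
        ⟨core k μ.1, hcore.1, hcl⟩, mem_topHooks_iff.2 ⟨by simp only; omega, _, h1⟩,
        locate_eq_inr.2 ⟨by omega, rfl, h4, rfl⟩⟩
    · obtain ⟨h3, h4⟩ := par_anc_column hk ha.1 ha.2 h2
      exact ⟨⟨_, hm'⟩, (mem_topOneDims_iff (by omega)).2 ⟨by simp only; omega, Or.inr h3⟩,
        ⟨core k μ.1, hcore.1, hcl⟩, mem_topHooks_iff.2 ⟨by simp only; omega, _, h1⟩,
        locate_eq_inr.2 ⟨by omega, rfl, h4, rfl⟩⟩
  · rintro ⟨s, hs, u, hu, h⟩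
    obtain ⟨h1, h2, h3, h4⟩ := locate_eq_inr.1 h
    obtain ⟨huc, p, hp⟩ := mem_topHooks_iff.1 hu
    obtain ⟨-, hs⟩ := (mem_topOneDims_iff (by omega)).1 hs
    have ha := anc_spec μ.2.1 h1
    have hcore := (core_spec μ.2.1 h1 μ.2.2).2.1
    rw [h4] at hcore
    rw [← h2] at hs
    refine ⟨by omega, ?_⟩
    rcases hs with hs | hs
    · exact ⟨p, hookAt_of_anc_row hk μ.2.1 h1 μ.2.2 (h4 ▸ hp)
        (hookAt_row_of_par hk ha.1 ha.2 h3 hs)⟩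
    · have := hp.2.1
      refine ⟨p - 2 ^ k, hookAt_of_anc_column hk μ.2.1 h1 μ.2.2 ?_
        (hookAt_column_of_par hk ha.1 ha.2 h3 hs)⟩
      rw [h4, Nat.sub_add_cancel (by omega)]
      exact hp

/-- The row cannot lose `2^k` boxes from its leg, nor the column from its arm, so the core of the
row is a row and that of the column a column. -/
theorem mem_topOneDims_succ (hk : 2 ≤ k) (μ : Vert (k + 1)) (hμ : μ ∈ topOneDims (k + 1)) :
    ∃ s : topHooks k, s.1 ∈ topOneDims k ∧ ∃ u ∈ topOneDims k,
      locate (k := k) (by omega) μ = Sum.inr (s, 0, u) := by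
  have hpow := pow_succ 2 k
  have hq := four_le_two_pow hk
  have hμ' := mem_topHooks_of_mem_topOneDims (by omega) hμ
  obtain ⟨s, hs, u, hu, h⟩ := (mem_topHooks_succ_iff_locate hk μ).1 hμ'
  refine ⟨s, hs, u, (mem_topOneDims_iff (by omega)).2 ⟨hu.1, ?_⟩, h⟩
  obtain ⟨hc, hμ⟩ := mem_topOneDims_succ_iff.1 hμ
  obtain ⟨h1, h2, h3, h4⟩ := locate_eq_inr.1 h
  rw [← h4]
  rcases hμ with hp | hp
  · rcases hook_cases hk μ.2.1 hc hp with ⟨h5, -⟩ | ⟨h5, -⟩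
    · exact Or.inl h5
    · have := h5.1
      omega
  · rcases hook_cases hk μ.2.1 hc hp with ⟨h5, -⟩ | ⟨h5, -⟩
    · have := h5.2.1
      omega
    · rw [add_comm 1 (2 ^ k)] at h5
      exact Or.inr h5

theorem existsUnique_topOneDims (hk : 2 ≤ k) (s : topHooks k) (hs : s.1 ∈ topOneDims k)
    (ψ : Vert k → Vert (k + 1))
    (hψ : ∀ u, locate (k := k) (by omega) (ψ u) = Sum.inr (s, 0, u)) :
    ∃! u : Vert k, u ∈ topOneDims k ∧ ψ u ∈ topOneDims (k + 1) := by
  have hpow := pow_succ 2 k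
  have hq := four_le_two_pow hk
  -- In the copy at the row, arms are lengthened: a row becomes a row, but a column becomes a hook
  -- that is neither row nor column, since `2^k ≥ 4`. In the copy at the column the roles are
  -- exchanged. So the node that stays one-dimensional has the shape of `s`.
  have hiff : ∀ u : Vert k, ∀ p, u.1.card = 2 ^ k - 1 →
      HookAt (2 ^ (k + 1)) p (2 ^ k - 1) (beads (2 ^ (k + 1)) s.1.1) →
      (p = 2 ^ (k + 1) - 1 ∨ p = 2 ^ k + 1) →
      u ∈ topOneDims k →
      (ψ u ∈ topOneDims (k + 1) ↔
        HookAt (2 ^ (k + 1)) p (2 ^ k - 1) (beads (2 ^ (k + 1)) u.1)) := by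
    intro u p huc hsp hpor hu
    obtain ⟨h1, h2, h3, h4⟩ := locate_eq_inr.1 (hψ u)
    have ha := anc_spec (ψ u).2.1 h1
    have hcore := (core_spec (ψ u).2.1 h1 (ψ u).2.2).2.1
    rw [h4] at hcore
    have hψc : (ψ u).1.card = 2 ^ (k + 1) - 1 := by omega
    rw [mem_topOneDims_succ_iff]
    rw [← h2] at hsp
    obtain ⟨-, hu'⟩ := (mem_topOneDims_iff (by omega)).1 hu
    rcases hpor with rfl | rfl
    · have harow := hookAt_row_of_par hk ha.1 ha.2 h3 hsp
      have hup : ∀ p', HookAt (2 ^ (k + 1)) p' (2 ^ k - 1) (beads (2 ^ (k + 1)) u.1) →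
          HookAt (2 ^ (k + 1)) p' (2 ^ (k + 1) - 1) (beads (2 ^ (k + 1)) (ψ u).1) :=
        fun p' hp' => hookAt_of_anc_row hk (ψ u).2.1 h1 (ψ u).2.2 (h4 ▸ hp') harow
      constructor
      · rintro ⟨-, h5⟩
        rcases hu' with h6 | h6
        · exact h6
        · rcases h5 with h5 | h5
          · have := h5.pos_unique (hup _ h6)
            omega
          · have := h5.pos_unique (hup _ h6)
            omega
      · intro h5
        exact ⟨hψc, Or.inl (hup _ h5)⟩
    · have harow := hookAt_column_of_par hk ha.1 ha.2 h3 hsp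
      have hup : ∀ p', 2 ^ k ≤ p' →
          HookAt (2 ^ (k + 1)) p' (2 ^ k - 1) (beads (2 ^ (k + 1)) u.1) →
          HookAt (2 ^ (k + 1)) (p' - 2 ^ k) (2 ^ (k + 1) - 1) (beads (2 ^ (k + 1)) (ψ u).1) := by
        intro p' hle hp'
        refine hookAt_of_anc_column hk (ψ u).2.1 h1 (ψ u).2.2 ?_ harow
        rw [h4, Nat.sub_add_cancel hle]
        exact hp'
      constructor
      · rintro ⟨-, h5⟩
        rcases hu' with h6 | h6
        · rcases h5 with h5 | h5
          · have := h5.pos_unique (hup _ (by omega) h6)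
            omega
          · have := h5.pos_unique (hup _ (by omega) h6)
            omega
        · exact h6
      · intro h5
        have h6 := hup _ (by omega) h5
        rw [Nat.add_sub_cancel_left] at h6
        exact ⟨hψc, Or.inr h6⟩
  obtain ⟨hsc, hs'⟩ := (mem_topOneDims_iff (by omega)).1 hs
  obtain ⟨p, hp, hpor⟩ : ∃ p, HookAt (2 ^ (k + 1)) p (2 ^ k - 1) (beads (2 ^ (k + 1)) s.1.1) ∧
      (p = 2 ^ (k + 1) - 1 ∨ p = 2 ^ k + 1) := by
    rcases hs' with h | h
    · exact ⟨_, h, Or.inl rfl⟩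
    · exact ⟨_, h, Or.inr rfl⟩
  refine ⟨s.1, ⟨hs, (hiff s.1 p hsc hp hpor hs).2 hp⟩, ?_⟩
  rintro u ⟨hu, hψu⟩
  have huc := ((mem_topOneDims_iff (by omega)).1 hu).1
  have h1 := (hiff u p huc hp hpor hu).1 hψu
  exact Subtype.ext ((beads_inj (vert_lt u).le (vert_lt s.1).le).1 (h1.eq hp))

/-- The passage from `M_k` to `M_{k+1}`. -/
theorem exists_iso_attachTwoCopies (hk : 2 ≤ k) :
    ∃ φ : attachTwoCopies (truncTree k) (truncRoot k) (topHooks k) ≃g truncTree (k + 1),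
      (∀ v : Vert k, (φ (Sum.inl v)).1 = v.1) ∧
      (∀ x, φ x ∈ topHooks (k + 1) ↔
        ∃ s : topHooks k, s.1 ∈ topOneDims k ∧ ∃ u ∈ topHooks k, x = Sum.inr (s, 0, u)) ∧
      (∀ x, φ x ∈ topOneDims (k + 1) →
        ∃ s : topHooks k, s.1 ∈ topOneDims k ∧ ∃ u ∈ topOneDims k, x = Sum.inr (s, 0, u)) ∧
      (∀ s : topHooks k, s.1 ∈ topOneDims k →
        ∃! u : Vert k, u ∈ topOneDims k ∧ φ (Sum.inr (s, 0, u)) ∈ topOneDims (k + 1)) := by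
  let e := Equiv.ofBijective _ (locate_bijective hk)
  let ψ : truncTree (k + 1) ≃g attachTwoCopies (truncTree k) (truncRoot k) (topHooks k) :=
    ⟨e, fun {μ ν} => attach_adj_locate_iff hk μ ν⟩
  have hψ : ∀ x, locate (k := k) (by omega) (ψ.symm x) = x := fun x => ψ.apply_symm_apply x
  refine ⟨ψ.symm, fun v => locate_eq_inl.1 (hψ _), fun x => ?_, fun x hx => ?_, fun s hs => ?_⟩
  · rw [mem_topHooks_succ_iff_locate hk, hψ]
  · have := mem_topOneDims_succ hk _ hx
    rwa [hψ] at this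
  · exact existsUnique_topOneDims hk s hs (fun u => ψ.symm (Sum.inr (s, 0, u))) fun u => hψ _

end Iso

/-! ### The tree `M_2` -/

section SixTree

/-- The bead sets of the odd partitions of `0, 1, 2, 3`. -/
def sixBeads : Fin 6 → Finset ℕ :=
  ![{0, 1, 2}, {0, 1, 3}, {0, 1, 4}, {0, 2, 3}, {0, 1, 5}, {1, 2, 3}]

/-- The sizes of the odd partitions of `0, 1, 2, 3`. -/
def sixSize : Fin 6 → ℕ := ![0, 1, 2, 2, 3, 3]

/-- Three beads are enough for partitions of size at most `3`, and these beads lie below `6`, so the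
check is finite. -/
theorem mem_range_sixBeads : ∀ X ∈ powersetCard 3 (range 6), ∀ n ∈ range 4,
    ∑ x ∈ X, x = 3 + n → Odd (cnt n X) → ∃ i, sixBeads i = X := by
  decide +kernel

theorem odd_cnt_sixBeads : ∀ i, Odd (cnt (sixSize i) (sixBeads i)) := by
  decide +kernel

theorem sixTree_adj_iff : ∀ i j, sixTree.Adj i j ↔
    (∃ c ∈ dn 1 (sixBeads j), sixBeads i = slide 1 c (sixBeads j)) ∨
    (∃ c ∈ dn 1 (sixBeads i), sixBeads j = slide 1 c (sixBeads i)) := by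
  simp only [sixTree, SimpleGraph.fromEdgeSet_adj, Set.mem_insert_iff, Set.mem_singleton_iff]
  decide +kernel

theorem exists_sixTree_iso : ∃ φ : sixTree ≃g truncTree 2, ∀ i : Fin 6,
    (φ i).1.rowLens = (![[], [1], [2], [1, 1], [3], [1, 1, 1]] : Fin 6 → List ℕ) i := by
  have hlev : ∀ i, (sixBeads i).card = 3 ∧ Lev (sixSize i) (sixBeads i) ∧ sixSize i < 4 := by
    unfold Lev
    decide +kernel
  choose μ _ hc hb using fun i => exists_beads_eq_of_lev (hlev i).1 (hlev i).2.1
  have hle : ∀ i, (μ i).card ≤ 3 := fun i => by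
    have := (hlev i).2.2
    have := hc i
    omega
  have hodd : ∀ i, IsOddPartition (μ i) := fun i => by
    rw [isOddPartition_iff (hle i), hb, hc]
    exact odd_cnt_sixBeads i
  let f : Fin 6 → Vert 2 := fun i => ⟨μ i, hodd i, by have := hle i; norm_num; omega⟩
  have hf : Function.Bijective f := by
    constructor
    · intro i j hij
      have h1 : μ i = μ j := congrArg Subtype.val hij
      have h2 : sixBeads i = sixBeads j := by rw [← hb, h1, hb]
      revert i j
      have : ∀ i j, sixBeads i = sixBeads j → i = j := by decide +kernel
      exact fun i j _ _ h => this i j h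
    · rintro ⟨ν, h1, h2⟩
      have hν : ν.card ≤ 3 := by norm_num at h2; omega
      have hl := lev_beads (rowLen_eq_zero_of_card_le hν)
      rw [isOddPartition_iff hν] at h1
      have hl' := hl
      rw [Lev, card_beads, show ∑ i ∈ range 3, i = 3 from rfl] at hl'
      obtain ⟨i, hi⟩ := mem_range_sixBeads (beads 3 ν)
        (mem_powersetCard.2 ⟨fun z hz => by
          have := single_le_sum (f := fun x : ℕ => x) (fun _ _ => Nat.zero_le _) hz
          have hz2 := mem_beads.1 hz
          obtain ⟨j, hj, hz2⟩ := hz2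
          have h3 : ν.rowLen j ≤ ν.card := by
            rw [YoungDiagram.rowLen_eq_card]
            exact card_le_card (filter_subset _ _)
          rw [mem_range]
          omega, card_beads 3 ν⟩) ν.card (mem_range.2 (by omega)) hl' h1
      exact ⟨i, Subtype.ext ((beads_inj (hle i) hν).1 ((hb i).trans hi))⟩
  refine ⟨⟨Equiv.ofBijective f hf, fun {i j} => ?_⟩, fun i => ?_⟩
  · rw [sixTree_adj_iff]
    change (SimpleGraph.hasse YoungDiagram).Adj (μ i) (μ j) ↔ _
    rw [SimpleGraph.hasse_adj, covBy_iff_rem_beads (hle j) (hle i),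
      covBy_iff_rem_beads (hle i) (hle j), hb, hb]
    simp only [Rem, mem_dn, and_assoc]
  · change (μ i).rowLens = _
    have key : ∀ k, 1 ≤ k → k ≤ (μ i).card →
        HookAt 3 (3 - 1 - ((μ i).card - k)) (μ i).card (beads 3 (μ i)) →
          (μ i).rowLens = k :: List.replicate ((μ i).card - k) 1 :=
      fun k h1 h2 => (rowLens_eq_hook_iff (hle i) h1 h2).2
    rw [hb, hc] at key
    fin_cases i
    · have h0 : μ 0 = ⊥ := card_eq_zero_iff.1 (hc 0)
      simp [h0, YoungDiagram.rowLens, YoungDiagram.colLen_eq_card, YoungDiagram.col]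
    · exact key 1 (by decide) (by decide) (by simp [HookAt, sixSize, sixBeads]; omega)
    · exact key 2 (by decide) (by decide) (by simp [HookAt, sixSize, sixBeads]; omega)
    · exact key 1 (by decide) (by decide) (by simp [HookAt, sixSize, sixBeads]; omega)
    · exact key 3 (by decide) (by decide) (by simp [HookAt, sixSize, sixBeads]; omega)
    · exact key 1 (by decide) (by decide) (by simp [HookAt, sixSize, sixBeads]; omega)

end SixTree

/-! ### The Coxeter presentation of the symmetric group -/

section Presentation

variable {M : Type*} [Monoid M]

/-- The Coxeter relations of the symmetric group `S_{n+1}`. -/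
structure IsCoxeterSeq (n : ℕ) (t : ℕ → M) : Prop where
  sq : ∀ i, i < n → t i * t i = 1
  braid : ∀ i, i + 1 < n → t i * t (i + 1) * t i = t (i + 1) * t i * t (i + 1)
  comm : ∀ i j, i + 1 < j → j < n → t i * t j = t j * t i

theorem IsCoxeterSeq.mono {n k : ℕ} {t : ℕ → M} (h : IsCoxeterSeq n t) (hk : k ≤ n) :
    IsCoxeterSeq k t :=
  ⟨fun i hi => h.sq i (by omega), fun i hi => h.braid i (by omega),
    fun i j hi hj => h.comm i j hi (by omega)⟩

/-- The product `t (j + l - 1) * ⋯ * t (j + 1) * t j`. -/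
def descProd (t : ℕ → M) (j : ℕ) : ℕ → M
  | 0 => 1
  | l + 1 => t (j + l) * descProd t j l

theorem descProd_succ (t : ℕ → M) (j l : ℕ) :
    descProd t j (l + 1) = descProd t (j + 1) l * t j := by
  induction l with
  | zero => simp [descProd]
  | succ l ih =>
    rw [descProd, ih, descProd, mul_assoc, show j + (l + 1) = j + 1 + l by omega]

variable {n : ℕ} {t : ℕ → M}

theorem IsCoxeterSeq.descProd_mul_of_lt (h : IsCoxeterSeq n t) {i j l : ℕ} (hi : i + 1 < j)
    (hl : j + l ≤ n) : descProd t j l * t i = t i * descProd t j l := by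
  induction l with
  | zero => simp [descProd]
  | succ l ih =>
    rw [descProd, mul_assoc, ih (by omega), ← mul_assoc, ← mul_assoc,
      h.comm i (j + l) (by omega) (by omega)]

/-- The generator commutes past the factors of smaller index, one braid relation lowers its index by
one, and the result commutes with the remaining larger factors. -/
theorem IsCoxeterSeq.descProd_mul_of_gt (h : IsCoxeterSeq n t) {i j l : ℕ} (hj : j ≤ i)
    (hi : i + 1 < j + l) (hl : j + l ≤ n) :
    descProd t j l * t (i + 1) = t i * descProd t j l := by
  induction l with
  | zero => omega
  | succ l ih =>
    rcases Nat.lt_or_ge (i + 1) (j + l) with h1 | h1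
    · rw [descProd, mul_assoc, ih (by omega) (by omega), ← mul_assoc, ← mul_assoc,
        h.comm i (j + l) (by omega) (by omega)]
    · obtain ⟨l, rfl⟩ : ∃ l', l = l' + 1 := ⟨l - 1, by omega⟩
      obtain rfl : i = j + l := by omega
      have key : descProd t j l * t (j + l + 1) = t (j + l + 1) * descProd t j l := by
        have : ∀ l', l' ≤ l → descProd t j l' * t (j + l + 1) = t (j + l + 1) * descProd t j l' := by
          intro l' hl'
          induction l' with
          | zero => simp [descProd]
          | succ l' ih' =>
            rw [descProd, mul_assoc, ih' (by omega), ← mul_assoc, ← mul_assoc,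
              h.comm (j + l') (j + l + 1) (by omega) (by omega)]
        exact this l le_rfl
      rw [descProd, descProd, show j + (l + 1) = j + l + 1 by omega, mul_assoc, mul_assoc, key,
        ← mul_assoc, ← mul_assoc, ← mul_assoc, ← h.braid (j + l) (by omega)]
      simp only [mul_assoc]

open Classical in
/-- Normal forms for the elements of the monoid generated by `t 0, …, t (n - 1)`. -/
noncomputable def normalForms (t : ℕ → M) : ℕ → Finset M
  | 0 => {1}
  | n + 1 => (normalForms t n ×ˢ range (n + 2)).image fun p => p.1 * descProd t p.2 (n + 1 - p.2)

theorem card_normalForms_le (t : ℕ → M) (n : ℕ) : (normalForms t n).card ≤ (n + 1).factorial := by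
  classical
  induction n with
  | zero => simp [normalForms]
  | succ n ih =>
    rw [normalForms]
    refine card_image_le.trans ?_
    rw [card_product, card_range, Nat.factorial_succ (n + 1), mul_comm]
    exact Nat.mul_le_mul_left _ ih

theorem mem_normalForms_succ {t : ℕ → M} {n : ℕ} {x : M} : x ∈ normalForms t (n + 1) ↔
    ∃ y ∈ normalForms t n, ∃ j l, j + l = n + 1 ∧ x = y * descProd t j l := by
  simp only [normalForms, mem_image, mem_product, mem_range, Prod.exists]
  constructor
  · rintro ⟨y, j, ⟨h1, h2⟩, rfl⟩
    exact ⟨y, h1, j, n + 1 - j, by omega, rfl⟩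
  · rintro ⟨y, h1, j, l, h2, rfl⟩
    exact ⟨y, j, ⟨h1, by omega⟩, by rw [← h2, Nat.add_sub_cancel_left]⟩

theorem one_mem_normalForms (t : ℕ → M) (n : ℕ) : 1 ∈ normalForms t n := by
  induction n with
  | zero => simp [normalForms]
  | succ n ih => exact mem_normalForms_succ.2 ⟨1, ih, n + 1, 0, rfl, by simp [descProd]⟩

/-- Multiplying `y * descProd t j l` by `t i` has four outcomes: for `i + 1 < j` and for `i > j` a
generator passes through to `y`; for `i + 1 = j` the descending product grows by a factor; for `i =
j` it loses one. -/
theorem IsCoxeterSeq.mul_mem_normalForms (h : IsCoxeterSeq n t) {x : M}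
    (hx : x ∈ normalForms t n) {i : ℕ} (hi : i < n) : x * t i ∈ normalForms t n := by
  induction n generalizing x i with
  | zero => omega
  | succ n ih =>
    obtain ⟨y, hy, j, l, hjl, rfl⟩ := mem_normalForms_succ.1 hx
    rw [mem_normalForms_succ, mul_assoc]
    rcases Nat.lt_or_ge (i + 1) j with h1 | h1
    · exact ⟨y * t i, ih (h.mono (by omega)) hy (by omega), j, l, hjl, by
        rw [h.descProd_mul_of_lt h1 hjl.le, mul_assoc]⟩
    rcases Nat.eq_or_lt_of_le h1 with h1 | h1
    · subst h1
      exact ⟨y, hy, i, l + 1, by omega, by rw [descProd_succ]⟩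
    rcases Nat.eq_or_lt_of_le (Nat.le_of_lt_succ h1) with h1 | h1
    · subst h1
      obtain ⟨l, rfl⟩ : ∃ l', l = l' + 1 := ⟨l - 1, by omega⟩
      exact ⟨y, hy, j + 1, l, by omega, by rw [descProd_succ, mul_assoc, h.sq j hi, mul_one]⟩
    · obtain ⟨i, rfl⟩ : ∃ i', i = i' + 1 := ⟨i - 1, by omega⟩
      exact ⟨y * t i, ih (h.mono (by omega)) hy (by omega), j, l, hjl, by
        rw [h.descProd_mul_of_gt (by omega) (by omega) hjl.le, mul_assoc]⟩

theorem isCoxeterSeq_swap (n : ℕ) : IsCoxeterSeq n fun i => if h : i < n then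
    Equiv.swap (⟨i, by omega⟩ : Fin (n + 1)) ⟨i + 1, by omega⟩ else 1 := by
  constructor
  · intro i hi
    simp [hi]
  · intro i hi
    have hi' : i < n := by omega
    simp only [hi, hi', dif_pos]
    set a : Fin (n + 1) := ⟨i, by omega⟩
    set b : Fin (n + 1) := ⟨i + 1, by omega⟩
    set c : Fin (n + 1) := ⟨i + 1 + 1, by omega⟩
    have hab : a ≠ b := by simp [a, b]
    have hac : a ≠ c := by simp [a, c]; omega
    have hbc : b ≠ c := by simp [b, c]
    rw [Equiv.swap_mul_swap_mul_swap hab hac, Equiv.swap_comm a b, Equiv.swap_comm b c,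
      Equiv.swap_mul_swap_mul_swap hbc.symm hac.symm, Equiv.swap_comm]
  · intro i j hij hj
    have hi : i < n := by omega
    simp only [hi, hj, dif_pos]
    rw [Equiv.mul_swap_eq_swap_mul, Equiv.swap_apply_of_ne_of_ne, Equiv.swap_apply_of_ne_of_ne] <;>
      · simp only [ne_eq, Fin.mk.injEq]
        omega

theorem closure_swap_succ (n : ℕ) : Submonoid.closure
    {σ : Equiv.Perm (Fin (n + 1)) | ∃ i : Fin n, σ = Equiv.swap i.castSucc i.succ} = ⊤ := by
  rw [← Equiv.Perm.mclosure_swap_castSucc_succ n]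
  congr 1
  ext σ
  simp [eq_comm]

/-- The Coxeter presentation of the symmetric group. -/
theorem IsCoxeterSeq.exists_hom (h : IsCoxeterSeq n t) :
    ∃ φ : Equiv.Perm (Fin (n + 1)) →* M, ∀ i : Fin n,
      φ (Equiv.swap i.castSucc i.succ) = t i := by
  classical
  set s : ℕ → Equiv.Perm (Fin (n + 1)) := fun i => if h : i < n then
    Equiv.swap (⟨i, by omega⟩ : Fin (n + 1)) ⟨i + 1, by omega⟩ else 1 with hs
  have hsw := isCoxeterSeq_swap n
  have hst : IsCoxeterSeq n fun i => (t i, s i) :=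
    ⟨fun i hi => Prod.ext (h.sq i hi) (hsw.sq i hi),
      fun i hi => Prod.ext (h.braid i hi) (hsw.braid i hi),
      fun i j hi hj => Prod.ext (h.comm i j hi hj) (hsw.comm i j hi hj)⟩
  have hsi : ∀ i : Fin n, s i = Equiv.swap i.castSucc i.succ := fun i => by
    simp only [hs, i.2, dif_pos]
    rfl
  -- This submonoid is the graph of the desired homomorphism. It projects onto the symmetric group
  -- and has at most `(n+1)!` elements by the normal forms, so the projection is bijective.
  let K : Submonoid (M × Equiv.Perm (Fin (n + 1))) :=
    Submonoid.closure (Set.range fun i : Fin n => (t i, s i))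
  have hK : ∀ x ∈ K, x ∈ normalForms (fun i => (t i, s i)) n := by
    intro x hx
    induction hx using Submonoid.closure_induction_right with
    | one => exact one_mem_normalForms _ _
    | mul_right x hx y hy ih =>
      obtain ⟨i, rfl⟩ := hy
      exact hst.mul_mem_normalForms ih i.2
  let π : K →* Equiv.Perm (Fin (n + 1)) := (MonoidHom.snd _ _).comp K.subtype
  have hgen : ∀ i : Fin n, (t i, s i) ∈ K := fun i => Submonoid.subset_closure ⟨i, rfl⟩
  have hsurj : Function.Surjective π := by
    rw [← MonoidHom.mrange_eq_top, eq_top_iff, ← closure_swap_succ, Submonoid.closure_le]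
    rintro _ ⟨i, rfl⟩
    exact ⟨⟨_, hgen i⟩, hsi i⟩
  have hfin : Finite K := Finite.of_injective
    (fun x : K => (⟨x.1, hK x.1 x.2⟩ : {x // x ∈ normalForms (fun i => (t i, s i)) n}))
    fun x y hxy => Subtype.ext (congrArg (fun z => z.1) hxy)
  have hcard : Nat.card K ≤ Nat.card (Equiv.Perm (Fin (n + 1))) := by
    rw [Nat.card_eq_fintype_card (α := Equiv.Perm _), Fintype.card_perm, Fintype.card_fin]
    refine le_trans ?_ (card_normalForms_le (fun i => (t i, s i)) n)
    rw [← Nat.card_eq_finsetCard]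
    exact Nat.card_le_card_of_injective
      (fun x : K => (⟨x.1, hK x.1 x.2⟩ : {x // x ∈ normalForms (fun i => (t i, s i)) n}))
      fun x y hxy => Subtype.ext (congrArg (fun z => z.1) hxy)
  have hbij : Function.Bijective π :=
    hsurj.bijective_of_nat_card_le hcard
  let e := MulEquiv.ofBijective π hbij
  refine ⟨(MonoidHom.fst _ _).comp (K.subtype.comp e.symm.toMonoidHom), fun i => ?_⟩
  have : e.symm (Equiv.swap i.castSucc i.succ) = ⟨_, hgen i⟩ := by
    rw [MulEquiv.symm_apply_eq]
    exact (hsi i).symm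
  change (e.symm _).1.1 = _
  rw [this]

end Presentation

/-! ### Paths as words of bead positions, i.e. shifted contents -/

section Paths

/-- The word `w` records the successive unit moves of beads that lead from the ground state to `X`
in `n` steps: the `i`-th move takes a bead from `w i` to `w i + 1`. -/
def Path : ℕ → (ℕ → ℕ) → Finset ℕ → Prop
  | 0, _, X => X = range X.card
  | n + 1, w, X => w n ∉ X ∧ w n + 1 ∈ X ∧ Path n w (slide 1 (w n) X)

theorem card_slide' {c : ℕ} {X : Finset ℕ} (h1 : c ∉ X) (h2 : c + 1 ∈ X) :
    (slide 1 c X).card = X.card := Rem.card_eq ⟨c, h1, h2, rfl⟩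

theorem path_congr {n : ℕ} {w w' : ℕ → ℕ} {X : Finset ℕ} (h : ∀ i < n, w i = w' i) :
    Path n w X ↔ Path n w' X := by
  induction n generalizing X with
  | zero => rfl
  | succ n ih => rw [Path, Path, h n (by omega), ih fun i hi => h i (by omega)]

theorem Path.lev {n : ℕ} {w : ℕ → ℕ} {X : Finset ℕ} (h : Path n w X) : Lev n X := by
  induction n generalizing X with
  | zero =>
    rw [Path] at h
    rw [h, Lev, card_range, add_zero]
  | succ n ih => exact Rem.lev ⟨_, h.1, h.2.1, rfl⟩ (ih h.2.2)

theorem Lev.exists_path {n : ℕ} {X : Finset ℕ} (h : Lev n X) : ∃ w, Path n w X := by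
  induction n generalizing X with
  | zero => exact ⟨0, h.eq_range⟩
  | succ n ih =>
    obtain ⟨c, hc⟩ := h.exists_dn
    rw [mem_dn] at hc
    obtain ⟨w, hw⟩ := ih (h.rem ⟨c, hc.1, hc.2, rfl⟩).2
    refine ⟨Function.update w n c, ?_⟩
    rw [Path, Function.update_self]
    refine ⟨hc.1, hc.2, (path_congr fun i hi => ?_).1 hw⟩
    rw [Function.update_of_ne (by omega)]

theorem Path.unique {n : ℕ} {w : ℕ → ℕ} {X Y : Finset ℕ} (hX : Path n w X) (hY : Path n w Y)
    (hc : X.card = Y.card) : X = Y := by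
  induction n generalizing X Y with
  | zero =>
    rw [Path] at hX hY
    rw [hX, hY, hc]
  | succ n ih =>
    have h := ih hX.2.2 hY.2.2 (by rw [card_slide' hX.1 hX.2.1, card_slide' hY.1 hY.2.1, hc])
    have h1 := hX.1
    have h2 := hX.2.1
    have h3 := hY.1
    have h4 := hY.2.1
    ext z
    have hz := congrArg (z ∈ ·) h
    simp only [mem_slide, eq_iff_iff] at hz
    grind

theorem Path.head_eq {n : ℕ} {w : ℕ → ℕ} {X : Finset ℕ} (h : Path (n + 1) w X) :
    w 0 + 1 = X.card := by
  induction n generalizing X with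
  | zero =>
    obtain ⟨h1, h2, h3⟩ := h
    rw [Path, card_slide' h1 h2] at h3
    have h4 : w 0 ∈ slide 1 (w 0) X := mem_slide.2 (by simp)
    have h5 : w 0 + 1 ∉ slide 1 (w 0) X := by
      rw [mem_slide]
      grind
    rw [h3, mem_range] at h4 h5
    omega
  | succ n ih => rw [ih h.2.2, card_slide' h.1 h.2.1]

/-- After a move from `a` the position `a` is free, so the next move cannot start there. -/
theorem Path.ne_succ {n : ℕ} {w : ℕ → ℕ} {X : Finset ℕ} (h : Path n w X) {i : ℕ}
    (hi : i + 1 < n) : w i ≠ w (i + 1) := by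
  induction n generalizing X with
  | zero => omega
  | succ n ih =>
    rcases Nat.eq_or_lt_of_le hi with hi | hi
    · obtain rfl : n = i + 1 := by omega
      obtain ⟨h1, h2, h3, h4, h5⟩ := h
      rw [mem_slide] at h3 h4
      grind
    · exact ih h.2.2 (by omega)

/-- Two moves from `a` require in between that the bead at `a + 1` leaves and that a bead arrives at
`a`; one move cannot do both. -/
theorem Path.ne_succ_succ {n : ℕ} {w : ℕ → ℕ} {X : Finset ℕ} (h : Path n w X) {i : ℕ}
    (hi : i + 2 < n) : w i ≠ w (i + 2) := by
  induction n generalizing X with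
  | zero => omega
  | succ n ih =>
    rcases Nat.eq_or_lt_of_le hi with hi | hi
    · obtain rfl : n = i + 2 := by omega
      obtain ⟨h1, h2, h3, h4, h5, h6, h7⟩ := h
      rw [mem_slide] at h3 h4
      rw [mem_slide, mem_slide] at h5 h6
      grind
    · exact ih h.2.2 (by omega)

/-- The letters `i` and `i + 1` of `w` differ by at least `2`. -/
def Swappable (i : ℕ) (w : ℕ → ℕ) : Prop := w i + 1 < w (i + 1) ∨ w (i + 1) + 1 < w i

/-- Exchange the letters `i` and `i + 1` of a word. -/
def swapWord (i : ℕ) (w : ℕ → ℕ) : ℕ → ℕ := w ∘ Equiv.swap i (i + 1)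

@[simp] theorem swapWord_left (i : ℕ) (w : ℕ → ℕ) : swapWord i w i = w (i + 1) := by
  simp [swapWord]

@[simp] theorem swapWord_right (i : ℕ) (w : ℕ → ℕ) : swapWord i w (i + 1) = w i := by
  simp [swapWord]

theorem swapWord_of_ne {i j : ℕ} (w : ℕ → ℕ) (h1 : j ≠ i) (h2 : j ≠ i + 1) :
    swapWord i w j = w j := by
  simp [swapWord, Equiv.swap_apply_of_ne_of_ne h1 h2]

theorem slide_slide_comm {a b : ℕ} {X : Finset ℕ} (h1 : a + 1 ≠ b)
    (h2 : b + 1 ≠ a) : slide 1 a (slide 1 b X) = slide 1 b (slide 1 a X) := by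
  ext z
  simp only [mem_slide]
  grind

theorem Path.swapWord {n : ℕ} {w : ℕ → ℕ} {X : Finset ℕ} (h : Path n w X) {i : ℕ}
    (hi : i + 1 < n) (hs : Swappable i w) : Path n (swapWord i w) X := by
  induction n generalizing X with
  | zero => omega
  | succ n ih =>
    rcases Nat.eq_or_lt_of_le hi with hi | hi
    · obtain rfl : n = i + 1 := by omega
      obtain ⟨h1, h2, h3, h4, h5⟩ := h
      rw [mem_slide] at h3 h4
      rw [Swappable] at hs
      rw [Path, Path, swapWord_right, swapWord_left, mem_slide, mem_slide,
        slide_slide_comm (by omega) (by omega)]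
      refine ⟨by grind, by grind, by grind, by grind, (path_congr fun j hj => ?_).1 h5⟩
      rw [swapWord_of_ne _ (by omega) (by omega)]
    · rw [Path, swapWord_of_ne _ (by omega) (by omega)]
      exact ⟨h.1, h.2.1, ih h.2.2 (by omega)⟩

/-- `w'` arises from `w` by an exchange of two neighbouring letters that differ by at least `2`,
among the first `k`. -/
def SwapStep (k : ℕ) (w w' : ℕ → ℕ) : Prop :=
  ∃ i, i + 1 < k ∧ Swappable i w ∧ w' = swapWord i w

/-- Paths with the same end are connected by exchanges. -/
theorem Path.connected {k : ℕ} {w w' : ℕ → ℕ} {X : Finset ℕ} (h : Path k w X)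
    (h' : Path k w' X) (heq : ∀ j, k ≤ j → w j = w' j) :
    Relation.ReflTransGen (SwapStep k) w w' := by
  induction k generalizing X w w' with
  | zero => rw [funext fun j => heq j (Nat.zero_le j)]
  | succ k ih =>
    have mono : ∀ {v v'}, Relation.ReflTransGen (SwapStep k) v v' →
        Relation.ReflTransGen (SwapStep (k + 1)) v v' := fun hv =>
      Relation.ReflTransGen.mono (fun _ _ ⟨i, hi, h⟩ => ⟨i, by omega, h⟩) _ _ hv
    by_cases hab : w k = w' k
    · refine mono (ih h.2.2 (by rw [hab]; exact h'.2.2) fun j hj => ?_)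
      rcases Nat.eq_or_lt_of_le hj with rfl | hj
      · exact hab
      · exact heq j hj
    · obtain ⟨h1, h2, h3⟩ := h
      obtain ⟨h1', h2', h3'⟩ := h'
      set a := w k with ha
      set b := w' k with hb
      have hab1 : a + 1 ≠ b := fun h => h1' (h ▸ h2)
      have hab2 : b + 1 ≠ a := fun h => h1 (h ▸ h2')
      have hbY : b ∉ slide 1 a X ∧ b + 1 ∈ slide 1 a X := by
        rw [mem_slide, mem_slide]
        grind
      have hk : k ≠ 0 := by
        rintro rfl
        rw [Path] at h3
        rw [h3, mem_range, mem_range] at hbY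
        omega
      obtain ⟨k, rfl⟩ := Nat.exists_eq_add_one_of_ne_zero hk
      -- The last moves `a` and `b` of the two paths are independent, so some path ends with `b` and
      -- then `a`. Induction connects it to `w`; exchanging its last two letters gives a path ending
      -- in `b`, which induction connects to `w'`.
      obtain ⟨v, hv⟩ := ((h3.lev).rem ⟨b, hbY.1, hbY.2, rfl⟩).2.exists_path
      rw [Nat.add_sub_cancel] at hv
      let v1 : ℕ → ℕ := fun j => if j < k then v j else if j = k then b else w j
      have hv1 : Path (k + 1) v1 (slide 1 a X) := by
        have : v1 k = b := by simp [v1]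
        rw [Path, this]
        exact ⟨hbY.1, hbY.2, (path_congr fun i hi => by simp [v1, hi]).1 hv⟩
      have hv1k : v1 k = b := by simp [v1]
      have hv1k' : v1 (k + 1) = a := by simp [v1, ha]
      have c1 : Relation.ReflTransGen (SwapStep (k + 1)) w v1 := ih h3 hv1 fun j hj => by
        simp only [v1]
        rw [if_neg (by omega), if_neg (by omega)]
      have hs : Swappable k v1 := by
        rw [Swappable, hv1k, hv1k']
        omega
      have hv1' : Path (k + 1 + 1) v1 X := ⟨by rwa [hv1k'], by rwa [hv1k'], by rwa [hv1k']⟩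
      have hv2 := (hv1'.swapWord (by omega) hs).2.2
      rw [swapWord_right, hv1k] at hv2
      have c2 : Relation.ReflTransGen (SwapStep (k + 1)) (Macdonald.swapWord k v1) w' := by
        refine ih hv2 h3' fun j hj => ?_
        rcases Nat.eq_or_lt_of_le hj with rfl | hj
        · rw [swapWord_right, hv1k]
        · rw [swapWord_of_ne _ (by omega) (by omega), ← heq j (by omega)]
          simp only [v1]
          rw [if_neg (by omega), if_neg (by omega)]
      exact ((mono c1).tail ⟨k, by omega, hs, rfl⟩).trans (mono c2)

end Paths

/-! ### The sum of the squares of the numbers of paths -/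

section Counting

open Classical in
/-- The words of paths of length `n` that end in `X`, continued by `0`. -/
noncomputable def pathWords : ℕ → Finset ℕ → Finset (ℕ → ℕ)
  | 0, X => if X = range X.card then {0} else ∅
  | n + 1, X => (dn 1 X).biUnion fun c =>
      (pathWords n (slide 1 c X)).image fun w => Function.update w n c

theorem mem_pathWords {n : ℕ} {X : Finset ℕ} {w : ℕ → ℕ} :
    w ∈ pathWords n X ↔ Path n w X ∧ ∀ j, n ≤ j → w j = 0 := by
  classical
  induction n generalizing X w with
  | zero =>
    rw [pathWords, Path]
    split_ifs with h
    · rw [mem_singleton, funext_iff]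
      exact ⟨fun h0 => ⟨h, fun j _ => h0 j⟩, fun h0 j => h0.2 j (Nat.zero_le j)⟩
    · simp [h]
  | succ n ih =>
    simp only [pathWords, mem_biUnion, mem_image, ih, Path, mem_dn]
    constructor
    · rintro ⟨c, ⟨hc1, hc2⟩, v, ⟨hv, hv0⟩, rfl⟩
      simp only [Function.update_self]
      refine ⟨⟨hc1, hc2, (path_congr fun i hi => ?_).1 hv⟩, fun j hj => ?_⟩
      · rw [Function.update_of_ne (by omega)]
      · rw [Function.update_of_ne (by omega)]
        exact hv0 j (by omega)
    · rintro ⟨⟨h1, h2, h3⟩, h0⟩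
      refine ⟨w n, ⟨h1, h2⟩, Function.update w n 0, ⟨(path_congr fun i hi => ?_).1 h3,
        fun j hj => ?_⟩, by simp⟩
      · rw [Function.update_of_ne (by omega)]
      · rcases Nat.eq_or_lt_of_le hj with rfl | hj
        · simp
        · rw [Function.update_of_ne (by omega)]
          exact h0 j hj

theorem cnt_succ (n : ℕ) (X : Finset ℕ) :
    cnt (n + 1) X = ∑ c ∈ dn 1 X, cnt n (slide 1 c X) := rfl

theorem card_pathWords (n : ℕ) (X : Finset ℕ) : (pathWords n X).card = cnt n X := by
  classical
  induction n generalizing X with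
  | zero =>
    rw [pathWords, cnt]
    split_ifs <;> rfl
  | succ n ih =>
    rw [pathWords, cnt, card_biUnion]
    · refine sum_congr rfl fun c _ => ?_
      rw [card_image_of_injOn, ih]
      intro w hw w' hw' h
      have h0 := (mem_pathWords.1 hw).2 n le_rfl
      have h0' := (mem_pathWords.1 hw').2 n le_rfl
      funext j
      rcases eq_or_ne j n with rfl | hj
      · rw [h0, h0']
      · have := congrFun h j
        simpa [hj] using this
    · intro c _ c' _ hcc
      rw [Function.onFun, disjoint_left]
      intro w hw hw'
      obtain ⟨v, _, rfl⟩ := mem_image.1 hw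
      obtain ⟨v', _, h⟩ := mem_image.1 hw'
      have := congrFun h n
      simp only [Function.update_self] at this
      exact hcc this.symm

open Classical in
/-- The bead sets with `m` elements at level `n`. -/
noncomputable def level (m n : ℕ) : Finset (Finset ℕ) :=
  (powersetCard m (range (m + n))).filter (Lev n)

theorem Path.subset_range {n : ℕ} {w : ℕ → ℕ} {X : Finset ℕ} (h : Path n w X) :
    X ⊆ range (X.card + n) := by
  induction n generalizing X with
  | zero =>
    rw [Path] at h
    exact h.le
  | succ n ih =>
    intro z hz
    have h1 := ih h.2.2
    rw [card_slide' h.1 h.2.1] at h1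
    have h2 := @h1 z
    have h3 := @h1 (w n)
    simp only [mem_slide, mem_range] at h2 h3 ⊢
    grind

theorem mem_level {m n : ℕ} {X : Finset ℕ} : X ∈ level m n ↔ X.card = m ∧ Lev n X := by
  classical
  rw [level, mem_filter, mem_powersetCard]
  constructor
  · rintro ⟨⟨-, h1⟩, h2⟩
    exact ⟨h1, h2⟩
  · rintro ⟨rfl, h2⟩
    obtain ⟨w, hw⟩ := h2.exists_path
    exact ⟨⟨hw.subset_range, rfl⟩, h2⟩

/-- The beads of `Y` that can be moved up. -/
def upBeads (Y : Finset ℕ) : Finset ℕ := Y.filter fun a => a + 1 ∉ Y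

/-- Move the bead `a` up. -/
def raise (a : ℕ) (Y : Finset ℕ) : Finset ℕ := insert (a + 1) (Y.erase a)

theorem mem_upBeads {a : ℕ} {Y : Finset ℕ} : a ∈ upBeads Y ↔ a ∈ Y ∧ a + 1 ∉ Y := mem_filter

theorem mem_raise {a z : ℕ} {Y : Finset ℕ} : z ∈ raise a Y ↔ z = a + 1 ∨ z ≠ a ∧ z ∈ Y := by
  rw [raise, mem_insert, mem_erase]

theorem slide_raise {a : ℕ} {Y : Finset ℕ} (h : a ∈ upBeads Y) : slide 1 a (raise a Y) = Y := by
  rw [mem_upBeads] at h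
  ext z
  rw [mem_slide, mem_raise]
  grind

theorem raise_slide {c : ℕ} {X : Finset ℕ} (h : c ∈ dn 1 X) : raise c (slide 1 c X) = X := by
  rw [mem_dn] at h
  ext z
  rw [mem_raise, mem_slide]
  grind

theorem mem_dn_raise (a : ℕ) (Y : Finset ℕ) : a ∈ dn 1 (raise a Y) := by
  rw [mem_dn, mem_raise, mem_raise]
  grind

theorem mem_upBeads_slide (c : ℕ) (X : Finset ℕ) : c ∈ upBeads (slide 1 c X) := by
  rw [mem_upBeads, mem_slide, mem_slide]
  grind

theorem dn_raise {a : ℕ} {Y : Finset ℕ} (h : a ∈ upBeads Y) :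
    dn 1 (raise a Y) = insert a ((dn 1 Y).filter fun c => c ≠ a + 1 ∧ c + 1 ≠ a) := by
  rw [mem_upBeads] at h
  ext c
  simp only [mem_dn, mem_raise, mem_insert, mem_filter]
  grind

theorem upBeads_slide {c : ℕ} {Y : Finset ℕ} (h : c ∈ dn 1 Y) :
    upBeads (slide 1 c Y) = insert c ((upBeads Y).filter fun a => c ≠ a + 1 ∧ c + 1 ≠ a) := by
  rw [mem_dn] at h
  ext a
  simp only [mem_upBeads, mem_slide, mem_insert, mem_filter]
  grind

theorem raise_slide_comm {a c : ℕ} {Y : Finset ℕ} (h : a ≠ c) : raise a (slide 1 c Y) = slide 1 c (raise a Y) := by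
  ext z
  simp only [mem_raise, mem_slide]
  grind

/-- Every maximal run of beads has an upper end that can move up; every run except the one
containing `0` has a lower end that can move down. -/
theorem card_upBeads {Y : Finset ℕ} (h : 0 ∈ Y) : (upBeads Y).card = (dn 1 Y).card + 1 := by
  have h1 := card_filter_add_card_filter_not (s := Y) (fun a => a + 1 ∉ Y)
  have h2 : ((Y.erase 0).filter fun z => z - 1 ∉ Y).card = (dn 1 Y).card := by
    refine card_bij' (fun z _ => z - 1) (fun c _ => c + 1) ?_ ?_ ?_ ?_ <;>
      simp only [mem_filter, mem_erase, mem_dn] <;> grind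
  have h3 := card_filter_add_card_filter_not (s := Y.erase 0) (fun z => z - 1 ∉ Y)
  have h4 : (Y.filter fun a => ¬ a + 1 ∉ Y).card = ((Y.erase 0).filter fun z => ¬ z - 1 ∉ Y).card := by
    refine card_bij' (fun z _ => z + 1) (fun z _ => z - 1) ?_ ?_ ?_ ?_ <;>
      simp only [mem_filter, mem_erase] <;> grind
  have h5 := card_erase_add_one h
  rw [upBeads]
  omega

/-- This is the commutation relation `DU - UD = 1` of Young's lattice. Raising `a` and lowering `c`
commute when they concern different places. The pairs that undo each other number one more in the
order up-down than in the order down-up, by `card_upBeads`. The bound `n < Y.card` guarantees the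
bead at `0`. -/
theorem sum_cnt_raise {n : ℕ} {Y : Finset ℕ} (hY : Lev n Y) (hn : n < Y.card) :
    ∑ a ∈ upBeads Y, cnt (n + 1) (raise a Y) = (n + 1) * cnt n Y := by
  induction n generalizing Y with
  | zero =>
    have h0 : dn 1 Y = ∅ := by
      rw [hY.eq_range]
      ext c
      simp only [mem_dn, mem_range, notMem_empty, iff_false]
      omega
    have h1 : ∀ a ∈ upBeads Y, cnt 1 (raise a Y) = cnt 0 Y := by
      intro a ha
      rw [cnt_succ, dn_raise ha, h0, filter_empty, insert_empty, sum_singleton, slide_raise ha]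
    rw [sum_congr rfl h1, sum_const, card_upBeads (zero_mem_of_lev hY hn), h0]
    simp
  | succ n ih =>
    have hl : ∀ a ∈ upBeads Y, cnt (n + 1 + 1) (raise a Y) = cnt (n + 1) Y +
        ∑ c ∈ dn 1 Y, if c ≠ a + 1 ∧ c + 1 ≠ a then cnt (n + 1) (slide 1 c (raise a Y)) else 0 := by
      intro a ha
      rw [cnt_succ, dn_raise ha, sum_insert, slide_raise ha, sum_filter]
      rw [mem_upBeads] at ha
      simp [mem_dn, ha]
    have hr : ∀ c ∈ dn 1 Y, (n + 1) * cnt n (slide 1 c Y) = cnt (n + 1) Y +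
        ∑ a ∈ upBeads Y, if c ≠ a + 1 ∧ c + 1 ≠ a then cnt (n + 1) (slide 1 c (raise a Y))
          else 0 := by
      intro c hc
      have hc' := mem_dn.1 hc
      rw [← ih (hY.rem ⟨c, hc'.1, hc'.2, rfl⟩).2 (by rw [card_slide' hc'.1 hc'.2]; omega),
        upBeads_slide hc, sum_insert, raise_slide hc, sum_filter]
      · congr 1
        refine sum_congr rfl fun a ha => ?_
        split_ifs with h
        · rw [raise_slide_comm (by rintro rfl; exact hc'.1 (mem_upBeads.1 ha).1)]
        · rfl
      · simp [mem_upBeads, hc'.1]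
    have hs : (n + 1) * cnt (n + 1) Y = (dn 1 Y).card * cnt (n + 1) Y +
        ∑ c ∈ dn 1 Y, ∑ a ∈ upBeads Y, if c ≠ a + 1 ∧ c + 1 ≠ a then
          cnt (n + 1) (slide 1 c (raise a Y)) else 0 := by
      conv_lhs => rw [cnt_succ, mul_sum, sum_congr rfl hr, sum_add_distrib, sum_const,
        smul_eq_mul]
    rw [sum_congr rfl hl, sum_add_distrib, sum_comm, add_mul (n + 1), one_mul, hs, sum_const,
      card_upBeads (zero_mem_of_lev hY hn)]
    simp only [smul_eq_mul]
    ring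

/-- Expand one factor over the lower neighbours and sum over the edges between levels `n` and `n +
1` from the other end, using `sum_cnt_raise`. -/
theorem sum_cnt_sq {m n : ℕ} (hn : n ≤ m) : ∑ X ∈ level m n, cnt n X ^ 2 = n.factorial := by
  induction n with
  | zero =>
    have : level m 0 = {range m} := by
      ext X
      rw [mem_level, mem_singleton]
      constructor
      · rintro ⟨rfl, h⟩
        exact h.eq_range
      · rintro rfl
        exact ⟨card_range m, by rw [Lev, card_range, add_zero]⟩
    rw [this, sum_singleton, cnt]
    simp
  | succ n ih =>
    have h1 : ∑ X ∈ level m (n + 1), cnt (n + 1) X ^ 2 =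
        ∑ X ∈ level m (n + 1), ∑ c ∈ dn 1 X, cnt (n + 1) X * cnt n (slide 1 c X) := by
      refine sum_congr rfl fun X _ => ?_
      rw [← mul_sum, sq]
      rfl
    have h2 : ∑ Y ∈ level m n, (n + 1) * cnt n Y ^ 2 =
        ∑ Y ∈ level m n, ∑ a ∈ upBeads Y, cnt (n + 1) (raise a Y) * cnt n Y := by
      refine sum_congr rfl fun Y hY => ?_
      rw [mem_level] at hY
      rw [← sum_mul, sum_cnt_raise hY.2 (by omega)]
      ring
    rw [Nat.factorial_succ, ← ih (by omega), mul_sum, h1, h2, sum_sigma', sum_sigma']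
    refine sum_bij' (fun p _ => ⟨slide 1 p.2 p.1, p.2⟩) (fun p _ => ⟨raise p.2 p.1, p.2⟩)
      ?_ ?_ ?_ ?_ ?_
    · rintro ⟨X, c⟩ h
      simp only [mem_sigma, mem_level] at h ⊢
      have hc := mem_dn.1 h.2
      exact ⟨⟨by rw [card_slide' hc.1 hc.2, h.1.1], (h.1.2.rem ⟨c, hc.1, hc.2, rfl⟩).2⟩,
        mem_upBeads_slide c X⟩
    · rintro ⟨Y, a⟩ h
      simp only [mem_sigma, mem_level] at h ⊢
      have hc := mem_dn.1 (mem_dn_raise a Y)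
      refine ⟨⟨?_, Rem.lev ⟨a, hc.1, hc.2, rfl⟩ ?_⟩, mem_dn_raise a Y⟩
      · rw [← card_slide' hc.1 hc.2, slide_raise h.2, h.1.1]
      · rw [slide_raise h.2]
        exact h.1.2
    · rintro ⟨X, c⟩ h
      simp only [mem_sigma] at h
      simp only [raise_slide h.2]
    · rintro ⟨Y, a⟩ h
      simp only [mem_sigma] at h
      simp only [slide_raise h.2]
    · rintro ⟨X, c⟩ h
      simp only [mem_sigma] at h
      simp only [raise_slide h.2]

end Counting

/-! ### Young's orthogonal form -/

section Seminormal

/-- The diagonal coefficient of Young's seminormal form. -/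
noncomputable def diagCoeff (a b : ℕ) : ℂ := ((b : ℂ) - a)⁻¹

/-- The off-diagonal coefficient of Young's orthogonal form. -/
noncomputable def offCoeff (a b : ℕ) : ℂ := (1 - diagCoeff a b ^ 2) ^ (((2 : ℕ) : ℂ)⁻¹)

theorem diagCoeff_swap (a b : ℕ) : diagCoeff b a = -diagCoeff a b := by
  rw [diagCoeff, diagCoeff, ← inv_neg, neg_sub]

theorem offCoeff_swap (a b : ℕ) : offCoeff b a = offCoeff a b := by
  rw [offCoeff, offCoeff, diagCoeff_swap, neg_sq]

theorem offCoeff_sq (a b : ℕ) : offCoeff a b ^ 2 = 1 - diagCoeff a b ^ 2 :=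
  Complex.cpow_nat_inv_pow _ two_ne_zero

theorem diagCoeff_mul_sub {a b : ℕ} (h : a ≠ b) : diagCoeff a b * ((b : ℂ) - a) = 1 :=
  inv_mul_cancel₀ (sub_ne_zero.2 (by exact_mod_cast h.symm))

/-- The reciprocals add up: `(b - a) + (c - b) = c - a`. The braid relation reduces to this
identity. -/
theorem diagCoeff_mul {a b c : ℕ} (h1 : a ≠ b) (h2 : b ≠ c) (h3 : a ≠ c) :
    diagCoeff a b * diagCoeff b c = (diagCoeff a b + diagCoeff b c) * diagCoeff a c := by
  have e1 : (b : ℂ) - a ≠ 0 := sub_ne_zero.2 (by exact_mod_cast h1.symm)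
  have e2 : (c : ℂ) - b ≠ 0 := sub_ne_zero.2 (by exact_mod_cast h2.symm)
  have e3 : (c : ℂ) - a ≠ 0 := sub_ne_zero.2 (by exact_mod_cast h3.symm)
  rw [diagCoeff, diagCoeff, diagCoeff]
  field_simp
  ring

theorem offCoeff_ne_zero {a b : ℕ} (h : a + 1 < b ∨ b + 1 < a) : offCoeff a b ≠ 0 := by
  have hab : a ≠ b := by omega
  intro h0
  have h1 := offCoeff_sq a b
  rw [h0, zero_pow two_ne_zero] at h1
  have h2 := diagCoeff_mul_sub hab
  have h3 : ((b : ℂ) - a - 1) * ((b : ℂ) - a + 1) = 0 := by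
    linear_combination (1 + diagCoeff a b * ((b : ℂ) - a)) * h2 + ((b : ℂ) - a) ^ 2 * h1.symm
  rcases mul_eq_zero.1 h3 with h3 | h3
  · have : (b : ℂ) = ((a + 1 : ℕ) : ℂ) := by push_cast; linear_combination h3
    have := Nat.cast_injective this
    omega
  · have : (a : ℂ) = ((b + 1 : ℕ) : ℂ) := by push_cast; linear_combination -h3
    have := Nat.cast_injective this
    omega

theorem offCoeff_eq_zero {a b : ℕ} (h : b = a + 1 ∨ a = b + 1) : offCoeff a b = 0 := by
  have h1 := offCoeff_sq a b
  rw [← sq_eq_zero_iff, h1]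
  rcases h with rfl | rfl <;> simp [diagCoeff]

@[simp] theorem swapWord_swapWord (i : ℕ) (w : ℕ → ℕ) : swapWord i (swapWord i w) = w := by
  funext j
  simp [swapWord]

/-- The functions on words. -/
abbrev WordFun : Type := (ℕ → ℕ) → ℂ

/-- The operator by which the transposition of `i` and `i + 1` acts in Young's orthogonal form. -/
noncomputable def youngOp (i : ℕ) : WordFun →ₗ[ℂ] WordFun where
  toFun f w := diagCoeff (w i) (w (i + 1)) * f w + offCoeff (w i) (w (i + 1)) * f (swapWord i w)
  map_add' f g := by
    funext w
    simp only [Pi.add_apply]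
    ring
  map_smul' c f := by
    funext w
    simp only [Pi.smul_apply, smul_eq_mul, RingHom.id_apply]
    ring

theorem youngOp_apply (i : ℕ) (f : WordFun) (w : ℕ → ℕ) : youngOp i f w =
    diagCoeff (w i) (w (i + 1)) * f w + offCoeff (w i) (w (i + 1)) * f (swapWord i w) := rfl

theorem youngOp_youngOp (i : ℕ) (f : WordFun) : youngOp i (youngOp i f) = f := by
  funext w
  simp only [youngOp_apply, swapWord_left, swapWord_right, swapWord_swapWord,
    diagCoeff_swap (w i) (w (i + 1)), offCoeff_swap (w i) (w (i + 1))]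
  linear_combination f w * offCoeff_sq (w i) (w (i + 1))

theorem swapWord_comm {i j : ℕ} (h : i + 1 < j) (w : ℕ → ℕ) :
    swapWord i (swapWord j w) = swapWord j (swapWord i w) := by
  have : Equiv.swap i (i + 1) * Equiv.swap j (j + 1) =
      Equiv.swap j (j + 1) * Equiv.swap i (i + 1) := by
    rw [Equiv.mul_swap_eq_swap_mul, Equiv.swap_apply_of_ne_of_ne, Equiv.swap_apply_of_ne_of_ne] <;>
      omega
  funext x
  exact congrArg w (DFunLike.congr_fun this.symm x)

theorem swapWord_braid (i : ℕ) (w : ℕ → ℕ) : swapWord i (swapWord (i + 1) (swapWord i w)) =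
    swapWord (i + 1) (swapWord i (swapWord (i + 1) w)) := by
  have h : Equiv.swap i (i + 1) * Equiv.swap (i + 1) (i + 2) * Equiv.swap i (i + 1) =
      Equiv.swap (i + 1) (i + 2) * Equiv.swap i (i + 1) * Equiv.swap (i + 1) (i + 2) := by
    rw [Equiv.swap_mul_swap_mul_swap (by omega) (by omega), Equiv.swap_comm i (i + 1),
      Equiv.swap_comm (i + 1) (i + 2), Equiv.swap_mul_swap_mul_swap (by omega) (by omega),
      Equiv.swap_comm]
  funext x
  exact congrArg w (DFunLike.congr_fun h x)

theorem youngOp_comm {i j : ℕ} (h : i + 1 < j) (f : WordFun) :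
    youngOp i (youngOp j f) = youngOp j (youngOp i f) := by
  funext w
  simp only [youngOp_apply, swapWord_comm h]
  rw [swapWord_of_ne (i := i) (j := j) w (by omega) (by omega),
    swapWord_of_ne (i := i) (j := j + 1) w (by omega) (by omega),
    swapWord_of_ne (i := j) (j := i) w (by omega) (by omega),
    swapWord_of_ne (i := j) (j := i + 1) w (by omega) (by omega)]
  ring

/-- The values of `f` at the words that need an argument are `w` and its two neighbours. Their
coefficients agree by `diagCoeff_mul`, after the squares of the off-diagonal coefficients are
eliminated. The three letters must be distinct, so the relation holds on paths but not for arbitrary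
words. -/
theorem youngOp_braid {i : ℕ} (f : WordFun) {w : ℕ → ℕ} (h1 : w i ≠ w (i + 1))
    (h2 : w (i + 1) ≠ w (i + 2)) (h3 : w i ≠ w (i + 2)) :
    youngOp i (youngOp (i + 1) (youngOp i f)) w =
      youngOp (i + 1) (youngOp i (youngOp (i + 1) f)) w := by
  have a1 : ∀ v, swapWord i v (i + 1 + 1) = v (i + 1 + 1) := fun v =>
    swapWord_of_ne _ (by omega) (by omega)
  have a2 : ∀ v, swapWord (i + 1) v i = v i := fun v => swapWord_of_ne _ (by omega) (by omega)
  have key := diagCoeff_mul h1 h2 h3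
  have hu := offCoeff_sq (w i) (w (i + 1))
  have hv := offCoeff_sq (w (i + 1)) (w (i + 2))
  simp only [youngOp_apply, swapWord_left, swapWord_right, swapWord_swapWord, a1, a2,
    diagCoeff_swap (w i) (w (i + 1)), offCoeff_swap (w i) (w (i + 1)), swapWord_braid,
    diagCoeff_swap (w (i + 1)) (w (i + 1 + 1)), offCoeff_swap (w (i + 1)) (w (i + 1 + 1))]
  rw [show i + 2 = i + 1 + 1 from rfl] at *
  set u := diagCoeff (w i) (w (i + 1))
  set v := diagCoeff (w (i + 1)) (w (i + 1 + 1))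
  set z := diagCoeff (w i) (w (i + 1 + 1))
  set gu := offCoeff (w i) (w (i + 1))
  set gv := offCoeff (w (i + 1)) (w (i + 1 + 1))
  linear_combination ((u - v) * f w + gu * f (swapWord i w) - gv * f (swapWord (i + 1) w)) * key +
    z * f w * hu - z * f w * hv

/-- The functions supported on a set of words. -/
def supp (Ω : Finset (ℕ → ℕ)) : Submodule ℂ WordFun where
  carrier := {f | ∀ w, w ∉ Ω → f w = 0}
  add_mem' hf hg w hw := by rw [Pi.add_apply, hf w hw, hg w hw, add_zero]
  zero_mem' _ _ := rfl
  smul_mem' c f hf w hw := by rw [Pi.smul_apply, hf w hw, smul_zero]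

/-- A set of words that carries Young's orthogonal form for `S_k`. -/
structure Admissible (k : ℕ) (Ω : Finset (ℕ → ℕ)) : Prop where
  swap_mem : ∀ w ∈ Ω, ∀ i, i + 1 < k → Swappable i w → swapWord i w ∈ Ω
  ne_succ : ∀ w ∈ Ω, ∀ i, i + 1 < k → w i ≠ w (i + 1)
  ne_succ_succ : ∀ w ∈ Ω, ∀ i, i + 2 < k → w i ≠ w (i + 2)
  exists_head_eq : 0 < k → ∃ c, ∀ w ∈ Ω, w 0 = c
  eq_of_agree : ∀ w ∈ Ω, ∀ w' ∈ Ω, (∀ i, i < k → w i = w' i) → w = w'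

variable {k n : ℕ} {Ω : Finset (ℕ → ℕ)}

/-- A word outside `Ω` whose exchange lies in `Ω` has neighbouring letters differing by exactly one,
where the off-diagonal coefficient vanishes. -/
theorem Admissible.youngOp_mem (h : Admissible k Ω) {i : ℕ} (hi : i + 1 < k) {f : WordFun}
    (hf : f ∈ supp Ω) : youngOp i f ∈ supp Ω := by
  intro w hw
  rw [youngOp_apply, hf w hw, mul_zero, zero_add]
  by_cases hs : swapWord i w ∈ Ω
  · rw [offCoeff_eq_zero, zero_mul]
    have h1 := h.ne_succ _ hs i hi
    rw [swapWord_left, swapWord_right] at h1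
    have h2 : ¬ Swappable i (swapWord i w) := fun h2 => hw (by
      rw [← swapWord_swapWord i w]
      exact h.swap_mem _ hs i hi h2)
    rw [Swappable, swapWord_left, swapWord_right] at h2
    omega
  · rw [hf _ hs, mul_zero]

/-- Young's orthogonal form. -/
theorem Admissible.exists_hom (h : Admissible (n + 1) Ω) :
    ∃ φ : Equiv.Perm (Fin (n + 1)) →* Module.End ℂ (supp Ω), ∀ (i : Fin n) (f : supp Ω),
      (φ (Equiv.swap i.castSucc i.succ) f : WordFun) = youngOp i f := by
  let t : ℕ → Module.End ℂ (supp Ω) := fun i => if hi : i + 1 < n + 1 then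
    (youngOp i).restrict fun _ hf => h.youngOp_mem hi hf else 1
  have ht : ∀ i, i < n → ∀ f, (t i f : WordFun) = youngOp i f := by
    intro i hi f
    simp only [t, dif_pos (Nat.succ_lt_succ hi)]
    rfl
  have hcox : IsCoxeterSeq n t := by
    refine ⟨fun i hi => ?_, fun i hi => ?_, fun i j hij hj => ?_⟩
    · refine LinearMap.ext fun f => Subtype.ext ?_
      rw [Module.End.mul_apply, ht i hi, ht i hi, youngOp_youngOp, Module.End.one_apply]
    · refine LinearMap.ext fun f => Subtype.ext (funext fun w => ?_)
      have hi' : i < n := by omega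
      by_cases hw : w ∈ Ω
      · simp only [Module.End.mul_apply, ht _ hi, ht _ hi']
        exact youngOp_braid _ (h.ne_succ w hw i (by omega)) (h.ne_succ w hw (i + 1) (by omega))
          (h.ne_succ_succ w hw i (by omega))
      · rw [(Subtype.property _ : _ ∈ supp Ω) w hw, (Subtype.property _ : _ ∈ supp Ω) w hw]
    · have hi : i < n := by omega
      refine LinearMap.ext fun f => Subtype.ext ?_
      simp only [Module.End.mul_apply, ht _ hi, ht _ hj]
      exact youngOp_comm hij _
  obtain ⟨φ, hφ⟩ := hcox.exists_hom
  exact ⟨φ, fun i f => by rw [hφ, ht i i.2]⟩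

end Seminormal

/-! ### Jucys-Murphy elements and matrix units -/

section MatrixUnits

variable {k : ℕ} {Ω : Finset (ℕ → ℕ)}

/-- The algebra generated by the operators that belong to `S_k`. -/
noncomputable def youngAlg (k : ℕ) : Subalgebra ℂ (Module.End ℂ WordFun) :=
  Algebra.adjoin ℂ {T | ∃ i, i + 1 < k ∧ T = youngOp i}

theorem youngOp_mem_youngAlg {i : ℕ} (hi : i + 1 < k) : youngOp i ∈ youngAlg k :=
  Algebra.subset_adjoin ⟨i, hi, rfl⟩

theorem mul_mem_supp (d : (ℕ → ℕ) → ℂ) {f : WordFun} (hf : f ∈ supp Ω) :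
    (fun w => d w * f w) ∈ supp Ω := fun w hw => by
  simp only [hf w hw, mul_zero]

/-- The Jucys-Murphy elements act diagonally. -/
theorem Admissible.exists_jucysMurphy (h : Admissible k Ω) {c : ℕ} (hc : ∀ w ∈ Ω, w 0 = c)
    {j : ℕ} (hj : j < k) :
    ∃ x ∈ youngAlg k, ∀ f ∈ supp Ω, x f = fun w => ((w j : ℂ) - c) * f w := by
  induction j with
  | zero =>
    refine ⟨0, zero_mem _, fun f hf => funext fun w => ?_⟩
    by_cases hw : w ∈ Ω
    · simp [hc w hw]
    · simp [hf w hw]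
  | succ j ih =>
    obtain ⟨x, hx, hxf⟩ := ih (by omega)
    have ht := youngOp_mem_youngAlg hj
    -- This is the recursion `x_{j+1} = s_j x_j s_j + s_j`, starting from `x_0 = 0`, which fits
    -- because the letter `0` of every word is `c`.
    refine ⟨youngOp j * x * youngOp j + youngOp j, add_mem (mul_mem (mul_mem ht hx) ht) ht,
      fun f hf => funext fun w => ?_⟩
    have hf1 := h.youngOp_mem hj hf
    rw [LinearMap.add_apply, Module.End.mul_apply, Module.End.mul_apply, hxf _ hf1, Pi.add_apply]
    by_cases hw : w ∈ Ω
    · have h1 := diagCoeff_mul_sub (h.ne_succ w hw j hj)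
      have h2 := offCoeff_sq (w j) (w (j + 1))
      simp only [youngOp_apply, swapWord_left, swapWord_right, swapWord_swapWord,
        diagCoeff_swap (w j) (w (j + 1)), offCoeff_swap (w j) (w (j + 1))]
      linear_combination ((w (j + 1) : ℂ) - c) * f w * h2 -
        (diagCoeff (w j) (w (j + 1)) * f w +
          offCoeff (w j) (w (j + 1)) * f (swapWord j w)) * h1
    · rw [hf1 w hw, h.youngOp_mem hj (mul_mem_supp _ hf1) w hw, hf w hw]
      ring

open Classical in
/-- The indicator function of a word. -/
noncomputable def delta (w : ℕ → ℕ) : WordFun := fun v => if v = w then 1 else 0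

@[simp] theorem delta_self (w : ℕ → ℕ) : delta w w = 1 := if_pos rfl

theorem delta_of_ne {v w : ℕ → ℕ} (h : v ≠ w) : delta w v = 0 := if_neg h

theorem delta_mem {w : ℕ → ℕ} (hw : w ∈ Ω) : delta w ∈ supp Ω := fun _ hv =>
  delta_of_ne fun h => hv (h ▸ hw)

/-- Interpolation: for each `v ∈ S` multiply by a factor in the Jucys-Murphy element of a place `j`
where `w` and `v` differ, normalized to be `1` at `w` and `0` at `v`. -/
theorem Admissible.exists_diag (h : Admissible k Ω) {w : ℕ → ℕ} (hw : w ∈ Ω)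
    (S : Finset (ℕ → ℕ)) (hS : S ⊆ Ω) (hwS : w ∉ S) :
    ∃ p ∈ youngAlg k, ∃ d : (ℕ → ℕ) → ℂ, d w = 1 ∧ (∀ v ∈ S, d v = 0) ∧
      ∀ f ∈ supp Ω, p f = fun v => d v * f v := by
  classical
  induction S using Finset.induction_on with
  | empty =>
    exact ⟨1, one_mem _, fun _ => 1, rfl, by simp, fun f _ => by simp⟩
  | insert v S hv ih =>
    rw [insert_subset_iff] at hS
    rw [mem_insert, not_or] at hwS
    obtain ⟨p, hp, d, hdw, hdS, hpf⟩ := ih hS.2 hwS.2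
    obtain ⟨j, hj, hne⟩ : ∃ j, j < k ∧ w j ≠ v j := by
      by_contra! hcon
      exact hwS.1 (h.eq_of_agree w hw v hS.1 hcon)
    obtain ⟨c, hc⟩ := h.exists_head_eq (by omega)
    obtain ⟨x, hx, hxf⟩ := h.exists_jucysMurphy hc hj
    have hne' : (w j : ℂ) - v j ≠ 0 := sub_ne_zero.2 (by exact_mod_cast hne)
    refine ⟨((w j : ℂ) - v j)⁻¹ • ((x - ((v j : ℂ) - c) • 1) * p),
      Subalgebra.smul_mem _ (mul_mem (sub_mem hx (Subalgebra.smul_mem _ (one_mem _) _)) hp) _,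
      fun u => ((w j : ℂ) - v j)⁻¹ * ((u j : ℂ) - v j) * d u, ?_, ?_, ?_⟩
    · simp only [hdw, inv_mul_cancel₀ hne', mul_one]
    · intro u hu
      rcases mem_insert.1 hu with rfl | hu
      · simp
      · simp [hdS u hu]
    · intro f hf
      funext u
      rw [LinearMap.smul_apply, Module.End.mul_apply, hpf f hf, LinearMap.sub_apply,
        hxf _ (mul_mem_supp d hf)]
      simp only [LinearMap.smul_apply, Module.End.one_apply, Pi.smul_apply, Pi.sub_apply,
        smul_eq_mul]
      ring

theorem Admissible.exists_proj (h : Admissible k Ω) {w : ℕ → ℕ} (hw : w ∈ Ω) :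
    ∃ p ∈ youngAlg k, ∀ f ∈ supp Ω, p f = f w • delta w := by
  classical
  obtain ⟨p, hp, d, hdw, hd, hpf⟩ := h.exists_diag hw (Ω.erase w) (erase_subset _ _)
    (notMem_erase _ _)
  refine ⟨p, hp, fun f hf => funext fun v => ?_⟩
  rw [hpf f hf, Pi.smul_apply, smul_eq_mul]
  rcases eq_or_ne v w with rfl | hv
  · simp only [hdw, delta_self, one_mul, mul_one]
  · rw [delta_of_ne hv, mul_zero]
    by_cases hvΩ : v ∈ Ω
    · simp only [hd v (mem_erase.2 ⟨hv, hvΩ⟩), zero_mul]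
    · simp only [hf v hvΩ, mul_zero]

/-- Each exchange sends the current delta function to the next one with nonzero coefficient, plus a
multiple of itself that the projection removes. -/
theorem Admissible.exists_matrixUnit (h : Admissible k Ω) {w w' : ℕ → ℕ} (hw : w ∈ Ω)
    (hww : Relation.ReflTransGen (SwapStep k) w w') :
    w' ∈ Ω ∧ ∃ p ∈ youngAlg k, ∀ f ∈ supp Ω, p f = f w • delta w' := by
  induction hww with
  | refl => exact ⟨hw, h.exists_proj hw⟩
  | @tail v _ _ hstep ih =>
    obtain ⟨i, hi, hs, rfl⟩ := hstep
    obtain ⟨hv, p, hp, hpf⟩ := ih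
    have hsv := h.swap_mem v hv i hi hs
    obtain ⟨q, hq, hqf⟩ := h.exists_proj hsv
    have h0 : offCoeff (v (i + 1)) (v i) ≠ 0 := offCoeff_ne_zero hs.symm
    refine ⟨hsv, (offCoeff (v (i + 1)) (v i))⁻¹ • (q * youngOp i * p),
      Subalgebra.smul_mem _ (mul_mem (mul_mem hq (youngOp_mem_youngAlg hi)) hp) _, fun f hf => ?_⟩
    have hne : swapWord i v ≠ v := fun heq => h.ne_succ v hv i hi (by
      conv_lhs => rw [← heq]
      simp)
    rw [LinearMap.smul_apply, Module.End.mul_apply, Module.End.mul_apply, hpf f hf, map_smul,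
      map_smul, hqf _ (h.youngOp_mem hi (delta_mem hv)), youngOp_apply, swapWord_swapWord,
      delta_self, delta_of_ne hne, swapWord_left, swapWord_right, mul_zero, zero_add, mul_one,
      smul_comm, inv_smul_smul₀ h0]

end MatrixUnits

/-! ### Path words as admissible sets -/

section Admissible

theorem admissible_of_path {k n m : ℕ} {Ω : Finset (ℕ → ℕ)} (hk : k ≤ n)
    (hΩ : ∀ w ∈ Ω, ∃ X, X.card = m ∧ Path n w X)
    (hs : ∀ w ∈ Ω, ∀ i, i + 1 < n → Swappable i w → swapWord i w ∈ Ω)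
    (he : ∀ w ∈ Ω, ∀ w' ∈ Ω, (∀ i, i < k → w i = w' i) → w = w') : Admissible k Ω where
  swap_mem w hw i hi := hs w hw i (by omega)
  ne_succ w hw i hi := by
    obtain ⟨X, -, h⟩ := hΩ w hw
    exact h.ne_succ (by omega)
  ne_succ_succ w hw i hi := by
    obtain ⟨X, -, h⟩ := hΩ w hw
    exact h.ne_succ_succ (by omega)
  exists_head_eq h0 := by
    refine ⟨m - 1, fun w hw => ?_⟩
    obtain ⟨X, hX, h⟩ := hΩ w hw
    obtain ⟨n, rfl⟩ := Nat.exists_eq_add_one_of_ne_zero (show n ≠ 0 by omega)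
    have := h.head_eq
    omega
  eq_of_agree := he

theorem swapWord_mem_pathWords {n i : ℕ} {X : Finset ℕ} {w : ℕ → ℕ} (hw : w ∈ pathWords n X)
    (hi : i + 1 < n) (hs : Swappable i w) : swapWord i w ∈ pathWords n X := by
  rw [mem_pathWords] at hw ⊢
  refine ⟨hw.1.swapWord hi hs, fun j hj => ?_⟩
  rw [swapWord_of_ne _ (by omega) (by omega), hw.2 j hj]

/-- A path is determined by its end and all its moves but the last one. -/
theorem eq_of_agree_of_mem_pathWords {n : ℕ} {X : Finset ℕ} {w w' : ℕ → ℕ}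
    (hw : w ∈ pathWords (n + 1) X) (hw' : w' ∈ pathWords (n + 1) X)
    (h : ∀ i, i < n → w i = w' i) : w = w' := by
  rw [mem_pathWords] at hw hw'
  obtain ⟨⟨h1, h2, h3⟩, h4⟩ := hw
  obtain ⟨⟨h1', h2', h3'⟩, h4'⟩ := hw'
  have h5 := h3.unique ((path_congr fun i hi => (h i hi).symm).1 h3')
    (by rw [card_slide' h1 h2, card_slide' h1' h2'])
  have h6 : w n = w' n := by
    have : w n ∈ slide 1 (w' n) X := h5 ▸ mem_slide.2 (Or.inl rfl)
    rw [mem_slide] at this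
    grind
  funext j
  rcases lt_trichotomy j n with hj | rfl | hj
  · exact h j hj
  · exact h6
  · rw [h4 j hj, h4' j hj]

/-- The case `k = n + 1` carries the representation of `S_{n+1}`. In the case `k = n` the first `n`
letters still separate the words; this is why the restriction to `S_n` is multiplicity free. -/
theorem admissible_pathWords {k n : ℕ} (X : Finset ℕ) (h1 : n ≤ k) (h2 : k ≤ n + 1) :
    Admissible k (pathWords (n + 1) X) :=
  admissible_of_path h2 (fun _ hw => ⟨X, rfl, (mem_pathWords.1 hw).1⟩)
    (fun _ hw _ hi hs => swapWord_mem_pathWords hw hi hs)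
    fun _ hw _ hw' h => eq_of_agree_of_mem_pathWords hw hw' fun i hi => h i (by omega)

open Classical in
/-- The words of all paths of length `n` on `m` beads. -/
noncomputable def allWords (m n : ℕ) : Finset (ℕ → ℕ) := (level m n).biUnion (pathWords n)

theorem mem_allWords {m n : ℕ} {w : ℕ → ℕ} :
    w ∈ allWords m n ↔ ∃ X, (X.card = m ∧ Lev n X) ∧ w ∈ pathWords n X := by
  classical
  simp only [allWords, mem_biUnion, mem_level]

theorem pathWords_subset_allWords {m n : ℕ} {X : Finset ℕ} (h : X.card = m) (hX : Lev n X) :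
    pathWords n X ⊆ allWords m n := fun _ hw => mem_allWords.2 ⟨X, ⟨h, hX⟩, hw⟩

theorem admissible_allWords (m n : ℕ) : Admissible n (allWords m n) := by
  refine admissible_of_path (m := m) le_rfl (fun w hw => ?_) (fun w hw i hi hs => ?_)
    fun w hw w' hw' h => funext fun j => ?_
  · obtain ⟨X, ⟨h1, -⟩, h2⟩ := mem_allWords.1 hw
    exact ⟨X, h1, (mem_pathWords.1 h2).1⟩
  · obtain ⟨X, h1, h2⟩ := mem_allWords.1 hw
    exact mem_allWords.2 ⟨X, h1, swapWord_mem_pathWords h2 hi hs⟩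
  · obtain ⟨X, h1, h2⟩ := mem_allWords.1 hw
    obtain ⟨Y, h3, h4⟩ := mem_allWords.1 hw'
    rcases Nat.lt_or_ge j n with hj | hj
    · exact h j hj
    · rw [(mem_pathWords.1 h2).2 j hj, (mem_pathWords.1 h4).2 j hj]

open Classical in
/-- The pairs of paths of length `n` on `m` beads with the same end. -/
noncomputable def pathPairs (m n : ℕ) : Finset ((ℕ → ℕ) × (ℕ → ℕ)) :=
  (level m n).biUnion fun X => pathWords n X ×ˢ pathWords n X

theorem mem_pathPairs {m n : ℕ} {p : (ℕ → ℕ) × (ℕ → ℕ)} : p ∈ pathPairs m n ↔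
    ∃ X, (X.card = m ∧ Lev n X) ∧ p.1 ∈ pathWords n X ∧ p.2 ∈ pathWords n X := by
  classical
  simp only [pathPairs, mem_biUnion, mem_level, mem_product]

theorem card_pathPairs {m n : ℕ} (h : n ≤ m) : (pathPairs m n).card = n.factorial := by
  classical
  rw [pathPairs, card_biUnion, ← sum_cnt_sq h]
  · exact sum_congr rfl fun X _ => by rw [card_product, card_pathWords, sq]
  · intro X hX Y hY hXY
    rw [Function.onFun, disjoint_left]
    intro p hp hp'
    rw [mem_product] at hp hp'
    rw [mem_coe, mem_level] at hX hY
    exact hXY ((mem_pathWords.1 hp.1).1.unique (mem_pathWords.1 hp'.1).1 (hX.1.trans hY.1.symm))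

end Admissible

/-! ### All irreducible representations have Young's orthogonal form -/

section Classification

theorem mem_of_swap_mem {n : ℕ} {V : Type*} [AddCommGroup V] [Module ℂ V]
    (ρ : Representation ℂ (Equiv.Perm (Fin (n + 1))) V) (W : Submodule ℂ V)
    (h : ∀ i : Fin n, ∀ v ∈ W, ρ (Equiv.swap i.castSucc i.succ) v ∈ W)
    (σ : Equiv.Perm (Fin (n + 1))) : ∀ v ∈ W, ρ σ v ∈ W := by
  have hσ : σ ∈ Submonoid.closure
      {σ : Equiv.Perm (Fin (n + 1)) | ∃ i : Fin n, σ = Equiv.swap i.castSucc i.succ} := by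
    rw [closure_swap_succ]
    trivial
  induction hσ using Submonoid.closure_induction with
  | mem σ hσ =>
    obtain ⟨i, rfl⟩ := hσ
    exact h i
  | one => simp
  | mul σ τ _ _ h1 h2 =>
    intro v hv
    rw [map_mul]
    exact h1 _ (h2 v hv)

theorem sum_smul_delta {Ω : Finset (ℕ → ℕ)} {f : WordFun} (hf : f ∈ supp Ω) :
    ∑ w ∈ Ω, f w • delta w = f := by
  funext v
  rw [Finset.sum_apply]
  simp only [Pi.smul_apply, smul_eq_mul]
  by_cases hv : v ∈ Ω
  · rw [sum_eq_single v, delta_self, mul_one]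
    · intro w _ hw
      rw [delta_of_ne hw.symm, mul_zero]
    · exact fun h => absurd hv h
  · rw [hf v hv]
    refine sum_eq_zero fun w hw => ?_
    rw [delta_of_ne (by rintro rfl; exact hv hw), mul_zero]

theorem supp_mono {Ω Ω' : Finset (ℕ → ℕ)} (h : Ω ⊆ Ω') : supp Ω ≤ supp Ω' :=
  fun _ hf w hw => hf w fun h' => hw (h h')

theorem finrank_supp (Ω : Finset (ℕ → ℕ)) : Module.finrank ℂ (supp Ω) = Ω.card := by
  classical
  let e : supp Ω ≃ₗ[ℂ] (Ω → ℂ) :=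
    { toFun := fun f w => f.1 w
      map_add' := fun _ _ => rfl
      map_smul' := fun _ _ => rfl
      invFun := fun g => ⟨fun w => if h : w ∈ Ω then g ⟨w, h⟩ else 0, fun w hw => dif_neg hw⟩
      left_inv := fun f => Subtype.ext (funext fun w => by
        by_cases hw : w ∈ Ω
        · simp [hw]
        · simp [hw, f.2 w hw])
      right_inv := fun g => funext fun w => by simp }
  rw [e.finrank_eq, Module.finrank_fintype_fun_eq_card, Fintype.card_coe]

/-- The group algebra of `S_{n+1}` acts faithfully by Young's orthogonal form, and its elements
realize all matrix units. -/
theorem exists_groupAlgebra_matrixUnits (n : ℕ) :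
    ∃ Ψ : MonoidAlgebra ℂ (Equiv.Perm (Fin (n + 1))) →ₐ[ℂ]
        Module.End ℂ (supp (allWords (n + 1) (n + 1))), Function.Injective Ψ ∧
      (∀ (i : Fin n) f, (Ψ (MonoidAlgebra.of ℂ _ (Equiv.swap i.castSucc i.succ)) f : WordFun) =
        youngOp i f) ∧
      ∀ p ∈ pathPairs (n + 1) (n + 1), ∃ x, ∀ f, (Ψ x f : WordFun) = f.1 p.1 • delta p.2 := by
  classical
  have hadm := admissible_allWords (n + 1) (n + 1)
  obtain ⟨φ, hφ⟩ := hadm.exists_hom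
  set Ψ := MonoidAlgebra.lift ℂ (Module.End ℂ (supp (allWords (n + 1) (n + 1))))
    (Equiv.Perm (Fin (n + 1))) φ
  have hΨ : ∀ (i : Fin n) f,
      (Ψ (MonoidAlgebra.of ℂ _ (Equiv.swap i.castSucc i.succ)) f : WordFun) = youngOp i f := by
    intro i f
    rw [MonoidAlgebra.lift_of, hφ]
  have hlift : ∀ p ∈ youngAlg (n + 1), ∃ x, ∀ f, (Ψ x f : WordFun) = p f := by
    intro p hp
    induction hp using Algebra.adjoin_induction with
    | mem p hp =>
      obtain ⟨i, hi, rfl⟩ := hp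
      exact ⟨_, hΨ ⟨i, by omega⟩⟩
    | algebraMap r =>
      refine ⟨algebraMap ℂ _ r, fun f => ?_⟩
      rw [AlgHom.commutes, Module.algebraMap_end_apply, Module.algebraMap_end_apply]
      rfl
    | add p q _ _ h1 h2 =>
      obtain ⟨x, hx⟩ := h1
      obtain ⟨y, hy⟩ := h2
      refine ⟨x + y, fun f => ?_⟩
      rw [map_add, LinearMap.add_apply, LinearMap.add_apply, ← hx, ← hy]
      rfl
    | mul p q _ _ h1 h2 =>
      obtain ⟨x, hx⟩ := h1
      obtain ⟨y, hy⟩ := h2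
      refine ⟨x * y, fun f => ?_⟩
      rw [map_mul, Module.End.mul_apply, Module.End.mul_apply, hx, hy]
  have hunit : ∀ p ∈ pathPairs (n + 1) (n + 1),
      ∃ x, ∀ f, (Ψ x f : WordFun) = f.1 p.1 • delta p.2 := by
    rintro ⟨w, w'⟩ hp
    obtain ⟨X, hX, h1, h2⟩ := mem_pathPairs.1 hp
    have hw := pathWords_subset_allWords hX.1 hX.2 h1
    rw [mem_pathWords] at h1 h2
    obtain ⟨-, q, hq, hqf⟩ := hadm.exists_matrixUnit hw
      (h1.1.connected h2.1 fun j hj => by rw [h1.2 j hj, h2.2 j hj])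
    obtain ⟨x, hx⟩ := hlift q hq
    exact ⟨x, fun f => by rw [hx, hqf _ f.2]⟩
  refine ⟨Ψ, ?_, hΨ, hunit⟩
  choose x hx using fun p : pathPairs (n + 1) (n + 1) => hunit p.1 p.2
  -- Applying a combination of matrix units to the delta function at `p.1` and evaluating at `p.2`
  -- isolates the coefficient of `p`. There are `(n+1)!` units, the dimension of the group algebra,
  -- so they form a basis and the same computation shows that `Ψ` is injective.
  have hcoeff : ∀ c : pathPairs (n + 1) (n + 1) → ℂ, Ψ (∑ p, c p • x p) = 0 → ∀ p, c p = 0 := by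
    intro c hc p
    obtain ⟨X, hX, h1, h2⟩ := mem_pathPairs.1 p.2
    have hw := pathWords_subset_allWords hX.1 hX.2 h1
    have h3 := congrFun (congrArg Subtype.val
      (LinearMap.congr_fun hc ⟨delta p.1.1, delta_mem hw⟩)) p.1.2
    rw [map_sum, LinearMap.sum_apply, AddSubmonoidClass.coe_finsetSum, Finset.sum_apply,
      sum_eq_single p] at h3
    · rw [map_smul, LinearMap.smul_apply, Submodule.coe_smul, hx] at h3
      simpa using h3
    · intro q _ hq
      rw [map_smul, LinearMap.smul_apply, Submodule.coe_smul, hx]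
      simp only [Pi.smul_apply, smul_eq_mul]
      by_cases hq1 : q.1.1 = p.1.1
      · rw [delta_of_ne (w := q.1.2), mul_zero, mul_zero]
        exact fun hq2 => hq (Subtype.ext (Prod.ext hq1 hq2.symm))
      · rw [delta_of_ne hq1, zero_mul, mul_zero]
    · exact fun h => absurd (mem_univ p) h
  have hli : LinearIndependent ℂ x := Fintype.linearIndependent_iff.2 fun c hc =>
    hcoeff c (by rw [hc, map_zero])
  have hcard : Fintype.card (pathPairs (n + 1) (n + 1)) =
      Module.finrank ℂ (MonoidAlgebra ℂ (Equiv.Perm (Fin (n + 1)))) := by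
    rw [Fintype.card_coe, card_pathPairs le_rfl,
      Module.finrank_eq_card_basis (MonoidAlgebra.basis _ ℂ), Fintype.card_perm, Fintype.card_fin]
  have : Nonempty (pathPairs (n + 1) (n + 1)) := by
    rw [nonempty_coe_sort, ← card_pos, card_pathPairs le_rfl]
    exact Nat.factorial_pos _
  have hspan := hli.span_eq_top_of_card_eq_finrank hcard
  rw [injective_iff_map_eq_zero]
  intro y hy
  obtain ⟨c, rfl⟩ := (Submodule.mem_span_range_iff_exists_fun ℂ).1
    (hspan ▸ Submodule.mem_top : y ∈ Submodule.span ℂ (Set.range x))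
  exact sum_eq_zero fun p _ => by rw [hcoeff c hy p, zero_smul]

/-- Every irreducible representation of `S_{n+1}` is given by Young's orthogonal form. -/
theorem exists_orthogonalForm {n : ℕ} {V : Type*} [AddCommGroup V] [Module ℂ V]
    (ρ : Representation ℂ (Equiv.Perm (Fin (n + 1))) V) (hρ : ρ.IsIrreducible) :
    ∃ X : Finset ℕ, ∃ θ : supp (pathWords (n + 1) X) ≃ₗ[ℂ] V,
      ∀ (i : Fin n) (f g : supp (pathWords (n + 1) X)), (g : WordFun) = youngOp i f →
        θ g = ρ (Equiv.swap i.castSucc i.succ) (θ f) := by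
  classical
  obtain ⟨Ψ, hinj, hs, hunit⟩ := exists_groupAlgebra_matrixUnits n
  choose! x hx using hunit
  obtain ⟨v, hv⟩ : ∃ v : V, v ≠ 0 := by
    by_contra! hcon
    have h1 : (⊥ : Subrepresentation ρ) = ⊤ := by
      refine SetLike.ext fun v => ?_
      rw [hcon v]
      exact ⟨fun _ => trivial, fun _ => Submodule.zero_mem _⟩
    exact bot_ne_top h1
  have hdiag : ∀ w ∈ allWords (n + 1) (n + 1), (w, w) ∈ pathPairs (n + 1) (n + 1) := fun w hw => by
    obtain ⟨X, h1, h2⟩ := mem_allWords.1 hw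
    exact mem_pathPairs.2 ⟨X, h1, h2, h2⟩
  -- The diagonal matrix units sum to the identity, so one of them does not annihilate `v`.
  obtain ⟨w, hw, hwv⟩ : ∃ w ∈ allWords (n + 1) (n + 1), ρ.asAlgebraHom (x (w, w)) v ≠ 0 := by
    by_contra! hcon
    have h1 : ∑ w ∈ allWords (n + 1) (n + 1), x (w, w) = 1 := by
      refine hinj (LinearMap.ext fun f => Subtype.ext ?_)
      rw [map_sum, LinearMap.sum_apply, AddSubmonoidClass.coe_finsetSum, map_one,
        Module.End.one_apply]
      conv_rhs => rw [← sum_smul_delta f.2]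
      exact sum_congr rfl fun w hw => hx _ (hdiag w hw) f
    refine hv ?_
    have h2 : ρ.asAlgebraHom 1 v = v := by rw [map_one, Module.End.one_apply]
    rw [← h2, ← h1, map_sum, LinearMap.sum_apply]
    exact sum_eq_zero hcon
  obtain ⟨X, hX, hwX⟩ := mem_allWords.1 hw
  have hsub : pathWords (n + 1) X ⊆ allWords (n + 1) (n + 1) := pathWords_subset_allWords hX.1 hX.2
  have hpair : ∀ u ∈ pathWords (n + 1) X, ∀ u' ∈ pathWords (n + 1) X,
      (u, u') ∈ pathPairs (n + 1) (n + 1) := fun u hu u' hu' => mem_pathPairs.2 ⟨X, hX, hu, hu'⟩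
  -- The matrix units with source `w` span a left ideal isomorphic to the functions on paths ending
  -- in `X`. Letting it act on `v` gives the intertwiner `θ`.
  let z : supp (pathWords (n + 1) X) →ₗ[ℂ] MonoidAlgebra ℂ (Equiv.Perm (Fin (n + 1))) :=
    { toFun := fun f => ∑ u ∈ pathWords (n + 1) X, f.1 u • x (w, u)
      map_add' := fun f g => by
        simp only [Submodule.coe_add, Pi.add_apply, add_smul, sum_add_distrib]
      map_smul' := fun c f => by
        simp only [Submodule.coe_smul, Pi.smul_apply, smul_eq_mul, mul_smul, smul_sum,
          RingHom.id_apply] }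
  have hz : ∀ f h, (Ψ (z f) h : WordFun) = h.1 w • f.1 := by
    intro f h
    change (Ψ (∑ u ∈ pathWords (n + 1) X, f.1 u • x (w, u)) h : WordFun) = _
    rw [map_sum, LinearMap.sum_apply, AddSubmonoidClass.coe_finsetSum]
    conv_rhs => rw [← sum_smul_delta f.2, smul_sum]
    refine sum_congr rfl fun u hu => ?_
    rw [map_smul, LinearMap.smul_apply, Submodule.coe_smul, hx _ (hpair w hwX u hu), smul_comm]
  let θ : supp (pathWords (n + 1) X) →ₗ[ℂ] V :=
    (LinearMap.applyₗ v).comp (ρ.asAlgebraHom.toLinearMap.comp z)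
  have hθ : ∀ f, θ f = ρ.asAlgebraHom (z f) v := fun _ => rfl
  have hequiv : ∀ (i : Fin n) (f g : supp (pathWords (n + 1) X)), (g : WordFun) = youngOp i f →
      θ g = ρ (Equiv.swap i.castSucc i.succ) (θ f) := by
    intro i f g hg
    rw [hθ, hθ, ← ρ.asAlgebraHom_of, ← Module.End.mul_apply, ← map_mul]
    congr 2
    refine hinj (LinearMap.ext fun h => Subtype.ext ?_)
    rw [hz, map_mul, Module.End.mul_apply, hs, hz, map_smul, hg]
  have hθinj : Function.Injective θ := by
    rw [injective_iff_map_eq_zero]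
    intro f hf
    refine Subtype.ext (funext fun u => ?_)
    by_cases hu : u ∈ pathWords (n + 1) X
    -- The unit from `u` back to `w` extracts the coefficient `f u`. If `θ f = 0`, this coefficient
    -- times a nonzero vector vanishes.
    · have h1 : x (u, w) * z f = f.1 u • x (w, w) := by
        refine hinj (LinearMap.ext fun h => Subtype.ext ?_)
        rw [map_mul, Module.End.mul_apply, hx _ (hpair u hu w hwX), hz, map_smul,
          LinearMap.smul_apply, Submodule.coe_smul, hx _ (hpair w hwX w hwX), Pi.smul_apply,
          smul_eq_mul, mul_comm, mul_smul]
      have h2 := congrArg (fun y => ρ.asAlgebraHom y v) h1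
      simp only [map_mul, Module.End.mul_apply, map_smul, LinearMap.smul_apply] at h2
      rw [← hθ, hf, map_zero] at h2
      exact (smul_eq_zero.1 h2.symm).resolve_right hwv
    · exact f.2 u hu
  have hθsurj : Function.Surjective θ := by
    have hinv := mem_of_swap_mem ρ (LinearMap.range θ) (by
      rintro i _ ⟨f, rfl⟩
      exact ⟨⟨youngOp i f, (admissible_pathWords X (Nat.le_succ n) le_rfl).youngOp_mem
        (by omega) f.2⟩, hequiv i _ _ rfl⟩)
    let R : Subrepresentation ρ := ⟨LinearMap.range θ, fun σ _ hu => hinv σ _ hu⟩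
    rcases hρ.eq_bot_or_eq_top R with h | h
    · exfalso
      have h1 : θ ⟨delta w, delta_mem hwX⟩ ∈ R := ⟨_, rfl⟩
      rw [h] at h1
      have h2 : θ ⟨delta w, delta_mem hwX⟩ = 0 := h1
      have h3 := congrFun (congrArg Subtype.val (hθinj (h2.trans (map_zero θ).symm))) w
      simp at h3
    · intro u
      have : u ∈ R := by
        rw [h]
        trivial
      exact this
  exact ⟨X, LinearEquiv.ofBijective θ ⟨hθinj, hθsurj⟩, hequiv⟩

end Classification

/-! ### Restriction to `S_n` -/

section Restriction

theorem toRepresentation_isIrreducible_iff {G V : Type*} [Group G] [AddCommGroup V] [Module ℂ V]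
    {σ : Representation ℂ G V} (W : Subrepresentation σ) :
    W.toRepresentation.IsIrreducible ↔ W.toSubmodule ≠ ⊥ ∧ ∀ U : Subrepresentation σ,
      U.toSubmodule ≤ W.toSubmodule → U.toSubmodule = ⊥ ∨ U.toSubmodule = W.toSubmodule := by
  constructor
  · intro h
    refine ⟨fun hW => ?_, fun U hU => ?_⟩
    · refine bot_ne_top (α := Subrepresentation W.toRepresentation) (SetLike.ext fun v => ?_)
      have hv : v = 0 := Subtype.ext ((Submodule.mem_bot ℂ).1 (hW ▸ v.2))
      rw [hv]
      exact ⟨fun _ => trivial, fun _ => Submodule.zero_mem _⟩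
    · let A : Subrepresentation W.toRepresentation :=
        ⟨U.toSubmodule.comap W.toSubmodule.subtype, fun g v hv =>
          U.apply_mem_toSubmodule g hv⟩
      have hA : ∀ v : W.toSubmodule, v ∈ A ↔ v.1 ∈ U.toSubmodule := fun _ => Iff.rfl
      rcases h.eq_bot_or_eq_top A with h1 | h1
      · refine Or.inl ((Submodule.eq_bot_iff _).2 fun v hv => ?_)
        have h2 := (hA ⟨v, hU hv⟩).2 hv
        rw [h1] at h2
        exact congrArg Subtype.val ((Submodule.mem_bot ℂ).1 h2)
      · refine Or.inr (le_antisymm hU fun v hv => ?_)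
        refine (hA ⟨v, hv⟩).1 ?_
        rw [h1]
        trivial
  · rintro ⟨h1, h2⟩
    obtain ⟨v, hv, hv0⟩ := Submodule.exists_mem_ne_zero_of_ne_bot h1
    refine { exists_pair_ne := ⟨⊥, ⊤, fun h => ?_⟩, eq_bot_or_eq_top := fun A => ?_ }
    · have : (⟨v, hv⟩ : W.toSubmodule) ∈ (⊥ : Subrepresentation W.toRepresentation) := by
        rw [h]
        trivial
      exact hv0 (congrArg Subtype.val ((Submodule.mem_bot ℂ).1 this))
    · let U : Subrepresentation σ := ⟨A.toSubmodule.map W.toSubmodule.subtype, by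
        rintro g _ ⟨u, hu, rfl⟩
        exact ⟨_, A.apply_mem_toSubmodule g hu, rfl⟩⟩
      have hU : ∀ u : W.toSubmodule, u.1 ∈ U.toSubmodule ↔ u ∈ A := fun u => by
        constructor
        · rintro ⟨u', hu', h⟩
          rwa [← Subtype.ext h]
        · exact fun h => ⟨u, h, rfl⟩
      rcases h2 U (Submodule.map_subtype_le _ _) with h3 | h3
      · refine Or.inl (SetLike.ext fun u => ?_)
        rw [← hU, h3, Submodule.mem_bot]
        exact ⟨fun h => (Submodule.mem_bot ℂ).2 (Subtype.ext h),
          fun h => congrArg Subtype.val ((Submodule.mem_bot ℂ).1 h)⟩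
      · refine Or.inr (SetLike.ext fun u => ?_)
        rw [← hU, h3]
        exact ⟨fun _ => trivial, fun _ => u.2⟩

theorem permIncl_swap {n : ℕ} (i : Fin n) (hi : i.1 + 1 < n) :
    permIncl n (Equiv.swap i ⟨i + 1, hi⟩) = Equiv.swap i.castSucc i.succ := by
  have hsucc : i.succ = (⟨i + 1, hi⟩ : Fin n).castSucc := rfl
  refine Equiv.ext fun x => ?_
  induction x using Fin.lastCases with
  | last =>
    rw [permIncl, Equiv.Perm.viaEmbeddingHom_apply, Equiv.Perm.viaEmbedding_apply_of_notMem,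
      Equiv.swap_apply_of_ne_of_ne]
    · exact (Fin.castSucc_lt_last i).ne'
    · rw [hsucc]
      exact (Fin.castSucc_lt_last _).ne'
    · rintro ⟨y, hy⟩
      exact (Fin.castSucc_lt_last y).ne hy
  | cast y =>
    have h := Equiv.Perm.viaEmbedding_apply (Equiv.swap i ⟨i + 1, hi⟩) Fin.castSuccEmb y
    rw [permIncl, Equiv.Perm.viaEmbeddingHom_apply]
    refine h.trans ?_
    rw [hsucc]
    exact (Fin.castSucc_injective n).map_swap _ _ _

variable {n : ℕ} {V : Type*} [AddCommGroup V] [Module ℂ V]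

theorem mem_of_swap_mem_permIncl (ρ : Representation ℂ (Equiv.Perm (Fin (n + 1))) V)
    (W : Submodule ℂ V)
    (h : ∀ i : Fin n, i.1 + 1 < n → ∀ v ∈ W, ρ (Equiv.swap i.castSucc i.succ) v ∈ W)
    (σ : Equiv.Perm (Fin n)) : ∀ v ∈ W, ρ.comp (permIncl n) σ v ∈ W := by
  rcases n with _ | n
  · rw [Subsingleton.elim σ 1]
    simp
  · refine mem_of_swap_mem (ρ.comp (permIncl (n + 1))) W (fun i v hv => ?_) σ
    have h1 := permIncl_swap i.castSucc (by simp)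
    have h2 := h i.castSucc (by simp) v hv
    rw [← h1] at h2
    exact h2

/-- The words in `pathWords (n + 1) X` that end in `a`. -/
noncomputable def endWords (n : ℕ) (X : Finset ℕ) (a : ℕ) : Finset (ℕ → ℕ) :=
  (pathWords (n + 1) X).filter fun w => w n = a

theorem mem_endWords {X : Finset ℕ} {a : ℕ} {w : ℕ → ℕ} :
    w ∈ endWords n X a ↔ w ∈ pathWords (n + 1) X ∧ w n = a := mem_filter

theorem endWords_subset (X : Finset ℕ) (a : ℕ) : endWords n X a ⊆ pathWords (n + 1) X :=
  filter_subset _ _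

theorem card_endWords {X : Finset ℕ} {a : ℕ} (ha : a ∈ dn 1 X) :
    (endWords n X a).card = cnt n (slide 1 a X) := by
  rw [mem_dn] at ha
  rw [← card_pathWords]
  refine card_bij' (fun w _ => Function.update w n 0) (fun w _ => Function.update w n a)
    (fun w hw => ?_) (fun w hw => ?_) (fun w hw => ?_) (fun w hw => ?_)
  · obtain ⟨hw', rfl⟩ := mem_endWords.1 hw
    rw [mem_pathWords] at hw' ⊢
    refine ⟨(path_congr fun i hi => ?_).1 hw'.1.2.2, fun j hj => ?_⟩
    · rw [Function.update_of_ne (by omega)]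
    · rcases eq_or_ne j n with rfl | hjn
      · rw [Function.update_self]
      · rw [Function.update_of_ne hjn, hw'.2 j (by omega)]
  · rw [mem_pathWords] at hw
    rw [mem_endWords, mem_pathWords, Path, Function.update_self]
    refine ⟨⟨⟨ha.1, ha.2, (path_congr fun i hi => ?_).1 hw.1⟩, fun j hj => ?_⟩, rfl⟩
    · rw [Function.update_of_ne (by omega)]
    · rw [Function.update_of_ne (by omega), hw.2 j (by omega)]
  · rw [Function.update_idem, ← (mem_endWords.1 hw).2, Function.update_eq_self]
  · rw [Function.update_idem, ← (mem_pathWords.1 hw).2 n le_rfl, Function.update_eq_self]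

theorem admissible_endWords (X : Finset ℕ) (a : ℕ) : Admissible n (endWords n X a) := by
  have h := admissible_pathWords (n := n) X le_rfl (Nat.le_succ n)
  have hs : ∀ w ∈ endWords n X a, w ∈ pathWords (n + 1) X := endWords_subset X a
  refine ⟨fun w hw i hi hsw => mem_endWords.2 ⟨h.swap_mem w (hs w hw) i hi hsw, ?_⟩,
    fun w hw => h.ne_succ w (hs w hw), fun w hw => h.ne_succ_succ w (hs w hw),
    fun h0 => (h.exists_head_eq h0).imp fun c hc w hw => hc w (hs w hw),
    fun w hw w' hw' => h.eq_of_agree w (hs w hw) w' (hs w' hw')⟩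
  rw [swapWord_of_ne _ (by omega) (by omega), (mem_endWords.1 hw).2]

/-- A subspace of functions that is invariant under `S_n` and contains a function which is not
zero at `w` contains all functions supported on the words that end like `w`. -/
theorem delta_mem_of_invariant {X : Finset ℕ} {U : Submodule ℂ WordFun}
    (hU : U ≤ supp (pathWords (n + 1) X)) (hinv : ∀ i, i + 1 < n → ∀ f ∈ U, youngOp i f ∈ U)
    {f : WordFun} (hf : f ∈ U) {w : ℕ → ℕ} (hfw : f w ≠ 0) :
    w ∈ pathWords (n + 1) X ∧ supp (endWords n X (w n)) ≤ U := by
  have hw : w ∈ pathWords (n + 1) X := by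
    by_contra h
    exact hfw (hU hf w h)
  refine ⟨hw, fun g hg => ?_⟩
  have halg : ∀ p ∈ youngAlg n, ∀ f ∈ U, p f ∈ U := by
    intro p hp
    induction hp using Algebra.adjoin_induction with
    | mem p hp =>
      obtain ⟨i, hi, rfl⟩ := hp
      exact hinv i hi
    | algebraMap r => exact fun f hf => U.smul_mem r hf
    | add p q _ _ h1 h2 => exact fun f hf => U.add_mem (h1 f hf) (h2 f hf)
    | mul p q _ _ h1 h2 => exact fun f hf => h1 _ (h2 f hf)
  rw [← sum_smul_delta hg]
  refine U.sum_mem fun w' hw' => U.smul_mem _ ?_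
  obtain ⟨hw', hn⟩ := mem_endWords.1 hw'
  have hP := mem_pathWords.1 hw
  have hP' := mem_pathWords.1 hw'
  obtain ⟨-, p, hp, hpf⟩ := (admissible_pathWords X le_rfl (Nat.le_succ n)).exists_matrixUnit hw
    (hP.1.2.2.connected (by rw [← hn]; exact hP'.1.2.2) fun j hj => by
      rcases Nat.eq_or_lt_of_le hj with rfl | hj
      · exact hn.symm
      · rw [hP.2 j hj, hP'.2 j hj])
  have h1 := halg p hp f hf
  rw [hpf f (hU hf)] at h1
  exact (U.smul_mem_iff hfw).1 h1

/-- Restriction of odd-dimensional irreducible representations from `S_{n+1}` to `S_n`. -/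
theorem existsUnique_odd_subrepresentation
    (ρ : Representation ℂ (Equiv.Perm (Fin (n + 1))) V) (hρ : ρ.IsIrreducible)
    (hodd : Odd (Module.finrank ℂ V)) :
    ∃! W : Subrepresentation (ρ.comp (permIncl n)),
      W.toRepresentation.IsIrreducible ∧ Odd (Module.finrank ℂ W.toSubmodule) := by
  obtain ⟨X, θ, hθ⟩ := exists_orthogonalForm ρ hρ
  rw [← θ.finrank_eq, finrank_supp, card_pathWords] at hodd
  obtain ⟨Y, ⟨⟨c, hc1, hc2, rfl⟩, hcodd⟩, huniq⟩ := existsUnique_odd_rem n X hodd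
  have hadm := admissible_pathWords (n := n) X (Nat.le_succ n) le_rfl
  -- The functions on paths whose last move starts at `a`. The generators of `S_n` leave the last
  -- letter alone, so this is invariant.
  let comp : ℕ → Submodule ℂ V := fun a =>
    ((supp (endWords n X a)).comap (supp (pathWords (n + 1) X)).subtype).map θ.toLinearMap
  have hcomp : ∀ a, ∀ f : supp (pathWords (n + 1) X),
      θ f ∈ comp a ↔ f.1 ∈ supp (endWords n X a) := fun a f => by
    constructor
    · rintro ⟨g, hg, h⟩
      rwa [← θ.injective h]
    · exact fun h => ⟨f, h, rfl⟩
  have hcinv : ∀ a σ, ∀ v ∈ comp a, ρ.comp (permIncl n) σ v ∈ comp a := by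
    intro a
    refine mem_of_swap_mem_permIncl ρ _ fun i hi v hv => ?_
    obtain ⟨f, rfl⟩ := θ.surjective v
    rw [← hθ i f ⟨youngOp i f, hadm.youngOp_mem (by omega) f.2⟩ rfl, hcomp]
    exact (admissible_endWords X a).youngOp_mem hi ((hcomp a f).1 hv)
  have hfin : ∀ a ∈ dn 1 X, Module.finrank ℂ (comp a) = cnt n (slide 1 a X) := by
    intro a ha
    rw [LinearEquiv.finrank_map_eq,
      (Submodule.comapSubtypeEquivOfLe (supp_mono (endWords_subset X a))).finrank_eq,
      finrank_supp, card_endWords ha]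
  -- A nonzero invariant subspace contains a function not vanishing at some path, and the matrix
  -- units of `S_n` then produce every path with the same last move. So it contains a whole
  -- component, and the only component it can lie in is that one.
  have hle : ∀ W : Subrepresentation (ρ.comp (permIncl n)), W.toSubmodule ≠ ⊥ →
      ∃ a ∈ dn 1 X, comp a ≤ W.toSubmodule ∧ comp a ≠ ⊥ ∧ ∀ b, W.toSubmodule ≤ comp b → b = a := by
    intro W hW
    obtain ⟨v, hv, hv0⟩ := Submodule.exists_mem_ne_zero_of_ne_bot hW
    obtain ⟨f, rfl⟩ := θ.surjective v
    obtain ⟨w, hfw⟩ : ∃ w, f.1 w ≠ 0 := by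
      by_contra! hcon
      exact hv0 (by rw [show f = 0 from Subtype.ext (funext hcon), map_zero])
    let U : Submodule ℂ WordFun :=
      (W.toSubmodule.comap θ.toLinearMap).map (supp (pathWords (n + 1) X)).subtype
    obtain ⟨hw, hwU⟩ := delta_mem_of_invariant (U := U) (Submodule.map_subtype_le _ _) (by
      rintro i hi _ ⟨g, hg, rfl⟩
      refine ⟨⟨youngOp i g, hadm.youngOp_mem (by omega) g.2⟩, ?_, rfl⟩
      have h1 := W.apply_mem_toSubmodule (Equiv.swap ⟨i, by omega⟩ ⟨i + 1, hi⟩) hg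
      rw [MonoidHom.comp_apply, permIncl_swap ⟨i, by omega⟩ hi] at h1
      change θ _ ∈ W.toSubmodule
      rw [hθ ⟨i, by omega⟩ g _ rfl]
      exact h1)
      ⟨f, hv, rfl⟩ hfw
    have hP := (mem_pathWords.1 hw).1
    refine ⟨w n, mem_dn.2 ⟨hP.1, hP.2.1⟩, ?_, fun h0 => ?_, fun b hb => ?_⟩
    · rintro _ ⟨g, hg, rfl⟩
      obtain ⟨g', hg', h⟩ := hwU hg
      rwa [← show g' = g from Subtype.ext h]
    · have h1 := (hcomp (w n) ⟨delta w, delta_mem hw⟩).2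
        (delta_mem (mem_endWords.2 ⟨hw, rfl⟩))
      rw [h0, Submodule.mem_bot, LinearEquiv.map_eq_zero_iff] at h1
      have h2 := congrFun (congrArg Subtype.val h1) w
      simp at h2
    · by_contra hne
      exact hfw ((hcomp b f).1 (hb hv) w fun h => hne (mem_endWords.1 h).2.symm)
  let W₀ : Subrepresentation (ρ.comp (permIncl n)) := ⟨comp c, fun σ v hv => hcinv c σ v hv⟩
  have hW₀ : Odd (Module.finrank ℂ W₀.toSubmodule) := by
    rw [show W₀.toSubmodule = comp c from rfl, hfin c (mem_dn.2 ⟨hc1, hc2⟩)]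
    exact hcodd
  refine ⟨W₀, ⟨(toRepresentation_isIrreducible_iff _).2 ⟨fun h => ?_, fun U hU => ?_⟩, hW₀⟩, ?_⟩
  · rw [h, finrank_bot] at hW₀
    exact Nat.not_odd_zero hW₀
  · refine or_iff_not_imp_left.2 fun hU0 => ?_
    obtain ⟨a, -, h1, -, h2⟩ := hle U hU0
    obtain rfl := h2 c hU
    exact le_antisymm hU h1
  · rintro W ⟨hW, hWodd⟩
    rw [toRepresentation_isIrreducible_iff] at hW
    obtain ⟨a, ha, h1, h2, -⟩ := hle W hW.1
    have h3 : comp a = W.toSubmodule :=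
      (hW.2 ⟨comp a, fun σ v hv => hcinv a σ v hv⟩ h1).resolve_left h2
    rw [← h3, hfin a ha] at hWodd
    have ha' := mem_dn.1 ha
    have h4 := huniq _ ⟨⟨a, ha'.1, ha'.2, rfl⟩, hWodd⟩
    have h5 : a = c := by
      have : a ∈ slide 1 c X := h4 ▸ mem_slide.2 (Or.inl rfl)
      rw [mem_slide] at this
      grind
    refine Subrepresentation.toSubmodule_injective ?_
    rw [← h3, h5]

end Restriction

end Macdonald

theorem mainTheorem4 :
    -- `M` is a binary tree rooted at the empty partition, and the parent of a nonempty odd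
    -- partition is the unique odd partition that it covers
    IsRootedBinaryTree tree root ∧
    (∀ μ : YoungDiagram, IsOddPartition μ → μ ≠ ⊥ →
      ∃! ν : YoungDiagram, IsOddPartition ν ∧ ν ⋖ μ) ∧
    -- `M_2`
    (∃ φ : sixTree ≃g truncTree 2, ∀ i : Fin 6,
      (φ i).1.rowLens = (![[], [1], [2], [1, 1], [3], [1, 1, 1]] : Fin 6 → List ℕ) i) ∧
    -- the passage from `M_k` to `M_{k+1}`
    (∀ k : ℕ, 2 ≤ k →
      ∃ φ : attachTwoCopies (truncTree k) (truncRoot k) (topHooks k) ≃g truncTree (k + 1),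
        (∀ v : Vert k, (φ (Sum.inl v)).1 = v.1) ∧
        (∀ x, φ x ∈ topHooks (k + 1) ↔
          ∃ s : topHooks k, s.1 ∈ topOneDims k ∧ ∃ u ∈ topHooks k, x = Sum.inr (s, 0, u)) ∧
        (∀ x, φ x ∈ topOneDims (k + 1) →
          ∃ s : topHooks k, s.1 ∈ topOneDims k ∧ ∃ u ∈ topOneDims k, x = Sum.inr (s, 0, u)) ∧
        (∀ s : topHooks k, s.1 ∈ topOneDims k →
          ∃! u : Vert k, u ∈ topOneDims k ∧ φ (Sum.inr (s, 0, u)) ∈ topOneDims (k + 1))) ∧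
    -- restriction of odd-dimensional irreducible representations from `S_{n+1}` to `S_n`
    (∀ (n : ℕ) (V : Type*) [AddCommGroup V] [Module ℂ V]
      (ρ : Representation ℂ (Equiv.Perm (Fin (n + 1))) V),
      ρ.IsIrreducible → Odd (Module.finrank ℂ V) →
      ∃! W : Subrepresentation (ρ.comp (permIncl n)),
        W.toRepresentation.IsIrreducible ∧ Odd (Module.finrank ℂ W.toSubmodule)) := by
  exact ⟨isRootedBinaryTree_tree, fun _ => existsUnique_odd_covBy, exists_sixTree_iso,
    fun _ hk => exists_iso_attachTwoCopies hk,
    fun _ _ _ _ ρ hρ hV => existsUnique_odd_subrepresentation ρ hρ hV⟩
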